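/- **Setting.** Let $E_j=i\lambda_j/\sqrt2$ ($\lambda_1,\dots,\lambda_8$ the Gell-Mann matrices) be the orthonormal basis of $\mathfrak{su}(3)$ for $\langle X|Y\rangle=\mathrm{tr}(X^\dagger Y)$, with coordinates $x_1,\dots,x_8$ and structure constants $[E_k,E_j]=\sum_l c_{kj}^lE_l$. The space $Poly(\mathfrak{su}(3))$ of complex polynomials on $\mathfrak{su}(3)$ carries the Poisson bracket $\{F,G\}=\sum_{j,k,l}c^l_{kj}\,x_l\,\partial_jF\,\partial_kG$. Dominant weights are the matrices $p\varpi_1+q\varpi_2$ ($p,q\in\mathbb N_0$), where $\varpi_1=\tfrac1{\sqrt2}E_3+\tfrac1{\sqrt6}E_8$ and $\varpi_2=\sqrt{\tfrac23}E_8$; a weight $\omega$ is identified with the functional $H\mapsto\mathrm{tr}(H(-i\omega))$ on diagonal traceless matrices. Let $\overline{\mathcal Q}$ be the set of $\xi=\sqrt{3/2}\,(x\varpi_1+y\varpi_2)$ with $x,y\ge0$, $x^2+xy+y^2=1$, such that $R\xi$ is a dominant weight for some $R>0$. For $\xi\in\overline{\mathcal Q}$ let $r(\xi)=\min\{R>0: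 R\xi\text{ is a dominant weight}\}$ and $\omega_\xi=r(\xi)\xi$, let $\mathcal O_\xi=\{g\xi g^{-1}:g\in SU(3)\}$ and let $Poly(\mathcal O_\xi)$ be the algebra of restrictions to $\mathcal O_\xi$ of polynomials on $\mathfrak{su}(3)$, with the supremum norm and the Poisson bracket $\{F|_{\mathcal O_\xi},G|_{\mathcal O_\xi}\}=\{F,G\}|_{\mathcal O_\xi}$. *Correspondences.* Let $\mathcal H_\omega$ be a unitary irreducible representation of $SU(3)$ with highest weight $\omega$, and $\rho_\omega:U(\mathfrak{sl}(3))\to\mathcal B(\mathcal H_\omega)$ the induced representation. A symbol correspondence is an injective linear map $W:\mathcal B(\mathcal H_\omega)\to Poly(\mathcal O_\xi)$ that is $SU(3)$-equivariant, real ($W_{A^\dagger}=\overline{W_A}$) and normalized ($\int_{\mathcal O_\xi}W_A=\mathrm{tr}(A)/\dim\mathcal H_\omega$ for the invariant probability measure). A $\xi$-ray of universal correspondences is a sequence of maps $w^s_\xi=W^s\circ\rho_{s\omega_\xi}:U(\mathfrak{sl}(3))\to Poly(\mathcal O_\xi)$, $s=1,2,\dots$, with $W^s$ a symbol correspondence for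 $\mathcal H_{s\omega_\xi}$. It induces on the image of $w^s_\xi$ the twisted product $w^s_\xi[u]\star^s_\xi w^s_\xi[v]=w^s_\xi[uv]$; every $f\in Poly(\mathcal O_\xi)$ lies in this image for all large $s$. The ray is of *Poisson type* if, for all $f_1,f_2\in Poly(\mathcal O_\xi)$, uniformly on $\mathcal O_\xi$ as $s\to\infty$, $$f_1\star^s_\xi f_2\to f_1f_2,\qquad s\,r(\xi)\,\big(f_1\star^s_\xi f_2-f_2\star^s_\xi f_1\big)\to i\{f_1,f_2\}.$$ *Degree and $\beta_d$.* Let $(e_1,\dots,e_8)=(T_-,-U_-,V_-,-T_+,U_+,V_+,-\sqrt2\,U_3,\sqrt{2/3}\,(2T_3+U_3))$ be the ordered basis of $\mathfrak{sl}(3)$, where $T_+,U_+,V_+$ are the matrix units $E_{12},E_{23},E_{13}$, $T_-,U_-,V_-$ their transposes, $T_3=\frac12\mathrm{diag}(1,-1,0)$ and $U_3=\frac12\mathrm{diag}(0,1,-1)$. By the Poincaré–Birkhoff–Witt theorem the ordered monomials $e_{j_1}\cdots e_{j_d}$, $j_1\le\dots\le j_d$, $d\ge0$, form a basis of $U(\mathfrak{sl}(3))$;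 let $U_d$ be the span of those of length $d$, $\pi_d$ the projection onto $U_d$, $\deg u$ the least $d$ with $u\in U_0\oplus\dots\oplus U_d$, $\beta:U(\mathfrak{sl}(3))\to Poly(\mathfrak{sl}(3))\equiv Poly(\mathfrak{su}(3))$ the linear map with $\beta[e_{j_1}\cdots e_{j_d}](X)=\mathrm{tr}(e_{j_1}X)\cdots\mathrm{tr}(e_{j_d}X)$ on ordered monomials, and $\beta_d[u]=\beta[\pi_d(u)]$. **Theorem.** Let $\xi\in\overline{\mathcal Q}$ and let $(w^s_\xi)_{s\ge1}$ be a $\xi$-ray of universal correspondences. Then $(w^s_\xi)$ is of Poisson type if and only if $$\lim_{s\to\infty}(s\,r(\xi))^{-\deg u}\,w^s_\xi[u]=(-i)^{\deg u}\,\beta_{\deg u}[u]\big|_{\mathcal O_\xi}\quad\text{uniformly on }\mathcal O_\xi,\ \text{ for every }u\in U(\mathfrak{sl}(3)).$$ -/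

import Mathlib

open Matrix Filter Topology

attribute [local instance 100] LieRing.ofAssociativeRing

noncomputable section

/-! ## The group `SU(3)`, the Lie algebras `su(3) ⊂ sl(3)`, bases -/

/-- Complex `3 × 3` matrices. -/
abbrev Mat3 : Type := Matrix (Fin 3) (Fin 3) ℂ

/-- The group `SU(3)`. -/
abbrev SU3 : Type := Matrix.specialUnitaryGroup (Fin 3) ℂ

/-- The complex Lie algebra `sl(3)` of traceless matrices. -/
abbrev SL3Lie : LieSubalgebra ℂ Mat3 := LieAlgebra.SpecialLinear.sl (Fin 3) ℂ

/-- The universal enveloping algebra `U(sl(3))`. -/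
abbrev USL3 : Type := UniversalEnvelopingAlgebra ℂ SL3Lie

instance SU3.instIsTopologicalGroup : IsTopologicalGroup SU3 where
  continuous_inv := by
    have h : Continuous fun g : SU3 => (star (g : Mat3) : Mat3) :=
      continuous_star.comp continuous_subtype_val
    exact Continuous.subtype_mk h _

instance SU3.instCompactSpace : CompactSpace SU3 := by
  suffices h : IsCompact (Matrix.specialUnitaryGroup (Fin 3) ℂ : Set Mat3) from
    isCompact_iff_compactSpace.mp h
  have hc : IsCompact (Set.pi Set.univ fun _ : Fin 3 => Set.pi Set.univ fun _ : Fin 3 =>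
      Metric.closedBall (0 : ℂ) 1) :=
    isCompact_univ_pi fun _ => isCompact_univ_pi fun _ => isCompact_closedBall 0 1
  refine IsCompact.of_isClosed_subset hc ?_ ?_
  · have h1 : IsClosed {A : Mat3 | star A * A = 1} :=
      isClosed_eq (by fun_prop) continuous_const
    have h2 : IsClosed {A : Mat3 | A * star A = 1} :=
      isClosed_eq (by fun_prop) continuous_const
    have h3 : IsClosed {A : Mat3 | A.det = 1} :=
      isClosed_eq (Continuous.matrix_det continuous_id) continuous_const
    have : (Matrix.specialUnitaryGroup (Fin 3) ℂ : Set Mat3) =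
        ({A : Mat3 | star A * A = 1} ∩ {A : Mat3 | A * star A = 1}) ∩ {A : Mat3 | A.det = 1} := by
      ext A
      rfl
    rw [this]
    exact (h1.inter h2).inter h3
  · intro A hA i _ j _
    have h := entry_norm_bound_of_unitary (Matrix.specialUnitaryGroup_le_unitaryGroup hA) i j
    simpa using h

instance SU3.instMeasurableSpace : MeasurableSpace SU3 := borel SU3

instance SU3.instBorelSpace : BorelSpace SU3 := ⟨rfl⟩

/-- The normalized (total mass one) Haar measure of `SU(3)`. -/
def haarSU3 : MeasureTheory.Measure SU3 := MeasureTheory.Measure.haarMeasure ⊤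

/-- The Gell-Mann matrices `λ₁, …, λ₈` (indexed by `0, …, 7`). -/
def gellMann : Fin 8 → Mat3 :=
  ![!![0, 1, 0; 1, 0, 0; 0, 0, 0],
    !![0, -Complex.I, 0; Complex.I, 0, 0; 0, 0, 0],
    !![1, 0, 0; 0, -1, 0; 0, 0, 0],
    !![0, 0, 1; 0, 0, 0; 1, 0, 0],
    !![0, 0, -Complex.I; 0, 0, 0; Complex.I, 0, 0],
    !![0, 0, 0; 0, 0, 1; 0, 1, 0],
    !![0, 0, 0; 0, 0, -Complex.I; 0, Complex.I, 0],
    ((1 / Real.sqrt 3 : ℝ) : ℂ) • !![1, 0, 0; 0, 1, 0; 0, 0, -2]]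

/-- The orthonormal basis `E_j = i λ_j / √2` of `su(3)`, for the inner product `tr (X† Y)`. -/
def suBasis (j : Fin 8) : Mat3 := (Complex.I / ((Real.sqrt 2 : ℝ) : ℂ)) • gellMann j

/-- The coordinate `x_j(X) = tr (E_j† X)` with respect to the basis `E_1, …, E_8`. -/
def suCoord (X : Mat3) (j : Fin 8) : ℂ := ((suBasis j)ᴴ * X).trace

/-- The matrices of the ordered basis `e_1, …, e_8` of `sl(3)`:
`T₋, -U₋, V₋, -T₊, U₊, V₊, -√2 U₃, √(2/3) (2 T₃ + U₃)`. -/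
def gtMatrix : Fin 8 → Mat3 :=
  ![!![0, 0, 0; 1, 0, 0; 0, 0, 0],
    !![0, 0, 0; 0, 0, 0; 0, -1, 0],
    !![0, 0, 0; 0, 0, 0; 1, 0, 0],
    !![0, -1, 0; 0, 0, 0; 0, 0, 0],
    !![0, 0, 0; 0, 0, 1; 0, 0, 0],
    !![0, 0, 1; 0, 0, 0; 0, 0, 0],
    ((Real.sqrt 2 : ℝ) : ℂ) • !![0, 0, 0; 0, -1 / 2, 0; 0, 0, 1 / 2],
    ((Real.sqrt (2 / 3) : ℝ) : ℂ) • !![1, 0, 0; 0, -1 / 2, 0; 0, 0, -1 / 2]]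

/-- The ordered basis `e_1, …, e_8` as elements of `sl(3)`. -/
def gtBasis (j : Fin 8) : SL3Lie :=
  ⟨gtMatrix j, by
    change (gtMatrix j).trace = 0
    fin_cases j <;> simp [gtMatrix, Matrix.trace_fin_three] <;> ring⟩

/-! ## Dominant weights and rational orbits -/

/-- The fundamental weight `ϖ₁ = E₃ / √2 + E₈ / √6`. -/
def fundWeight₁ : Mat3 :=
  (1 / Real.sqrt 2 : ℝ) • suBasis 2 + (1 / Real.sqrt 6 : ℝ) • suBasis 7

/-- The fundamental weight `ϖ₂ = √(2/3) E₈`. -/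
def fundWeight₂ : Mat3 := (Real.sqrt (2 / 3) : ℝ) • suBasis 7

/-- Dominant weights `p ϖ₁ + q ϖ₂`, `p, q ∈ ℕ₀`. -/
def IsDominantWeight (ω : Mat3) : Prop :=
  ∃ p q : ℕ, ω = (p : ℝ) • fundWeight₁ + (q : ℝ) • fundWeight₂

/-- The intersection of the unit sphere of `su(3)` with the closed principal Weyl chamber: the
points `√(3/2) (x ϖ₁ + y ϖ₂)` with `x, y ≥ 0` and `x² + x y + y² = 1`. -/
def unitChamber : Set Mat3 :=
  {ξ | ∃ x y : ℝ, 0 ≤ x ∧ 0 ≤ y ∧ x ^ 2 + x * y + y ^ 2 = 1 ∧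
    ξ = Real.sqrt (3 / 2) • (x • fundWeight₁ + y • fundWeight₂)}

/-- The points of the unit chamber whose adjoint orbit is rational, i.e. a rescaling of the orbit
of a dominant weight. -/
def rationalPoints : Set Mat3 :=
  {ξ ∈ unitChamber | ∃ R : ℝ, 0 < R ∧ IsDominantWeight (R • ξ)}

/-- The integral radius `r(ξ) = min {R > 0 : R ξ is a dominant weight}`. -/
def integralRadius (ξ : Mat3) : ℝ := sInf {R : ℝ | 0 < R ∧ IsDominantWeight (R • ξ)}

/-- The first dominant weight `ω_ξ = r(ξ) ξ`. -/
def firstDominantWeight (ξ : Mat3) : Mat3 := integralRadius ξ • ξ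

/-! ## Adjoint orbits and polynomials on them -/

/-- The adjoint action `Ad_g X = g X g⁻¹`. -/
def adMat (g : SU3) (X : Mat3) : Mat3 := (g : Mat3) * X * ((g⁻¹ : SU3) : Mat3)

/-- The adjoint orbit `O_ξ`. -/
def adOrbit (ξ : Mat3) : Set Mat3 := Set.range fun g : SU3 => adMat g ξ

/-- The action of `SU(3)` on the orbit `O_ξ`. -/
def adOn {ξ : Mat3} (g : SU3) (x : adOrbit ξ) : adOrbit ξ :=
  ⟨adMat g x, by
    obtain ⟨h, hh⟩ := x.2
    refine ⟨g * h, ?_⟩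
    simp only [← hh, adMat, _root_.mul_inv_rev, Submonoid.coe_mul, mul_assoc]⟩

/-- The base point `ξ` of `O_ξ`. -/
def basePoint (ξ : Mat3) : adOrbit ξ := ⟨ξ, 1, by simp [adMat]⟩

/-- Complex polynomials on `su(3)` (equivalently on `sl(3)`), written in the linear coordinates
`x_1, …, x_8` of the basis `E_1, …, E_8`. -/
abbrev PolySU3 : Type := MvPolynomial (Fin 8) ℂ

/-- Restriction of polynomials to the orbit `O_ξ`. -/
def restrictPoly (ξ : Mat3) : PolySU3 →ₐ[ℂ] (adOrbit ξ → ℂ) :=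
  MvPolynomial.aeval fun j (x : adOrbit ξ) => suCoord x j

/-- The algebra `Poly(O_ξ)` of restrictions to `O_ξ` of polynomials on `su(3)`. -/
def PolyOrbit (ξ : Mat3) : Subalgebra ℂ (adOrbit ξ → ℂ) := (restrictPoly ξ).range

/-- The restriction of a polynomial, as an element of `Poly(O_ξ)`. -/
def resOrbit (ξ : Mat3) (F : PolySU3) : PolyOrbit ξ := ⟨restrictPoly ξ F, F, rfl⟩

/-- The structure constants: `[E_k, E_j] = ∑ l, c^l_{kj} E_l`. -/
def structConst (k j l : Fin 8) : ℂ := suCoord ⁅suBasis k, suBasis j⁆ l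

/-- The Poisson bracket of polynomials on `su(3)` given by the bivector
`∑ c^l_{kj} x_l ∂_j ⊗ ∂_k`. This bivector is tangent to the adjoint orbits, and its restriction to
`O_ξ` is the Poisson bivector of `O_ξ`: the bracket of `F|O_ξ` and `G|O_ξ` is `{F, G}|O_ξ`. -/
def poissonBracket (F G : PolySU3) : PolySU3 :=
  ∑ j : Fin 8, ∑ k : Fin 8, ∑ l : Fin 8,
    MvPolynomial.C (structConst k j l) * MvPolynomial.X l *
      MvPolynomial.pderiv j F * MvPolynomial.pderiv k G

/-! ## Poincaré–Birkhoff–Witt and the maps `β`, `β_d` -/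

/-- The ordered monomial `e_1^{m_1} ⋯ e_8^{m_8}` in `U(sl(3))`. -/
def pbwMonomial (m : Fin 8 →₀ ℕ) : USL3 :=
  (List.ofFn fun j : Fin 8 => UniversalEnvelopingAlgebra.ι ℂ (gtBasis j) ^ m j).prod

/-- The linear map that sends a commutative monomial to the corresponding ordered monomial of
`U(sl(3))`. By the Poincaré–Birkhoff–Witt theorem it is bijective. -/
def pbwMap : MvPolynomial (Fin 8) ℂ →ₗ[ℂ] USL3 :=
  (MvPolynomial.basisMonomials (Fin 8) ℂ).constr ℂ pbwMonomial

/-- The coordinates of `u ∈ U(sl(3))` in the basis of ordered monomials, collected in a polynomial: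
the inverse of the bijection `pbwMap`. -/
def pbwCoords : USL3 → MvPolynomial (Fin 8) ℂ := Function.invFun pbwMap

/-- `U_d(sl(3))`, the span of the ordered monomials of length `d`. -/
def Uhom (d : ℕ) : Submodule ℂ USL3 :=
  Submodule.span ℂ (pbwMonomial '' {m | m.degree = d})

/-- `U_{≤ d}(sl(3))`. -/
def Ule (d : ℕ) : Submodule ℂ USL3 := ⨆ m ∈ Set.Iic d, Uhom m

/-- The degree of `u ∈ U(sl(3))`: the least `d` with `u ∈ U_{≤ d}(sl(3))`. -/
def Udeg (u : USL3) : ℕ := sInf {d | u ∈ Ule d}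

/-- The projection `π_d` of `U(sl(3))` onto `U_d(sl(3))`. -/
def Uproj (d : ℕ) (u : USL3) : USL3 :=
  pbwMap (MvPolynomial.homogeneousComponent d (pbwCoords u))

/-- The linear polynomial `X ↦ (Y, X) = tr (Y X)`, in the coordinates `x_1, …, x_8`. -/
def linPoly (Y : Mat3) : PolySU3 :=
  ∑ k : Fin 8, MvPolynomial.C ((Y * suBasis k).trace) * MvPolynomial.X k

/-- The linear map `β : U(sl(3)) → Poly(sl(3))`, determined by
`β[e_{j_1} ⋯ e_{j_d}](X) = (e_{j_1}, X) ⋯ (e_{j_d}, X)` for `j_1 ≤ ⋯ ≤ j_d`. -/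
def beta (u : USL3) : PolySU3 :=
  MvPolynomial.aeval (fun j => linPoly (gtMatrix j)) (pbwCoords u)

/-- `β_d[u] = β[π_d u]`. -/
def betaHom (d : ℕ) (u : USL3) : PolySU3 := beta (Uproj d u)

/-! ## Quark systems and correspondences -/

/-- A quantum quark system with highest weight `ω`: a continuous irreducible unitary representation
of `SU(3)` of highest weight `ω`, on a Hilbert space `ℂ^dim` (in an orthonormal basis), with the
representation of `sl(3)` that it induces. A weight `ω ∈ su(3)` is identified with the functional
`H ↦ tr (H (-i ω))` on the diagonal matrices. -/
structure QuarkSystem (ω : Mat3) where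
  /-- the dimension -/
  dim : ℕ
  /-- the representation of `SU(3)` -/
  rep : SU3 →* Matrix.unitaryGroup (Fin dim) ℂ
  continuous_rep : Continuous rep
  irreducible : ∀ S : Submodule ℂ (Fin dim → ℂ),
    (∀ g : SU3, ∀ v ∈ S, (rep g : Matrix (Fin dim) (Fin dim) ℂ) *ᵥ v ∈ S) → S = ⊥ ∨ S = ⊤
  /-- the induced representation of `sl(3)` -/
  diff : SL3Lie →ₗ⁅ℂ⁆ Matrix (Fin dim) (Fin dim) ℂ
  /-- on `su(3)`, `diff` is the differential of `rep` -/
  rep_exp : ∀ (X : SL3Lie) (g : SU3), (X : Mat3)ᴴ = -(X : Mat3) →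
    (g : Mat3) = NormedSpace.exp (X : Mat3) →
    (rep g : Matrix (Fin dim) (Fin dim) ℂ) = NormedSpace.exp (diff X)
  /-- there is a highest weight vector: it is annihilated by `T₊`, `U₊`, `V₊` and has weight `ω` -/
  highest_weight : ∃ v : Fin dim → ℂ, v ≠ 0 ∧
    (∀ j ∈ ({3, 4, 5} : Set (Fin 8)), diff (gtBasis j) *ᵥ v = 0) ∧
    (∀ j ∈ ({6, 7} : Set (Fin 8)),
      diff (gtBasis j) *ᵥ v = (gtMatrix j * ((-Complex.I) • ω)).trace • v)

/-- Operators on the Hilbert space of a quark system. -/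
abbrev QuarkSystem.Op {ω : Mat3} (Q : QuarkSystem ω) : Type := Matrix (Fin Q.dim) (Fin Q.dim) ℂ

/-- The irreducible representation `ρ_ω` of `U(sl(3))`. -/
def QuarkSystem.rho {ω : Mat3} (Q : QuarkSystem ω) : USL3 →ₐ[ℂ] Q.Op :=
  UniversalEnvelopingAlgebra.lift ℂ Q.diff

/-- Symbol correspondences `B(H_ω) → Poly(O_ξ)`: injective linear maps that are equivariant, real
and normalized. The integral over `O_ξ` is the one induced by the normalized Haar measure. -/
structure IsSymbolCorrespondence {ω : Mat3} (Q : QuarkSystem ω) (ξ : Mat3)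
    (W : Q.Op →ₗ[ℂ] PolyOrbit ξ) : Prop where
  injective : Function.Injective W
  equivariant : ∀ (g : SU3) (A : Q.Op) (x : adOrbit ξ),
    (W ((Q.rep g : Q.Op) * A * (Q.rep g⁻¹ : Q.Op))).1 (adOn g x) = (W A).1 x
  real : ∀ (A : Q.Op) (x : adOrbit ξ), (W Aᴴ).1 x = star ((W A).1 x)
  normalized : ∀ A : Q.Op,
    ∫ g : SU3, (W A).1 (adOn g (basePoint ξ)) ∂haarSU3 = A.trace / (Q.dim : ℂ)

/-- Universal correspondences for `ω`: maps `U(sl(3)) → Poly(O_ξ)` of the form `W ∘ ρ_ω` with `W` a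
symbol correspondence. -/
def IsUniversalCorrespondence (ω ξ : Mat3) (w : USL3 →ₗ[ℂ] PolyOrbit ξ) : Prop :=
  ∃ (Q : QuarkSystem ω) (W : Q.Op →ₗ[ℂ] PolyOrbit ξ),
    IsSymbolCorrespondence Q ξ W ∧ ∀ u : USL3, w u = W (Q.rho u)

/-- `ξ`-rays of universal correspondences: `w s` is a universal correspondence for `s ω_ξ`, for
every `s = 1, 2, 3, …` (the value `w 0` plays no role). -/
def IsUniversalRay (ξ : Mat3) (w : ℕ → USL3 →ₗ[ℂ] PolyOrbit ξ) : Prop :=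
  ∀ s : ℕ, 1 ≤ s → IsUniversalCorrespondence ((s : ℝ) • firstDominantWeight ξ) ξ (w s)

/-- The twisted product induced by a universal correspondence `w`, determined on the image of `w` by
`w[u] ⋆ w[v] = w[u v]` (see `twistedProduct_apply`); `Function.invFun w f` is a preimage of `f`
whenever `f` lies in the image of `w`. -/
def twistedProduct {ξ : Mat3} (w : USL3 →ₗ[ℂ] PolyOrbit ξ) (f g : PolyOrbit ξ) : PolyOrbit ξ :=
  w (Function.invFun w f * Function.invFun w g)

theorem twistedProduct_apply {ω ξ : Mat3} {w : USL3 →ₗ[ℂ] PolyOrbit ξ}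
    (hw : IsUniversalCorrespondence ω ξ w) (u v : USL3) :
    twistedProduct w (w u) (w v) = w (u * v) := by
  obtain ⟨Q, W, hW, h⟩ := hw
  have key : ∀ a : USL3, Q.rho (Function.invFun w (w a)) = Q.rho a := fun a => by
    have h1 : w (Function.invFun w (w a)) = w a := Function.invFun_eq ⟨a, rfl⟩
    exact hW.injective (((h _).symm.trans h1).trans (h a))
  unfold twistedProduct
  rw [h (_ * _), h (u * v), map_mul Q.rho, map_mul Q.rho, key, key]

/-- A `ξ`-ray is of Poisson type: for all `f₁ = F₁|O_ξ` and `f₂ = F₂|O_ξ` in `Poly(O_ξ)`, uniformly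
on `O_ξ` as `s → ∞`, `f₁ ⋆ˢ f₂ → f₁ f₂` and `s r(ξ) (f₁ ⋆ˢ f₂ - f₂ ⋆ˢ f₁) → i {f₁, f₂}`.
Both `f₁` and `f₂` lie in the image of `w s`, where `⋆ˢ` is defined, for all large `s`. -/
def IsPoissonType (ξ : Mat3) (w : ℕ → USL3 →ₗ[ℂ] PolyOrbit ξ) : Prop :=
  ∀ F₁ F₂ : PolySU3,
    TendstoUniformly
      (fun (s : ℕ) (x : adOrbit ξ) =>
        (twistedProduct (w s) (resOrbit ξ F₁) (resOrbit ξ F₂)).1 x)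
      (fun x => (resOrbit ξ F₁).1 x * (resOrbit ξ F₂).1 x) atTop ∧
    TendstoUniformly
      (fun (s : ℕ) (x : adOrbit ξ) => ((s * integralRadius ξ : ℝ) : ℂ) *
        ((twistedProduct (w s) (resOrbit ξ F₁) (resOrbit ξ F₂)).1 x -
          (twistedProduct (w s) (resOrbit ξ F₂) (resOrbit ξ F₁)).1 x))
      (fun x => Complex.I * (resOrbit ξ (poissonBracket F₁ F₂)).1 x) atTop

end

/-!
Replace the coordinates `x_k` of a noncommutative polynomial `t` by `-(i / R) E_k`, where
`R = s r(ξ)` is the radius of the coadjoint orbit. Both conditions of the theorem say that, for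
every `t`, the symbols of the resulting elements of `U(sl(3))` converge to the commutative
polynomial underlying `t`.

For the condition on leading parts, ordering the factors of a product of `d` elements of `sl(3)`
only changes terms of degree less than `d`, which the factor `R ^ (-d)` sends to zero.

If the symbols of all quantizations converge, then so do the twisted products and the rescaled
commutators: a product of quantizations is the quantization of the product, and `R` times a
commutator of quantizations is the quantization of a polynomial independent of `R` whose symbol is
`i` times the Poisson bracket. To pass from fixed functions to the elements of `U(sl(3))` that
represent them one uses that every polynomial function lies in a finite-dimensional
`SU(3)`-invariant space, on which the symbol maps are eventually invertible.

Conversely, equivariance determines the commutators of a symbol with those of the generators: `E_k`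
acts by the vector field `{x_k, ·}`. Comparing with the Poisson limit shows that the difference
between the symbols of the generators and the coordinates has vanishing Poisson bracket with
everything, hence tends to zero, and the limit of twisted products extends this from the generators
to all noncommutative polynomials.
-/

noncomputable section

/-! ### The two bases of `sl(3)` -/

theorem ofReal_sqrt_mul_self {a : ℝ} (ha : 0 ≤ a) : ((√a : ℝ) : ℂ) * ((√a : ℝ) : ℂ) = a := by
  rw [← Complex.ofReal_mul, Real.mul_self_sqrt ha]

theorem inv_ofReal_sqrt_mul_self {a : ℝ} (ha : 0 ≤ a) :
    ((√a : ℝ) : ℂ)⁻¹ * ((√a : ℝ) : ℂ)⁻¹ = (a : ℂ)⁻¹ := by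
  rw [← mul_inv, ofReal_sqrt_mul_self ha]

theorem trace_gellMann (k : Fin 8) : (gellMann k).trace = 0 := by
  fin_cases k <;> simp [gellMann, trace_fin_three]
  ring

theorem conjTranspose_gellMann (k : Fin 8) : (gellMann k)ᴴ = gellMann k := by
  fin_cases k <;> ext i j <;> fin_cases i <;> fin_cases j <;> simp [gellMann]

theorem trace_gellMann_mul_gellMann (j k : Fin 8) :
    (gellMann j * gellMann k).trace = if j = k then 2 else 0 := by
  have h3 := inv_ofReal_sqrt_mul_self (a := 3) (by norm_num)
  push_cast at h3
  fin_cases j <;> fin_cases k <;> simp [gellMann, trace_fin_three] <;>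
    first | linear_combination 6 * h3 | norm_num

theorem sum_trace_gellMann_mul_smul_gellMann (X : Mat3) :
    ∑ j, (1 / 2 * (gellMann j * X).trace) • gellMann j = X - (X.trace / 3) • 1 := by
  have h3 := inv_ofReal_sqrt_mul_self (a := 3) (by norm_num)
  push_cast at h3
  have hI := Complex.I_mul_I
  ext i j
  fin_cases i <;> fin_cases j <;>
    simp [gellMann, trace_fin_three, mul_apply, Fin.sum_univ_succ, vecHead, vecTail]
  · linear_combination (1 / 2) * (X 0 0 + X 1 1 - 2 * X 2 2) * h3
  · linear_combination (1 / 2) * (-X 0 1 + X 1 0) * hI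
  · linear_combination (1 / 2) * (-X 0 2 + X 2 0) * hI
  · linear_combination (1 / 2) * (-X 1 0 + X 0 1) * hI
  · linear_combination (1 / 2) * (X 0 0 + X 1 1 - 2 * X 2 2) * h3
  · linear_combination (1 / 2) * (-X 1 2 + X 2 1) * hI
  · linear_combination (1 / 2) * (-X 2 0 + X 0 2) * hI
  · linear_combination (1 / 2) * (-X 2 1 + X 1 2) * hI
  · linear_combination (-1) * (X 0 0 + X 1 1 - 2 * X 2 2) * h3

theorem trace_suBasis (k : Fin 8) : (suBasis k).trace = 0 := by
  simp [suBasis, trace_gellMann]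

theorem conjTranspose_suBasis (k : Fin 8) : (suBasis k)ᴴ = -suBasis k := by
  simp [suBasis, conjTranspose_gellMann, neg_div]

theorem suCoord_eq_neg_trace (X : Mat3) (j : Fin 8) : suCoord X j = -(suBasis j * X).trace := by
  simp [suCoord, conjTranspose_suBasis]

theorem I_div_sqrt_two_mul_self : Complex.I / ((√2 : ℝ) : ℂ) * (Complex.I / ((√2 : ℝ) : ℂ)) =
    -(1 / 2) := by
  rw [div_mul_div_comm, Complex.I_mul_I, ofReal_sqrt_mul_self (by norm_num)]
  norm_num

theorem suCoord_suBasis (k j : Fin 8) : suCoord (suBasis k) j = if j = k then 1 else 0 := by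
  rw [suCoord_eq_neg_trace]
  simp only [suBasis, Matrix.smul_mul, Matrix.mul_smul, smul_smul, trace_smul,
    trace_gellMann_mul_gellMann, I_div_sqrt_two_mul_self]
  split_ifs <;> norm_num

theorem sum_suCoord_smul_suBasis (X : Mat3) :
    ∑ j, suCoord X j • suBasis j = X - (X.trace / 3) • 1 := by
  rw [← sum_trace_gellMann_mul_smul_gellMann]
  refine Finset.sum_congr rfl fun j _ => ?_
  rw [suCoord_eq_neg_trace, suBasis, smul_smul, Matrix.smul_mul, trace_smul, smul_eq_mul]
  congr 1
  linear_combination (-(gellMann j * X).trace) * I_div_sqrt_two_mul_self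

/-- The coordinates `x_1, …, x_8`, as one linear map on all `3 × 3` matrices; the scalar matrices
are its kernel. -/
def suCoordLin : Mat3 →ₗ[ℂ] (Fin 8 → ℂ) where
  toFun := suCoord
  map_add' X Y := by ext j; simp [suCoord, mul_add]
  map_smul' c X := by ext j; simp [suCoord]

theorem suCoord_smul (c : ℂ) (X : Mat3) : suCoord (c • X) = c • suCoord X :=
  suCoordLin.map_smul c X

theorem suCoord_sum {ι : Type*} (s : Finset ι) (X : ι → Mat3) :
    suCoord (∑ i ∈ s, X i) = ∑ i ∈ s, suCoord (X i) :=
  map_sum suCoordLin X s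

theorem continuous_suCoord (j : Fin 8) : Continuous fun X : Mat3 => suCoord X j :=
  (continuous_const.matrix_mul continuous_id).matrix_trace

/-- `E_1, …, E_8` as a basis of `sl(3)` over `ℂ`. -/
def suLieBasis : Module.Basis (Fin 8) ℂ SL3Lie :=
  Module.Basis.ofEquivFun
    { toFun := fun X => suCoord X
      map_add' := fun X Y => suCoordLin.map_add X Y
      map_smul' := fun c X => suCoordLin.map_smul c X
      invFun := fun c => ∑ j, c j • ⟨suBasis j, trace_suBasis j⟩
      left_inv := fun X => Subtype.ext <| by
        have hX : (X : Mat3).trace = 0 := X.2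
        simpa [AddSubmonoidClass.coe_finsetSum, hX] using sum_suCoord_smul_suBasis (X : Mat3)
      right_inv := fun c => by
        ext j
        simp [suCoord_sum, suCoord_smul, suCoord_suBasis] }

theorem suLieBasis_repr (X : SL3Lie) (j : Fin 8) : suLieBasis.repr X j = suCoord X j := rfl

theorem coe_suLieBasis (k : Fin 8) : (suLieBasis k : Mat3) = suBasis k := by
  simp [suLieBasis, Pi.single_apply]

theorem lie_suLieBasis (k j : Fin 8) :
    ⁅suLieBasis k, suLieBasis j⁆ = ∑ l, structConst k j l • suLieBasis l := by
  rw [← suLieBasis.sum_repr ⁅suLieBasis k, suLieBasis j⁆]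
  simp only [suLieBasis_repr, LieSubalgebra.coe_bracket, coe_suLieBasis, structConst]

theorem structConst_eq_neg_trace (k j l : Fin 8) :
    structConst k j l = -(suBasis l * (suBasis k * suBasis j - suBasis j * suBasis k)).trace := by
  rw [structConst, suCoord_eq_neg_trace, Ring.lie_def]

theorem structConst_swap_right (k j l : Fin 8) : structConst k j l = -structConst k l j := by
  rw [structConst_eq_neg_trace, structConst_eq_neg_trace, mul_sub, mul_sub, trace_sub, trace_sub,
    ← mul_assoc, ← mul_assoc, ← mul_assoc, ← mul_assoc,
    trace_mul_cycle (suBasis l) (suBasis k) (suBasis j),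
    trace_mul_cycle (suBasis j) (suBasis k) (suBasis l),
    trace_mul_cycle (suBasis l) (suBasis j) (suBasis k),
    trace_mul_cycle (suBasis k) (suBasis l) (suBasis j)]
  ring

theorem structConst_swap_left (k j l : Fin 8) : structConst k j l = -structConst j k l := by
  rw [structConst_eq_neg_trace, structConst_eq_neg_trace, mul_sub, mul_sub, trace_sub, trace_sub]
  ring

theorem sqrt_two_thirds_mul_self : ((√(2 / 3) : ℝ) : ℂ) * ((√(2 / 3) : ℝ) : ℂ) = 2 / 3 := by
  rw [ofReal_sqrt_mul_self (by norm_num)]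
  norm_num

theorem trace_conjTranspose_gtMatrix_mul_gtMatrix (j k : Fin 8) :
    ((gtMatrix j)ᴴ * gtMatrix k).trace = if j = k then 1 else 0 := by
  have h2 := ofReal_sqrt_mul_self (a := 2) (by norm_num)
  have h3 := sqrt_two_thirds_mul_self
  push_cast at h2
  have hc : (starRingEnd ℂ) 2 = 2 := map_ofNat _ 2
  fin_cases j <;> fin_cases k <;>
    simp [gtMatrix, trace_fin_three, mul_apply, Fin.sum_univ_three, hc,
      -Nat.ofNat_nonneg, -Real.sqrt_div', -Real.sqrt_div] <;>
    first | linear_combination (1 / 2) * h2 | linear_combination (3 / 2) * h3 | norm_num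

theorem sum_trace_conjTranspose_gtMatrix_mul_smul_gtMatrix {X : Mat3} (hX : X.trace = 0) :
    ∑ j, ((gtMatrix j)ᴴ * X).trace • gtMatrix j = X := by
  have h2 := ofReal_sqrt_mul_self (a := 2) (by norm_num)
  have h3 := sqrt_two_thirds_mul_self
  push_cast at h2
  have hc : (starRingEnd ℂ) 2 = 2 := map_ofNat _ 2
  have hX' : X 2 2 = -X 0 0 - X 1 1 := by
    rw [trace_fin_three] at hX; linear_combination hX
  ext i j
  fin_cases i <;> fin_cases j <;>
    simp [gtMatrix, trace_fin_three, mul_apply, Fin.sum_univ_succ, vecHead, vecTail, hX', hc,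
      -Nat.ofNat_nonneg, -Real.sqrt_div', -Real.sqrt_div]
  · linear_combination (3 / 2) * X 0 0 * h3
  · linear_combination (1 / 2 * X 1 1 + 1 / 4 * X 0 0) * h2 - 3 / 4 * X 0 0 * h3
  · linear_combination (-1 / 2 * X 1 1 - 1 / 4 * X 0 0) * h2 - 3 / 4 * X 0 0 * h3

/-- The ordered basis `e_1, …, e_8` as a `Module.Basis` of `sl(3)`. -/
def gtLieBasis : Module.Basis (Fin 8) ℂ SL3Lie :=
  Module.Basis.ofEquivFun
    { toFun := fun X j => ((gtMatrix j)ᴴ * (X : Mat3)).trace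
      map_add' := fun X Y => by ext j; simp [mul_add]
      map_smul' := fun c X => by ext j; simp
      invFun := fun c => ∑ j, c j • gtBasis j
      left_inv := fun X => Subtype.ext <| by
        simpa [AddSubmonoidClass.coe_finsetSum, gtBasis] using
          sum_trace_conjTranspose_gtMatrix_mul_smul_gtMatrix (X := X) X.2
      right_inv := fun c => by
        ext j
        simp [AddSubmonoidClass.coe_finsetSum, gtBasis, Matrix.mul_sum, trace_sum,
          trace_conjTranspose_gtMatrix_mul_gtMatrix] }

theorem gtLieBasis_apply (j : Fin 8) : gtLieBasis j = gtBasis j := by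
  simp [gtLieBasis, Pi.single_apply]

/-! ### Traceless matrices are sums of commutators -/

theorem map_eq_zero_of_trace_eq_zero {n K M : Type*} [Fintype n] [DecidableEq n] [Field K]
    [NeZero (2 : K)] [AddCommGroup M] [Module K M] (φ : Matrix n n K →ₗ[K] M)
    (h : ∀ X Y : Matrix n n K, X.trace = 0 → Y.trace = 0 → φ ⁅X, Y⁆ = 0)
    {X : Matrix n n K} (hX : X.trace = 0) : φ X = 0 := by
  have hoff {i j : n} (hij : i ≠ j) (c : K) : φ (single i j c) = 0 := by
    have e : ⁅single i i (1 : K) - single j j 1, single i j (c / 2)⁆ = single i j c := by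
      simp [Ring.lie_def, sub_mul, mul_sub, hij.symm, ← single_add]
    rw [← e]
    exact h _ _ (by simp) (by simp [hij])
  have hdiag (i j : n) (c : K) : φ (single i i c) = φ (single j j c) := by
    obtain rfl | hij := eq_or_ne i j
    · rfl
    · have := h (single i j c) (single j i 1) (by simp [hij]) (by simp [hij.symm])
      simpa [Ring.lie_def, sub_eq_zero] using this
  cases isEmpty_or_nonempty n with
  | inl _ => rw [Subsingleton.elim X 0, map_zero]
  | inr hn =>
    obtain ⟨i₀⟩ := hn
    calc φ X = ∑ i, ∑ j, φ (single i j (X i j)) := by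
          conv_lhs => rw [matrix_eq_sum_single X]
          simp only [map_sum]
      _ = ∑ i, φ (single i₀ i₀ (X i i)) := Finset.sum_congr rfl fun i _ => by
          rw [Finset.sum_eq_single i (fun j _ hj => hoff hj.symm _) (by simp), hdiag i i₀]
      _ = φ (single i₀ i₀ X.trace) := by
          rw [← map_sum]; exact congrArg φ (map_sum (singleAddMonoidHom (α := K) i₀ i₀) _ _).symm
      _ = 0 := by rw [hX, single_zero, map_zero]

theorem eq_zero_of_forall_sum_structConst_mul {θ : Fin 8 → ℂ}
    (h : ∀ k l, ∑ j, structConst k l j * θ j = 0) : θ = 0 := by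
  let φ : Mat3 →ₗ[ℂ] ℂ := (Fintype.linearCombination ℂ θ).comp suCoordLin
  have hφ : ∀ X, φ X = ∑ j, suCoord X j * θ j := fun X => by
    simp [φ, Fintype.linearCombination_apply, suCoordLin]
  have expand {X : Mat3} (hX : X.trace = 0) : X = ∑ j, suCoord X j • suBasis j := by
    rw [sum_suCoord_smul_suBasis, hX]; simp
  have hb : ∀ X Y : Mat3, X.trace = 0 → Y.trace = 0 → φ ⁅X, Y⁆ = 0 := by
    intro X Y hX hY
    rw [expand hX, expand hY, sum_lie]
    simp only [lie_sum, smul_lie, lie_smul, map_sum, map_smul]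
    refine Finset.sum_eq_zero fun k _ => Finset.sum_eq_zero fun l _ => ?_
    have hkl : ∑ j, suCoord ⁅suBasis k, suBasis l⁆ j * θ j = 0 := h k l
    rw [hφ, hkl, smul_zero, smul_zero]
  ext j
  simpa [hφ, suCoord_suBasis] using map_eq_zero_of_trace_eq_zero φ hb (trace_suBasis j)

/-! ### Ordered monomials in universal enveloping algebras -/

section OrderedMonomials

open UniversalEnvelopingAlgebra (ι)

variable {R L : Type*} [CommRing R] [LieRing L] [LieAlgebra R L] {n : ℕ}
  (b : Module.Basis (Fin n) R L)

/-- The product in `U(L)` of the basis elements listed by a word. -/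
def wordProd (l : List (Fin n)) : UniversalEnvelopingAlgebra R L :=
  (l.map fun j => ι R (b j)).prod

/-- The exponents of the commutative monomial underlying a word. -/
def wordExp (l : List (Fin n)) : Fin n →₀ ℕ := Multiset.toFinsupp (l : Multiset (Fin n))

/-- The increasing word with given exponents. -/
def orderedWord (m : Fin n →₀ ℕ) : List (Fin n) :=
  (List.ofFn fun j => List.replicate (m j) j).flatten

/-- The ordered monomial `b₁ ^ m₁ ⋯ bₙ ^ mₙ` in `U(L)`; `pbwMonomial` for an arbitrary basis. -/
def orderedMonomial (m : Fin n →₀ ℕ) : UniversalEnvelopingAlgebra R L :=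
  (List.ofFn fun j => ι R (b j) ^ m j).prod

/-- The linear map from polynomials to `U(L)` that orders the variables of each monomial; `pbwMap`
for an arbitrary basis. -/
def orderedMap : MvPolynomial (Fin n) R →ₗ[R] UniversalEnvelopingAlgebra R L :=
  (MvPolynomial.basisMonomials (Fin n) R).constr R (orderedMonomial b)

/-- The span of the ordered monomials of length less than `d`. -/
def orderedLT (d : ℕ) : Submodule R (UniversalEnvelopingAlgebra R L) :=
  (MvPolynomial.restrictSupport R {m : Fin n →₀ ℕ | m.degree < d}).map (orderedMap b)

/-- The linear polynomial whose image under `orderedMap` is a given element of `L`. -/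
def linForm : L →ₗ[R] MvPolynomial (Fin n) R := b.constr R MvPolynomial.X

theorem orderedMap_monomial (m : Fin n →₀ ℕ) (c : R) :
    orderedMap b (MvPolynomial.monomial m c) = c • orderedMonomial b m := by
  have h : MvPolynomial.monomial m c = c • MvPolynomial.basisMonomials (Fin n) R m := by
    simp [MvPolynomial.smul_monomial]
  rw [h, map_smul, orderedMap, Module.Basis.constr_basis]

theorem orderedMap_one : orderedMap b 1 = 1 := by
  rw [← MvPolynomial.C_1, ← MvPolynomial.monomial_zero', orderedMap_monomial]
  simp [orderedMonomial]

theorem orderedMonomial_mem_orderedLT {m : Fin n →₀ ℕ} {d : ℕ} (h : m.degree < d) :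
    orderedMonomial b m ∈ orderedLT b d :=
  ⟨MvPolynomial.monomial m 1, (MvPolynomial.monomial_mem_restrictSupport R).mpr (.inl h), by
    rw [orderedMap_monomial, one_smul]⟩

theorem orderedLT_mono {d d' : ℕ} (h : d ≤ d') : orderedLT b d ≤ orderedLT b d' :=
  Submodule.map_mono (MvPolynomial.restrictSupport_mono _ fun _ hm => lt_of_lt_of_le hm h)

theorem orderedLT_eq_span (d : ℕ) :
    orderedLT b d = Submodule.span R (orderedMonomial b '' {m | m.degree < d}) := by
  simp only [orderedLT, MvPolynomial.restrictSupport_eq_span, Submodule.map_span, Set.image_image,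
    orderedMap_monomial, one_smul]

theorem linForm_basis (j : Fin n) : linForm b (b j) = MvPolynomial.X j :=
  b.constr_basis R _ j

theorem linForm_isHomogeneous (X : L) : (linForm b X).IsHomogeneous 1 := by
  rw [linForm, Module.Basis.constr_apply_fintype]
  exact MvPolynomial.IsHomogeneous.sum _ _ _ fun j _ =>
    (MvPolynomial.homogeneousSubmodule (Fin n) R 1).smul_mem _ (MvPolynomial.isHomogeneous_X R j)

theorem prod_linForm_isHomogeneous (l : List L) :
    ((l.map (linForm b)).prod).IsHomogeneous l.length := by
  induction l with
  | nil => simpa using MvPolynomial.isHomogeneous_one (Fin n) R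
  | cons X l ih =>
    rw [List.map_cons, List.prod_cons, List.length_cons, add_comm]
    exact (linForm_isHomogeneous b X).mul ih

theorem wordProd_cons (j : Fin n) (l : List (Fin n)) :
    wordProd b (j :: l) = ι R (b j) * wordProd b l := by
  simp [wordProd]

theorem wordProd_append (l l' : List (Fin n)) :
    wordProd b (l ++ l') = wordProd b l * wordProd b l' := by
  simp [wordProd]

theorem wordExp_apply (l : List (Fin n)) (j : Fin n) : wordExp l j = l.count j := by
  simp [wordExp]

theorem wordExp_cons (j : Fin n) (l : List (Fin n)) :
    wordExp (j :: l) = Finsupp.single j 1 + wordExp l := by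
  rw [wordExp, ← Multiset.cons_coe, ← Multiset.singleton_add, map_add, Multiset.toFinsupp_singleton,
    wordExp]

theorem degree_wordExp (l : List (Fin n)) : (wordExp l).degree = l.length := by
  induction l with
  | nil => simp [wordExp]
  | cons j l ih => rw [wordExp_cons, map_add, Finsupp.degree_single, ih, List.length_cons, add_comm]

theorem wordProd_orderedWord (m : Fin n →₀ ℕ) :
    wordProd b (orderedWord m) = orderedMonomial b m := by
  simp only [wordProd, orderedWord, orderedMonomial, List.map_flatten, List.prod_flatten,
    List.map_ofFn]
  congr 2
  funext j
  simp

theorem wordExp_orderedWord (m : Fin n →₀ ℕ) : wordExp (orderedWord m) = m := by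
  ext j
  rw [wordExp_apply, orderedWord, List.count_flatten, List.map_ofFn, List.sum_ofFn]
  simp [List.count_replicate]

theorem length_orderedWord (m : Fin n →₀ ℕ) : (orderedWord m).length = m.degree := by
  rw [← degree_wordExp, wordExp_orderedWord]

theorem prod_map_X_eq_monomial (l : List (Fin n)) :
    (l.map MvPolynomial.X).prod = MvPolynomial.monomial (wordExp l) (1 : R) := by
  induction l with
  | nil => simp [wordExp]
  | cons j l ih =>
    rw [List.map_cons, List.prod_cons, ih, wordExp_cons, MvPolynomial.X,
      MvPolynomial.monomial_mul, mul_one]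

theorem prod_map_linForm_orderedWord (m : Fin n →₀ ℕ) :
    (((orderedWord m).map b).map (linForm b)).prod = MvPolynomial.monomial m (1 : R) := by
  rw [List.map_map, ← wordExp_orderedWord m, ← prod_map_X_eq_monomial, wordExp_orderedWord]
  simp only [Function.comp_def, linForm_basis]

theorem perm_orderedWord (l : List (Fin n)) : l.Perm (orderedWord (wordExp l)) := by
  rw [List.perm_iff_count]
  intro j
  rw [← wordExp_apply, ← wordExp_apply, wordExp_orderedWord]

theorem wordProd_swap_sub (l₀ l : List (Fin n)) (i j : Fin n) :
    wordProd b (l₀ ++ i :: j :: l) - wordProd b (l₀ ++ j :: i :: l) =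
      ∑ k, b.repr ⁅b i, b j⁆ k • wordProd b (l₀ ++ k :: l) := by
  have hlie : ι R (b i) * ι R (b j) - ι R (b j) * ι R (b i) =
      ∑ k, b.repr ⁅b i, b j⁆ k • ι R (b k) := by
    rw [← Ring.lie_def, ← LieHom.map_lie]
    conv_lhs => rw [← b.sum_repr ⁅b i, b j⁆]
    simp only [map_sum, map_smul]
  calc wordProd b (l₀ ++ i :: j :: l) - wordProd b (l₀ ++ j :: i :: l)
      = wordProd b l₀ * (ι R (b i) * ι R (b j) - ι R (b j) * ι R (b i)) * wordProd b l := by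
        simp only [wordProd_append, wordProd_cons, mul_sub, sub_mul, mul_assoc]
    _ = ∑ k, b.repr ⁅b i, b j⁆ k • wordProd b (l₀ ++ k :: l) := by
        simp only [hlie, wordProd_append, wordProd_cons, Finset.mul_sum, Finset.sum_mul,
          mul_smul_comm, smul_mul_assoc, mul_assoc]

theorem wordProd_sub_mem_orderedLT_of_perm {d : ℕ}
    (hd : ∀ l : List (Fin n), l.length < d → wordProd b l ∈ orderedLT b d) {l₁ l₂ : List (Fin n)}
    (h : l₁.Perm l₂) (l₀ : List (Fin n)) (hl : (l₀ ++ l₁).length = d) :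
    wordProd b (l₀ ++ l₁) - wordProd b (l₀ ++ l₂) ∈ orderedLT b d := by
  induction h generalizing l₀ with
  | nil => simp
  | cons a _ ih => simpa using ih (l₀ ++ [a]) (by simpa using hl)
  | swap a c l =>
    rw [wordProd_swap_sub]
    refine Submodule.sum_mem _ fun j _ => Submodule.smul_mem _ _ (hd _ ?_)
    simp only [List.length_append, List.length_cons] at hl ⊢
    omega
  | trans h₁ _ ih₁ ih₂ =>
    have h₁₂ := ih₁ l₀ hl
    have h₂₃ := ih₂ l₀ (by simpa [h₁.length_eq] using hl)
    simpa using Submodule.add_mem _ h₁₂ h₂₃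

theorem wordProd_sub_orderedMonomial_mem (l : List (Fin n)) :
    wordProd b l - orderedMonomial b (wordExp l) ∈ orderedLT b l.length := by
  induction hd : l.length using Nat.strong_induction_on generalizing l with
  | _ d ih =>
    have hshort (l : List (Fin n)) (hl : l.length < d) : wordProd b l ∈ orderedLT b d := by
      have h := orderedLT_mono b hl.le (ih _ hl l rfl)
      exact (Submodule.sub_mem_iff_left _
        (orderedMonomial_mem_orderedLT b (by rwa [degree_wordExp]))).mp h
    simpa [wordProd_orderedWord] using
      wordProd_sub_mem_orderedLT_of_perm b hshort (perm_orderedWord l) [] (by simpa using hd)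

theorem ι_basis_mul_orderedMonomial_sub_mem (j : Fin n) (m : Fin n →₀ ℕ) :
    ι R (b j) * orderedMonomial b m - orderedMonomial b (Finsupp.single j 1 + m) ∈
      orderedLT b (m.degree + 1) := by
  have h := wordProd_sub_orderedMonomial_mem b (j :: orderedWord m)
  rwa [wordProd_cons, wordProd_orderedWord, wordExp_cons, wordExp_orderedWord, List.length_cons,
    length_orderedWord] at h

theorem ι_basis_mul_orderedMap_sub_mem (j : Fin n) {d : ℕ} {p : MvPolynomial (Fin n) R}
    (hp : p ∈ MvPolynomial.restrictSupport R {m | m.degree < d}) :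
    ι R (b j) * orderedMap b p - orderedMap b (MvPolynomial.X j * p) ∈ orderedLT b d := by
  rw [MvPolynomial.restrictSupport_eq_span] at hp
  induction hp using Submodule.span_induction with
  | mem _ hp =>
    obtain ⟨m, hm, rfl⟩ := hp
    rw [MvPolynomial.X, MvPolynomial.monomial_mul, orderedMap_monomial, orderedMap_monomial,
      one_mul, one_smul, one_smul]
    exact orderedLT_mono b hm (ι_basis_mul_orderedMonomial_sub_mem b j m)
  | zero => simp
  | add p q _ _ hp hq =>
    rw [map_add, mul_add, mul_add, map_add, add_sub_add_comm]
    exact Submodule.add_mem _ hp hq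
  | smul c p _ hp =>
    rw [map_smul, mul_smul_comm, mul_smul_comm, map_smul, ← smul_sub]
    exact Submodule.smul_mem _ _ hp

theorem ι_mul_orderedMap_sub_mem (X : L) {d : ℕ} {p : MvPolynomial (Fin n) R}
    (hp : p ∈ MvPolynomial.restrictSupport R {m | m.degree < d}) :
    ι R X * orderedMap b p - orderedMap b (linForm b X * p) ∈ orderedLT b d := by
  rw [← b.sum_repr X]
  simp only [map_sum, map_smul, linForm_basis, Finset.sum_mul, smul_mul_assoc,
    ← Finset.sum_sub_distrib, ← smul_sub]
  exact Submodule.sum_mem _ fun j _ =>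
    Submodule.smul_mem _ _ (ι_basis_mul_orderedMap_sub_mem b j hp)

theorem mem_restrictSupport_degree_lt_iff {d : ℕ} {p : MvPolynomial (Fin n) R} :
    p ∈ MvPolynomial.restrictSupport R {m | m.degree < d + 1} ↔ p.totalDegree ≤ d := by
  rw [MvPolynomial.mem_restrictSupport_iff, MvPolynomial.totalDegree, Finset.sup_le_iff]
  exact forall₂_congr fun m _ => Nat.lt_succ_iff

theorem linForm_mul_mem_restrictSupport (X : L) {d : ℕ} {p : MvPolynomial (Fin n) R}
    (hp : p ∈ MvPolynomial.restrictSupport R {m | m.degree < d}) :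
    linForm b X * p ∈ MvPolynomial.restrictSupport R {m | m.degree < d + 1} := by
  have hX : linForm b X ∈ MvPolynomial.restrictSupport R {m | m.degree < 2} :=
    mem_restrictSupport_degree_lt_iff.mpr (linForm_isHomogeneous b X).totalDegree_le
  have hmul := Submodule.mul_mem_mul hX hp
  rw [← MvPolynomial.restrictSupport_add] at hmul
  refine MvPolynomial.restrictSupport_mono R ?_ hmul
  rintro _ ⟨m, hm, m', hm', rfl⟩
  simp only [Set.mem_ofPred_eq, map_add] at hm hm' ⊢
  omega

theorem ι_mul_mem_orderedLT (X : L) {d : ℕ} {u : UniversalEnvelopingAlgebra R L}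
    (hu : u ∈ orderedLT b d) : ι R X * u ∈ orderedLT b (d + 1) := by
  obtain ⟨p, hp, rfl⟩ := hu
  have hsub := orderedLT_mono b d.le_succ (ι_mul_orderedMap_sub_mem b X hp)
  refine (Submodule.sub_mem_iff_left _ ?_).mp hsub
  exact Submodule.mem_map_of_mem (linForm_mul_mem_restrictSupport b X hp)

theorem prod_ι_sub_orderedMap_mem (l : List L) :
    (l.map (ι R)).prod - orderedMap b (l.map (linForm b)).prod ∈ orderedLT b l.length := by
  induction l with
  | nil => simp [orderedMap_one]
  | cons X l ih =>
    have hdeg := mem_restrictSupport_degree_lt_iff.mpr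
      (prod_linForm_isHomogeneous b l).totalDegree_le
    have h := Submodule.add_mem _ (ι_mul_mem_orderedLT b X ih) (ι_mul_orderedMap_sub_mem b X hdeg)
    rwa [mul_sub, sub_add_sub_cancel, ← List.prod_cons, ← List.map_cons] at h

theorem eq_top_of_forall_ι_mem {S : Subalgebra R (UniversalEnvelopingAlgebra R L)}
    (h : ∀ X : L, ι R X ∈ S) : S = ⊤ := by
  let f : L →ₗ⁅R⁆ S :=
    { toFun := fun X => ⟨ι R X, h X⟩
      map_add' := fun X Y => Subtype.ext (map_add _ X Y)
      map_smul' := fun c X => Subtype.ext (map_smul _ c X)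
      map_lie' := fun {X Y} => Subtype.ext (LieHom.map_lie _ X Y) }
  have hf : S.val.comp (UniversalEnvelopingAlgebra.lift R f) = AlgHom.id R _ :=
    UniversalEnvelopingAlgebra.hom_ext R <| LieHom.ext fun X =>
      congrArg S.val (UniversalEnvelopingAlgebra.lift_ι_apply R f X)
  refine eq_top_iff.mpr fun u _ => ?_
  rw [← AlgHom.id_apply (R := R) u, ← hf]
  exact (UniversalEnvelopingAlgebra.lift R f u).2

theorem submodule_eq_top_of_forall_ι_mul_mem
    {M : Submodule R (UniversalEnvelopingAlgebra R L)} (h1 : 1 ∈ M)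
    (h : ∀ X : L, ∀ u ∈ M, ι R X * u ∈ M) : M = ⊤ := by
  let S : Subalgebra R (UniversalEnvelopingAlgebra R L) :=
    { carrier := {a | ∀ u ∈ M, a * u ∈ M}
      mul_mem' := fun {a b} ha hb u hu => by rw [mul_assoc]; exact ha _ (hb u hu)
      add_mem' := fun {a b} ha hb u hu => by rw [add_mul]; exact M.add_mem (ha u hu) (hb u hu)
      algebraMap_mem' := fun c u hu => by
        rw [Algebra.algebraMap_eq_smul_one, smul_mul_assoc, one_mul]; exact M.smul_mem c hu }
  have hS : S = ⊤ := eq_top_of_forall_ι_mem fun X u hu => h X u hu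
  refine eq_top_iff.mpr fun u _ => ?_
  have hu : u ∈ S := hS ▸ Algebra.mem_top
  simpa using hu 1 h1

theorem orderedMap_surjective : Function.Surjective (orderedMap b) := by
  rw [← LinearMap.range_eq_top]
  refine submodule_eq_top_of_forall_ι_mul_mem ⟨1, orderedMap_one b⟩ ?_
  rintro X _ ⟨p, rfl⟩
  obtain ⟨q, -, hq⟩ :=
    ι_mul_orderedMap_sub_mem b X (mem_restrictSupport_degree_lt_iff.mpr (le_refl p.totalDegree))
  exact ⟨q + linForm b X * p, by rw [map_add, hq, sub_add_cancel]⟩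

end OrderedMonomials

/-! ### Left-invariant vector fields and independence of ordered monomials -/

section LeftInvariantFields

variable {R ν : Type*} [CommRing R] [Fintype ν]

/-- The left-invariant vector field on the space of `ν × ν` matrices with value `X` at the
identity, as a derivation of the polynomial functions in the matrix entries. -/
def leftField (X : Matrix ν ν R) :
    Derivation R (MvPolynomial (ν × ν) R) (MvPolynomial (ν × ν) R) :=
  MvPolynomial.mkDerivation R fun p => ∑ l, X l p.2 • MvPolynomial.X (p.1, l)

theorem leftField_X (X : Matrix ν ν R) (i k : ν) :
    leftField X (MvPolynomial.X (i, k)) = ∑ l, X l k • MvPolynomial.X (i, l) :=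
  MvPolynomial.mkDerivation_X _ _ _

variable [DecidableEq ν]

theorem leftField_lie (X Y : Matrix ν ν R) :
    leftField ⁅X, Y⁆ = ⁅leftField X, leftField Y⁆ := by
  refine MvPolynomial.derivation_ext fun ⟨i, k⟩ => ?_
  have hcomp (X Y : Matrix ν ν R) : ∑ l, (X * Y) l k • MvPolynomial.X (R := R) (i, l) =
      leftField X (leftField Y (MvPolynomial.X (i, k))) := by
    simp only [leftField_X, map_sum, Derivation.map_smul, Matrix.mul_apply, Finset.smul_sum,
      Finset.sum_smul, smul_smul]
    rw [Finset.sum_comm]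
    exact Finset.sum_congr rfl fun l _ => Finset.sum_congr rfl fun m _ => by rw [mul_comm]
  rw [Derivation.commutator_apply, leftField_X, Ring.lie_def, ← hcomp, ← hcomp]
  simp only [Matrix.sub_apply, sub_smul, Finset.sum_sub_distrib]

/-- The representation of the Lie algebra of `ν × ν` matrices by left-invariant vector fields. -/
def leftFieldRep : Matrix ν ν R →ₗ⁅R⁆ Module.End R (MvPolynomial (ν × ν) R) where
  toFun X := (leftField X : MvPolynomial (ν × ν) R →ₗ[R] MvPolynomial (ν × ν) R)
  map_add' X Y := by
    have : leftField (X + Y) = leftField X + leftField Y :=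
      MvPolynomial.derivation_ext fun ⟨i, k⟩ => by
        simp [leftField_X, add_smul, Finset.sum_add_distrib]
    simp [this]
  map_smul' c X := by
    have : leftField (c • X) = c • leftField X :=
      MvPolynomial.derivation_ext fun ⟨i, k⟩ => by
        simp [leftField_X, mul_smul, Finset.smul_sum]
    simp [this]
  map_lie' {X Y} := by simp [leftField_lie X Y, Derivation.commutator_coe_linear_map]

variable {L : Type*} [LieRing L] [LieAlgebra R L] {n : ℕ} (b : Module.Basis (Fin n) R L)
  (φ : L →ₗ⁅R⁆ Matrix ν ν R)

/-- The action of `U(L)` by left-invariant differential operators that is induced by a matrix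
representation of `L`. -/
def diffOpRep : UniversalEnvelopingAlgebra R L →ₐ[R] Module.End R (MvPolynomial (ν × ν) R) :=
  UniversalEnvelopingAlgebra.lift R (leftFieldRep.comp φ)

theorem diffOpRep_ι (X : L) (f : MvPolynomial (ν × ν) R) :
    diffOpRep φ (UniversalEnvelopingAlgebra.ι R X) f = leftField (φ X) f := by
  rw [diffOpRep, UniversalEnvelopingAlgebra.lift_ι_apply]
  rfl

theorem diffOpRep_wordProd_pow (f : MvPolynomial (ν × ν) R) (l : List (Fin n)) (k : ℕ) :
    ∃ g, diffOpRep φ (wordProd b l) (f ^ (l.length + k)) =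
      ((l.length + k).descFactorial l.length : R) •
        (f ^ k * (l.map fun j => leftField (φ (b j)) f).prod) + f ^ (k + 1) * g := by
  induction l generalizing k with
  | nil => exact ⟨0, by simp [wordProd]⟩
  | cons j l ih =>
    obtain ⟨g, hg⟩ := ih (k + 1)
    have hlen : (j :: l).length + k = l.length + (k + 1) := by
      rw [List.length_cons, add_right_comm, add_assoc]
    have hdesc : (((l.length + (k + 1)).descFactorial (j :: l).length : ℕ) : R) =
        (l.length + (k + 1)).descFactorial l.length * (k + 1 : R) := by
      rw [List.length_cons, Nat.descFactorial_succ, Nat.cast_mul, mul_comm,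
        Nat.add_sub_cancel_left]
      push_cast; rfl
    rw [wordProd_cons, map_mul, Module.End.mul_apply, hlen, hg, diffOpRep_ι, hdesc, List.map_cons,
      List.prod_cons]
    refine ⟨((l.length + (k + 1)).descFactorial l.length : R) •
        leftField (φ (b j)) (l.map fun j => leftField (φ (b j)) f).prod +
      ((k + 2 : ℕ) : R) • (leftField (φ (b j)) f * g) + f * leftField (φ (b j)) g, ?_⟩
    simp only [map_add, Derivation.leibniz, Derivation.leibniz_pow, Derivation.map_natCast,
      smul_eq_mul, nsmul_eq_mul, MvPolynomial.smul_eq_C_mul, map_mul, map_one,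
      Nat.add_sub_cancel, map_natCast]
    push_cast
    ring

theorem map_diffOpRep_orderedMonomial {A : Type*} [CommRing A] [Algebra R A]
    (ε : MvPolynomial (ν × ν) R →ₐ[R] A)
    {f : MvPolynomial (ν × ν) R} (hf : ε f = 0) {m : Fin n →₀ ℕ} {d : ℕ} (hm : m.degree ≤ d) :
    ε (diffOpRep φ (orderedMonomial b m) (f ^ d)) =
      if m.degree = d then (d.factorial : A) * ∏ j, ε (leftField (φ (b j)) f) ^ m j else 0 := by
  obtain ⟨k, rfl⟩ := Nat.exists_eq_add_of_le hm
  obtain ⟨g, hg⟩ := diffOpRep_wordProd_pow b φ f (orderedWord m) k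
  rw [wordProd_orderedWord, length_orderedWord] at hg
  rw [hg]
  obtain rfl | hk := Nat.eq_zero_or_pos k
  · have : (((orderedWord m).map fun j => leftField (φ (b j)) f).map ε).prod =
        ∏ j, ε (leftField (φ (b j)) f) ^ m j := by
      rw [orderedWord, List.map_map, List.map_flatten, List.prod_flatten, List.map_ofFn,
        List.map_ofFn, List.prod_ofFn]
      simp
    simp [hf, map_list_prod, ← this, Nat.descFactorial_self, Algebra.smul_def]
  · simp [hf, hk.ne']

/-- Evaluation of a polynomial function on matrices at the identity matrix. -/
def evalOne : MvPolynomial (ν × ν) R →ₐ[R] R :=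
  MvPolynomial.aeval fun p => (1 : Matrix ν ν R) p.1 p.2

theorem evalOne_leftField_linear (τ : Matrix ν ν R →ₗ[R] R) (X : Matrix ν ν R) :
    evalOne (leftField X (∑ i, ∑ k, τ (single i k 1) •
      (MvPolynomial.X (i, k) - MvPolynomial.C ((1 : Matrix ν ν R) i k)))) = τ X := by
  conv_rhs => rw [matrix_eq_sum_single X]
  simp only [map_sum, Derivation.map_smul, map_sub, MvPolynomial.derivation_C, sub_zero,
    leftField_X, map_smul, evalOne, MvPolynomial.aeval_X, smul_eq_mul]
  refine Finset.sum_congr rfl fun i _ => Finset.sum_congr rfl fun k _ => ?_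
  have hsingle : single i k (X i k) = X i k • single i k (1 : R) := by simp
  rw [hsingle, map_smul, smul_eq_mul, mul_comm]
  simp [Matrix.one_apply]

end LeftInvariantFields

section Independence

variable {K ν L : Type*} [Field K] [Fintype ν] [DecidableEq ν] [LieRing L]
  [LieAlgebra K L] {n : ℕ} (b : Module.Basis (Fin n) K L) {φ : L →ₗ⁅K⁆ Matrix ν ν K}

theorem exists_evalOne_leftField_eq (hφ : Function.Injective φ) (t : Fin n → K) :
    ∃ f : MvPolynomial (ν × ν) K, evalOne f = 0 ∧ ∀ j, evalOne (leftField (φ (b j)) f) = t j := by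
  obtain ⟨ψ, hψ⟩ := (φ : L →ₗ[K] Matrix ν ν K).exists_leftInverse_of_injective
    (LinearMap.ker_eq_bot.mpr hφ)
  let τ : Matrix ν ν K →ₗ[K] K := (b.constr K t).comp ψ
  have hτ (j : Fin n) : τ (φ (b j)) = t j := by
    have : ψ (φ (b j)) = b j := LinearMap.congr_fun hψ (b j)
    simp [τ, this]
  refine ⟨∑ i, ∑ k, τ (single i k 1) •
    (MvPolynomial.X (i, k) - MvPolynomial.C ((1 : Matrix ν ν K) i k)), ?_, fun j => ?_⟩
  · simp [evalOne]
  · rw [evalOne_leftField_linear, hτ]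

variable [CharZero K]

theorem homogeneousComponent_eq_zero_of_orderedMap_eq_zero (hφ : Function.Injective φ)
    {p : MvPolynomial (Fin n) K} (hp : orderedMap b p = 0) :
    MvPolynomial.homogeneousComponent p.totalDegree p = 0 := by
  set d := p.totalDegree
  refine MvPolynomial.funext fun t => ?_
  obtain ⟨f, hf, hft⟩ := exists_evalOne_leftField_eq b hφ t
  have hterm : ∀ m ∈ p.support, evalOne (diffOpRep φ (orderedMap b
      (MvPolynomial.monomial m (p.coeff m))) (f ^ d)) =
        (d.factorial : K) * if m.degree = d then p.coeff m * ∏ j, t j ^ m j else 0 := by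
    intro m hm
    rw [orderedMap_monomial, map_smul, LinearMap.smul_apply, map_smul,
      map_diffOpRep_orderedMonomial b φ evalOne hf (MvPolynomial.le_totalDegree hm)]
    split_ifs
    · simp only [hft, smul_eq_mul]; ring
    · simp
  have hsum : (d.factorial : K) * ∑ m ∈ p.support with m.degree = d, p.coeff m * ∏ j, t j ^ m j =
      0 := by
    rw [Finset.sum_filter, Finset.mul_sum, ← Finset.sum_congr rfl hterm, ← map_sum,
      ← LinearMap.sum_apply, ← map_sum, ← map_sum, ← p.as_sum, hp]
    simp
  have h := (mul_eq_zero.mp hsum).resolve_left (Nat.cast_ne_zero.mpr d.factorial_ne_zero)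
  rw [MvPolynomial.homogeneousComponent_apply, map_sum, map_zero, ← h]
  refine Finset.sum_congr rfl fun m _ => ?_
  rw [MvPolynomial.eval_monomial, Finsupp.prod_fintype _ _ (by simp)]

theorem orderedMap_injective (hφ : Function.Injective φ) : Function.Injective (orderedMap b) := by
  rw [injective_iff_map_eq_zero]
  intro p hp
  by_contra hne
  obtain ⟨m, hm, hmd⟩ := Finset.exists_mem_eq_sup p.support
    (MvPolynomial.support_nonempty.mpr hne) fun m => m.degree
  have hcoeff : MvPolynomial.coeff m (MvPolynomial.homogeneousComponent p.totalDegree p) =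
      p.coeff m := by
    rw [MvPolynomial.coeff_homogeneousComponent, if_pos]
    exact hmd.symm
  rw [homogeneousComponent_eq_zero_of_orderedMap_eq_zero b hφ hp] at hcoeff
  exact MvPolynomial.mem_support_iff.mp hm (by simpa using hcoeff.symm)

theorem orderedMap_mem_orderedLT_iff (hφ : Function.Injective φ) {p : MvPolynomial (Fin n) K}
    {d : ℕ} : orderedMap b p ∈ orderedLT b (d + 1) ↔ p.totalDegree ≤ d := by
  rw [← mem_restrictSupport_degree_lt_iff]
  exact (orderedMap_injective b hφ).mem_set_image

end Independence

/-! ### The degree and the maps `β_d` in terms of `pbwMap` -/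

theorem orderedMonomial_gtLieBasis : orderedMonomial gtLieBasis = pbwMonomial := by
  ext m
  simp only [orderedMonomial, pbwMonomial, gtLieBasis_apply]

theorem orderedMap_gtLieBasis : orderedMap gtLieBasis = pbwMap := by
  rw [orderedMap, orderedMonomial_gtLieBasis, pbwMap]

theorem pbwMap_injective : Function.Injective pbwMap := by
  rw [← orderedMap_gtLieBasis]
  exact orderedMap_injective gtLieBasis (φ := SL3Lie.incl) Subtype.val_injective

theorem pbwMap_surjective : Function.Surjective pbwMap := by
  rw [← orderedMap_gtLieBasis]
  exact orderedMap_surjective gtLieBasis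

theorem pbwCoords_pbwMap (p : MvPolynomial (Fin 8) ℂ) : pbwCoords (pbwMap p) = p :=
  Function.leftInverse_invFun pbwMap_injective p

theorem Ule_eq_orderedLT (d : ℕ) : Ule d = orderedLT gtLieBasis (d + 1) := by
  rw [orderedLT_eq_span, orderedMonomial_gtLieBasis]
  refine le_antisymm ?_ (Submodule.span_le.mpr ?_)
  · exact iSup₂_le fun n hn => Submodule.span_mono <| Set.image_mono fun m hm =>
      Nat.lt_succ_of_le ((le_of_eq hm).trans hn)
  · rintro _ ⟨m, hm, rfl⟩
    exact Submodule.mem_iSup_of_mem m.degree <| Submodule.mem_iSup_of_mem (Nat.le_of_lt_succ hm) <|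
      Submodule.subset_span ⟨m, rfl, rfl⟩

theorem Udeg_pbwMap (p : MvPolynomial (Fin 8) ℂ) : Udeg (pbwMap p) = p.totalDegree := by
  have : {d | pbwMap p ∈ Ule d} = Set.Ici p.totalDegree := by
    ext d
    rw [Set.mem_ofPred_eq, Ule_eq_orderedLT, ← orderedMap_gtLieBasis,
      orderedMap_mem_orderedLT_iff gtLieBasis (φ := SL3Lie.incl) Subtype.val_injective, Set.mem_Ici]
  rw [Udeg, this, csInf_Ici]

theorem betaHom_pbwMap (d : ℕ) (p : MvPolynomial (Fin 8) ℂ) :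
    betaHom d (pbwMap p) = MvPolynomial.aeval (fun j => linPoly (gtMatrix j))
      (MvPolynomial.homogeneousComponent d p) := by
  rw [betaHom, beta, Uproj, pbwCoords_pbwMap, pbwCoords_pbwMap]

/-! ### One-parameter subgroups -/

section exponential

variable {𝔸 : Type*} [NormedRing 𝔸] [NormedAlgebra ℂ 𝔸] [CompleteSpace 𝔸]

theorem hasDerivAt_clm_exp_smul (φ : 𝔸 →L[ℂ] ℂ) (X : 𝔸) :
    HasDerivAt (fun t : ℝ => φ (NormedSpace.exp ((t : ℂ) • X))) (φ X) 0 := by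
  have h : HasDerivAt (fun t : ℂ => NormedSpace.exp (t • X)) X 0 := by
    simpa using hasDerivAt_exp_smul_const (𝕂 := ℂ) X (0 : ℂ)
  exact (φ.hasFDerivAt.comp_hasDerivAt (0 : ℂ) h).comp_ofReal (z := 0)

theorem hasDerivAt_clm_exp_smul_conj (φ : 𝔸 →L[ℂ] ℂ) (X A : 𝔸) :
    HasDerivAt
      (fun t : ℝ => φ (NormedSpace.exp ((t : ℂ) • X) * A * NormedSpace.exp (-((t : ℂ) • X))))
      (φ (X * A - A * X)) 0 := by
  have hX : HasDerivAt (fun t : ℂ => NormedSpace.exp (t • X)) X 0 := by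
    simpa using hasDerivAt_exp_smul_const (𝕂 := ℂ) X (0 : ℂ)
  have hnegX : HasDerivAt (fun t : ℂ => NormedSpace.exp (-(t • X))) (-X) 0 := by
    simpa using hasDerivAt_exp_smul_const (𝕂 := ℂ) (-X) (0 : ℂ)
  have h := (hX.mul_const A).mul hnegX
  rw [zero_smul, neg_zero, NormedSpace.exp_zero, mul_one, one_mul, mul_neg,
    ← sub_eq_add_neg] at h
  exact (φ.hasFDerivAt.comp_hasDerivAt (0 : ℂ) h).comp_ofReal (z := 0)

end exponential

section matrixExponential

open scoped Matrix.Norms.Operator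

variable {n : Type*} [Fintype n] [DecidableEq n]

theorem hasDerivAt_matrix_exp_smul_conj (φ : Matrix n n ℂ →ₗ[ℂ] ℂ) (X A : Matrix n n ℂ) :
    HasDerivAt
      (fun t : ℝ => φ (NormedSpace.exp ((t : ℂ) • X) * A * NormedSpace.exp (-((t : ℂ) • X))))
      (φ (X * A - A * X)) 0 :=
  hasDerivAt_clm_exp_smul_conj (𝔸 := Matrix n n ℂ) (LinearMap.toContinuousLinearMap φ) X A

theorem eq_of_forall_matrix_exp_smul_eq {X Y : Matrix n n ℂ}
    (h : ∀ t : ℝ, NormedSpace.exp ((t : ℂ) • X) = NormedSpace.exp ((t : ℂ) • Y)) : X = Y := by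
  refine Matrix.ext fun i j => ?_
  have hder := fun Z : Matrix n n ℂ => hasDerivAt_clm_exp_smul (𝔸 := Matrix n n ℂ)
    (LinearMap.toContinuousLinearMap (Matrix.entryLinearMap ℂ ℂ i j)) Z
  exact (hder X).unique ((hder Y).congr_of_eventuallyEq (.of_forall fun t => congrArg _ (h t)))

end matrixExponential

theorem det_exp_smul_of_isHermitian {n : Type*} [Fintype n] [DecidableEq n] {H : Matrix n n ℂ}
    (hH : H.IsHermitian) (c : ℂ) :
    (NormedSpace.exp (c • H)).det = Complex.exp (c * H.trace) := by
  set U : Matrix n n ℂ := (hH.eigenvectorUnitary : Matrix n n ℂ)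
  have hUU : U * star U = 1 := (Matrix.mem_unitaryGroup_iff).mp hH.eigenvectorUnitary.2
  have hU : IsUnit U := IsUnit.of_mul_eq_one _ hUU
  have hspec : H = U * Matrix.diagonal (fun i => (hH.eigenvalues i : ℂ)) * U⁻¹ := by
    rw [Matrix.inv_eq_right_inv hUU]
    simpa [Unitary.conjStarAlgAut_apply, Function.comp_def] using hH.spectral_theorem
  have htr : H.trace = ∑ i, (hH.eigenvalues i : ℂ) := by
    simpa using hH.trace_eq_sum_eigenvalues
  have hc : c • H = U * Matrix.diagonal (fun i => c * (hH.eigenvalues i : ℂ)) * U⁻¹ := by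
    conv_lhs => rw [hspec]
    rw [← Matrix.smul_mul, ← Matrix.mul_smul, ← Matrix.diagonal_smul]
    rfl
  rw [hc, Matrix.exp_conj U _ hU, Matrix.det_conj hU, Matrix.exp_diagonal, Matrix.det_diagonal,
    htr, Finset.mul_sum, Complex.exp_sum]
  exact Finset.prod_congr rfl fun i _ => by rw [Pi.coe_exp, Complex.exp_eq_exp_ℂ]

theorem exp_mem_specialUnitaryGroup {n : Type*} [Fintype n] [DecidableEq n] {X : Matrix n n ℂ}
    (hX : Xᴴ = -X) (ht : X.trace = 0) :
    NormedSpace.exp X ∈ Matrix.specialUnitaryGroup n ℂ := by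
  refine Matrix.mem_specialUnitaryGroup_iff.mpr ⟨?_, ?_⟩
  · rw [Matrix.mem_unitaryGroup_iff', Matrix.star_eq_conjTranspose, ← Matrix.exp_conjTranspose, hX,
      Matrix.exp_neg, Matrix.nonsing_inv_mul]
    exact (Matrix.isUnit_iff_isUnit_det _).mp (Matrix.isUnit_exp X)
  · have hH : (Complex.I • X).IsHermitian := by
      rw [Matrix.IsHermitian, Matrix.conjTranspose_smul, hX]
      simp
    simpa [smul_smul, ht] using det_exp_smul_of_isHermitian hH (-Complex.I)

/-- The one-parameter subgroup `t ↦ exp (t E_k)` of `SU(3)`. -/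
def expSU (k : Fin 8) (t : ℝ) : SU3 :=
  ⟨NormedSpace.exp ((t : ℂ) • suBasis k), exp_mem_specialUnitaryGroup
    (by rw [Matrix.conjTranspose_smul, conjTranspose_suBasis]; simp)
    (by rw [Matrix.trace_smul, trace_suBasis, smul_zero])⟩

theorem coe_expSU (k : Fin 8) (t : ℝ) :
    (expSU k t : Mat3) = NormedSpace.exp ((t : ℂ) • suBasis k) := rfl

theorem SU3.coe_mul_inv (g : SU3) : (g : Mat3) * ((g⁻¹ : SU3) : Mat3) = 1 := by
  rw [← Submonoid.coe_mul, mul_inv_cancel, Submonoid.coe_one]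

theorem SU3.coe_inv_mul (g : SU3) : ((g⁻¹ : SU3) : Mat3) * (g : Mat3) = 1 := by
  rw [← Submonoid.coe_mul, inv_mul_cancel, Submonoid.coe_one]

theorem SU3.coe_inv (g : SU3) : ((g⁻¹ : SU3) : Mat3) = (g : Mat3)⁻¹ :=
  (Matrix.inv_eq_right_inv (SU3.coe_mul_inv g)).symm

theorem coe_expSU_inv (k : Fin 8) (t : ℝ) :
    (((expSU k t)⁻¹ : SU3) : Mat3) = NormedSpace.exp (-((t : ℂ) • suBasis k)) := by
  rw [SU3.coe_inv, coe_expSU, Matrix.exp_neg]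

/-! ### The adjoint action -/

theorem adMat_mul (g h : SU3) (X : Mat3) : adMat (g * h) X = adMat g (adMat h X) := by
  simp only [adMat, _root_.mul_inv_rev, Submonoid.coe_mul, mul_assoc]

theorem adMat_one (X : Mat3) : adMat 1 X = X := by simp [adMat]

theorem trace_adMat (g : SU3) (X : Mat3) : (adMat g X).trace = X.trace := by
  rw [adMat, Matrix.trace_mul_comm, ← mul_assoc, SU3.coe_inv_mul, one_mul]

theorem conjTranspose_adMat (g : SU3) (X : Mat3) : (adMat g X)ᴴ = adMat g Xᴴ := by
  have hg : ((g⁻¹ : SU3) : Mat3) = (g : Mat3)ᴴ := rfl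
  simp only [adMat, hg, Matrix.conjTranspose_mul, Matrix.conjTranspose_conjTranspose, mul_assoc]

theorem adMat_mul_adMat (g : SU3) (X Y : Mat3) : adMat g X * adMat g Y = adMat g (X * Y) := by
  calc adMat g X * adMat g Y
      = g * X * (((g⁻¹ : SU3) : Mat3) * g) * Y * ((g⁻¹ : SU3) : Mat3) := by
        simp only [adMat, mul_assoc]
    _ = adMat g (X * Y) := by rw [SU3.coe_inv_mul, mul_one]; simp only [adMat, mul_assoc]

theorem adMat_sum_smul {ι : Type*} (s : Finset ι) (g : SU3) (c : ι → ℂ) (X : ι → Mat3) :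
    adMat g (∑ i ∈ s, c i • X i) = ∑ i ∈ s, c i • adMat g (X i) := by
  simp [adMat, Finset.mul_sum, Finset.sum_mul]

theorem exp_smul_adMat (g : SU3) (c : ℂ) (X : Mat3) :
    NormedSpace.exp (c • adMat g X) = adMat g (NormedSpace.exp (c • X)) := by
  have hg : IsUnit (g : Mat3) := IsUnit.of_mul_eq_one _ (SU3.coe_mul_inv g)
  simp only [adMat, SU3.coe_inv]
  rw [← Matrix.exp_conj _ _ hg, Matrix.mul_smul, Matrix.smul_mul]

theorem continuous_adMat (X : Mat3) : Continuous fun g : SU3 => adMat g X :=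
  (continuous_subtype_val.mul continuous_const).mul (continuous_subtype_val.comp continuous_inv)

theorem adMat_suBasis (g : SU3) (k : Fin 8) :
    adMat g (suBasis k) = ∑ j, suCoord (adMat g (suBasis k)) j • suBasis j := by
  rw [sum_suCoord_smul_suBasis, trace_adMat, trace_suBasis, zero_div, zero_smul, sub_zero]

/-- The adjoint representation of `SU(3)`, in matrices with respect to the basis
`E_1, …, E_8`. -/
def adRep : SU3 →* Matrix (Fin 8) (Fin 8) ℂ where
  toFun g := Matrix.of fun j k => suCoord (adMat g (suBasis k)) j
  map_one' := by
    ext j k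
    simp [adMat_one, suCoord_suBasis, Matrix.one_apply]
  map_mul' g h := by
    ext j k
    simp only [Matrix.of_apply, Matrix.mul_apply]
    rw [adMat_mul, adMat_suBasis h, adMat_sum_smul, suCoord_sum, Finset.sum_apply]
    refine Finset.sum_congr rfl fun l _ => ?_
    rw [suCoord_smul, Pi.smul_apply, smul_eq_mul, mul_comm, ← adMat_suBasis h]

theorem adRep_apply (g : SU3) (j k : Fin 8) : adRep g j k = suCoord (adMat g (suBasis k)) j := rfl

theorem continuous_adRep : Continuous adRep :=
  continuous_matrix fun j k => (continuous_suCoord j).comp (continuous_adMat (suBasis k))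

theorem suCoord_eq_sum_adRep_mul (g : SU3) (X : Mat3) (k : Fin 8) :
    suCoord X k = ∑ j, adRep g j k * suCoord (adMat g X) j := by
  calc suCoord X k = -(adMat g (suBasis k) * adMat g X).trace := by
        rw [adMat_mul_adMat, trace_adMat, suCoord_eq_neg_trace]
    _ = ∑ j, adRep g j k * suCoord (adMat g X) j := by
        rw [adMat_suBasis, Finset.sum_mul, Matrix.trace_sum, ← Finset.sum_neg_distrib]
        refine Finset.sum_congr rfl fun j _ => ?_
        rw [Matrix.smul_mul, Matrix.trace_smul, suCoord_eq_neg_trace (adMat g X), adRep_apply,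
          smul_eq_mul, mul_neg]

/-! ### Functions on adjoint orbits -/

section orbit

variable {ξ : Mat3}

instance instCompactSpaceOrbit : CompactSpace (adOrbit ξ) :=
  isCompact_iff_compactSpace.mp (isCompact_range (continuous_adMat ξ))

theorem adOn_mul (g h : SU3) (x : adOrbit ξ) : adOn (g * h) x = adOn g (adOn h x) :=
  Subtype.ext (adMat_mul g h x)

theorem adOn_one (x : adOrbit ξ) : adOn 1 x = x := Subtype.ext (adMat_one x)

theorem adOn_inv_adOn (g : SU3) (x : adOrbit ξ) : adOn g⁻¹ (adOn g x) = x := by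
  rw [← adOn_mul, inv_mul_cancel, adOn_one]

theorem adOn_adOn_inv (g : SU3) (x : adOrbit ξ) : adOn g (adOn g⁻¹ x) = x := by
  rw [← adOn_mul, mul_inv_cancel, adOn_one]

theorem exists_adOn_basePoint (x : adOrbit ξ) : ∃ g : SU3, adOn g (basePoint ξ) = x := by
  obtain ⟨g, hg⟩ := x.2
  exact ⟨g, Subtype.ext hg⟩

theorem continuous_adOn (x : adOrbit ξ) : Continuous fun g : SU3 => adOn g x :=
  (continuous_adMat (x : Mat3)).subtype_mk _

theorem resOrbit_apply (F : PolySU3) (x : adOrbit ξ) :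
    (resOrbit ξ F).1 x = MvPolynomial.eval (suCoord x) F := by
  change (Pi.evalAlgHom ℂ (fun _ : adOrbit ξ => ℂ) x) (restrictPoly ξ F) = _
  rw [restrictPoly, MvPolynomial.comp_aeval_apply]
  rfl

theorem exists_resOrbit (f : PolyOrbit ξ) : ∃ F, resOrbit ξ F = f := by
  obtain ⟨F, hF⟩ := f.2
  exact ⟨F, Subtype.ext hF⟩

/-- Restriction to the orbit, as a homomorphism onto `Poly(O_ξ)`. -/
def resHom (ξ : Mat3) : PolySU3 →ₐ[ℂ] PolyOrbit ξ := (restrictPoly ξ).rangeRestrict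

theorem resHom_apply (F : PolySU3) : resHom ξ F = resOrbit ξ F := rfl

theorem continuous_polyOrbit (f : PolyOrbit ξ) : Continuous f.1 := by
  obtain ⟨F, rfl⟩ := exists_resOrbit f
  rw [funext (resOrbit_apply F)]
  exact (MvPolynomial.continuous_eval F).comp
    (continuous_pi fun j => (continuous_suCoord j).comp continuous_subtype_val)

/-- The inclusion of `Poly(O_ξ)` in the algebra of continuous functions, whose norm is the supremum
norm. -/
def toC (ξ : Mat3) : PolyOrbit ξ →ₐ[ℂ] C(adOrbit ξ, ℂ) where
  toFun f := ⟨f.1, continuous_polyOrbit f⟩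
  map_one' := rfl
  map_mul' _ _ := rfl
  map_zero' := rfl
  map_add' _ _ := rfl
  commutes' _ := rfl

theorem toC_apply (f : PolyOrbit ξ) (x : adOrbit ξ) : toC ξ f x = f.1 x := rfl

end orbit

/-! ### The Poisson bracket -/

theorem poissonBracket_antisymm (F G : PolySU3) : poissonBracket F G = -poissonBracket G F := by
  simp only [poissonBracket, ← Finset.sum_neg_distrib]
  rw [Finset.sum_comm]
  refine Finset.sum_congr rfl fun j _ => Finset.sum_congr rfl fun k _ =>
    Finset.sum_congr rfl fun l _ => ?_
  rw [structConst_swap_left, map_neg]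
  ring

theorem poissonBracket_mul_left (F F' G : PolySU3) :
    poissonBracket (F * F') G = F * poissonBracket F' G + poissonBracket F G * F' := by
  simp only [poissonBracket, Finset.mul_sum, Finset.sum_mul, ← Finset.sum_add_distrib]
  refine Finset.sum_congr rfl fun j _ => Finset.sum_congr rfl fun k _ =>
    Finset.sum_congr rfl fun l _ => ?_
  rw [Derivation.leibniz, smul_eq_mul, smul_eq_mul]
  ring

/-- The Poisson bracket as a bilinear map. -/
def poissonBilin : PolySU3 →ₗ[ℂ] PolySU3 →ₗ[ℂ] PolySU3 :=
  LinearMap.mk₂ ℂ poissonBracket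
    (fun F F' G => by
      simp only [poissonBracket, map_add, mul_add, add_mul, Finset.sum_add_distrib])
    (fun c F G => by
      simp only [poissonBracket, Derivation.map_smul, Finset.smul_sum, mul_smul_comm,
        smul_mul_assoc])
    (fun F G G' => by simp only [poissonBracket, map_add, mul_add, Finset.sum_add_distrib])
    (fun c F G => by
      simp only [poissonBracket, Derivation.map_smul, Finset.smul_sum, mul_smul_comm])

theorem poissonBilin_apply (F G : PolySU3) : poissonBilin F G = poissonBracket F G := rfl

theorem poissonBracket_X_right (F : PolySU3) (k : Fin 8) :
    poissonBracket F (MvPolynomial.X k) =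
      ∑ j, ∑ l,
        MvPolynomial.C (structConst k j l) * MvPolynomial.X l * MvPolynomial.pderiv j F := by
  refine Finset.sum_congr rfl fun j _ => ?_
  rw [Finset.sum_eq_single k]
  · simp
  · intro b _ hb
    simp [MvPolynomial.pderiv_X_of_ne hb.symm]
  · simp

theorem poissonBracket_X_X (k l : Fin 8) :
    poissonBracket (MvPolynomial.X k) (MvPolynomial.X l) =
      ∑ m, structConst l k m • (MvPolynomial.X m : PolySU3) := by
  rw [poissonBracket_X_right, Finset.sum_eq_single k]
  · simp [MvPolynomial.smul_eq_C_mul]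
  · intro b _ hb
    simp [MvPolynomial.pderiv_X_of_ne hb.symm]
  · simp

theorem poissonBracket_eq_sum_pderiv_mul (F G : PolySU3) :
    poissonBracket F G = ∑ k, MvPolynomial.pderiv k G * poissonBracket F (MvPolynomial.X k) := by
  simp only [poissonBracket_X_right, Finset.mul_sum]
  rw [poissonBracket, Finset.sum_comm]
  refine Finset.sum_congr rfl fun k _ => Finset.sum_congr rfl fun j _ =>
    Finset.sum_congr rfl fun l _ => ?_
  ring

theorem hasDerivAt_eval {σ : Type*} [Fintype σ] (F : MvPolynomial σ ℂ) {c : ℝ → σ → ℂ}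
    {c' : σ → ℂ} {t : ℝ} (h : ∀ j, HasDerivAt (fun t => c t j) (c' j) t) :
    HasDerivAt (fun t => MvPolynomial.eval (c t) F)
      (∑ j, c' j * MvPolynomial.eval (c t) (MvPolynomial.pderiv j F)) t := by
  classical
  induction F using MvPolynomial.induction_on with
  | C a => simpa using hasDerivAt_const t a
  | add p q hp hq =>
    simp only [map_add, mul_add, Finset.sum_add_distrib]
    exact hp.add hq
  | mul_X p i hp =>
    have leibniz : ∀ j,
        c' j * MvPolynomial.eval (c t) (MvPolynomial.pderiv j (p * MvPolynomial.X i)) =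
          c' j * MvPolynomial.eval (c t) (MvPolynomial.pderiv j p) * c t i +
            if j = i then MvPolynomial.eval (c t) p * c' i else 0 := by
      intro j
      rw [Derivation.leibniz]
      split_ifs with hj
      · subst hj; simp; ring
      · simp [MvPolynomial.pderiv_X_of_ne (Ne.symm hj)]; ring
    simp only [leibniz, Finset.sum_add_distrib, ← Finset.sum_mul, Finset.sum_ite_eq',
      Finset.mem_univ, if_true, map_mul, MvPolynomial.eval_X]
    exact hp.mul (h i)

theorem suCoord_commutator_suBasis (k j : Fin 8) (x : Mat3) :
    suCoord (suBasis k * x - x * suBasis k) j = ∑ l, structConst k l j * suCoord x l := by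
  have hx : x = ∑ l, suCoord x l • suBasis l + (x.trace / 3) • (1 : Mat3) := by
    rw [sum_suCoord_smul_suBasis, sub_add_cancel]
  have hcomm : suBasis k * x - x * suBasis k = ∑ l, suCoord x l • ⁅suBasis k, suBasis l⁆ := by
    conv_lhs => rw [hx]
    simp only [mul_add, add_mul, mul_smul_comm, smul_mul_assoc, mul_one, one_mul,
      add_sub_add_right_eq_sub, Finset.mul_sum, Finset.sum_mul, ← Finset.sum_sub_distrib,
      ← smul_sub, Ring.lie_def]
  rw [hcomm, suCoord_sum, Finset.sum_apply]
  refine Finset.sum_congr rfl fun l _ => ?_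
  rw [suCoord_smul, Pi.smul_apply, smul_eq_mul, mul_comm, structConst]

theorem hasDerivAt_eval_adMat (F : PolySU3) (k : Fin 8) (x : Mat3) :
    HasDerivAt (fun t : ℝ => MvPolynomial.eval (suCoord (adMat (expSU k t) x)) F)
      (-MvPolynomial.eval (suCoord x) (poissonBracket F (MvPolynomial.X k))) 0 := by
  have hcoord : ∀ j, HasDerivAt (fun t : ℝ => suCoord (adMat (expSU k t) x) j)
      (suCoord (suBasis k * x - x * suBasis k) j) 0 := fun j => by
    simp only [adMat, coe_expSU_inv, coe_expSU]
    exact hasDerivAt_matrix_exp_smul_conj ((LinearMap.proj j).comp suCoordLin) (suBasis k) x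
  have h0 : adMat (expSU k 0) x = x := by
    rw [adMat, coe_expSU_inv, coe_expSU]
    simp
  convert hasDerivAt_eval F hcoord using 1
  rw [h0, poissonBracket_X_right]
  simp only [map_sum, map_mul, MvPolynomial.eval_C, MvPolynomial.eval_X,
    suCoord_commutator_suBasis, ← Finset.sum_neg_distrib, Finset.sum_mul]
  refine Finset.sum_congr rfl fun j _ => Finset.sum_congr rfl fun l _ => ?_
  rw [structConst_swap_right k l j]
  ring

section orbit

variable {ξ : Mat3}

theorem hasDerivAt_resOrbit (F : PolySU3) (k : Fin 8) (x : adOrbit ξ) :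
    HasDerivAt (fun t : ℝ => (resOrbit ξ F).1 (adOn (expSU k t) x))
      (-(resOrbit ξ (poissonBracket F (MvPolynomial.X k))).1 x) 0 := by
  simp only [resOrbit_apply]
  exact hasDerivAt_eval_adMat F k x

theorem resOrbit_poissonBracket_congr_left {F F' : PolySU3} (G : PolySU3)
    (h : resOrbit ξ F = resOrbit ξ F') :
    resOrbit ξ (poissonBracket F G) = resOrbit ξ (poissonBracket F' G) := by
  have hX : ∀ k, resOrbit ξ (poissonBracket F (MvPolynomial.X k)) =
      resOrbit ξ (poissonBracket F' (MvPolynomial.X k)) := fun k => by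
    refine Subtype.ext (funext fun x => ?_)
    have hF := hasDerivAt_resOrbit F k x
    rw [h] at hF
    exact neg_injective (hF.unique (hasDerivAt_resOrbit F' k x))
  rw [poissonBracket_eq_sum_pderiv_mul F, poissonBracket_eq_sum_pderiv_mul F', ← resHom_apply,
    ← resHom_apply, map_sum, map_sum]
  exact Finset.sum_congr rfl fun k _ => by
    simp only [map_mul, resHom_apply (poissonBracket _ _), hX k]

theorem resOrbit_poissonBracket_congr {F F' G G' : PolySU3}
    (hF : resOrbit ξ F = resOrbit ξ F') (hG : resOrbit ξ G = resOrbit ξ G') :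
    resOrbit ξ (poissonBracket F G) = resOrbit ξ (poissonBracket F' G') := by
  rw [resOrbit_poissonBracket_congr_left G hF, poissonBracket_antisymm F' G,
    poissonBracket_antisymm F' G', ← resHom_apply, ← resHom_apply, map_neg, map_neg, resHom_apply,
    resHom_apply, resOrbit_poissonBracket_congr_left F' hG]

end orbit

/-! ### Quark systems and symbol correspondences -/

section quark

open UniversalEnvelopingAlgebra (ι)

variable {ω ξ : Mat3} (Q : QuarkSystem ω)

/-- The adjoint action on `sl(3)`. -/
def adLie (g : SU3) (X : SL3Lie) : SL3Lie :=
  ⟨adMat g X, (trace_adMat g X).trans X.2⟩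

theorem coe_adLie (g : SU3) (X : SL3Lie) : (adLie g X : Mat3) = adMat g X := rfl

theorem adLie_suLieBasis (g : SU3) (k : Fin 8) :
    adLie g (suLieBasis k) = ∑ j, adRep g j k • suLieBasis j := by
  rw [← suLieBasis.sum_repr (adLie g (suLieBasis k))]
  simp only [suLieBasis_repr, coe_adLie, coe_suLieBasis, adRep_apply]

theorem rep_expSU (k : Fin 8) (t : ℝ) :
    (Q.rep (expSU k t) : Q.Op) = NormedSpace.exp ((t : ℂ) • Q.diff (suLieBasis k)) := by
  rw [← map_smul]
  refine Q.rep_exp _ _ ?_ ?_ <;> rw [Submodule.coe_smul, coe_suLieBasis]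
  · rw [Matrix.conjTranspose_smul, conjTranspose_suBasis]
    simp
  · rfl

theorem coe_rep_mul (g h : SU3) : (Q.rep (g * h) : Q.Op) = Q.rep g * Q.rep h := by
  rw [map_mul]
  rfl

theorem rep_inv_mul_rep (g : SU3) : (Q.rep g⁻¹ : Q.Op) * (Q.rep g : Q.Op) = 1 := by
  rw [← coe_rep_mul, inv_mul_cancel, map_one]
  rfl

theorem rep_mul_rep_inv (g : SU3) : (Q.rep g : Q.Op) * (Q.rep g⁻¹ : Q.Op) = 1 := by
  rw [← coe_rep_mul, mul_inv_cancel, map_one]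
  rfl

theorem coe_rep_inv (g : SU3) : (Q.rep g⁻¹ : Q.Op) = (Q.rep g : Q.Op)⁻¹ :=
  (Matrix.inv_eq_right_inv (rep_mul_rep_inv Q g)).symm

theorem rep_conj_diff_suLieBasis (g : SU3) (k : Fin 8) :
    (Q.rep g : Q.Op) * Q.diff (suLieBasis k) * (Q.rep g⁻¹ : Q.Op) =
      Q.diff (adLie g (suLieBasis k)) := by
  refine eq_of_forall_matrix_exp_smul_eq fun t => ?_
  have hU : IsUnit (Q.rep g : Q.Op) := IsUnit.of_mul_eq_one _ (rep_mul_rep_inv Q g)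
  have hexp : (Q.rep (g * expSU k t * g⁻¹) : Q.Op) =
      NormedSpace.exp (Q.diff ((t : ℂ) • adLie g (suLieBasis k))) := by
    refine Q.rep_exp _ _ ?_ ?_ <;> rw [Submodule.coe_smul, coe_adLie, coe_suLieBasis]
    · rw [Matrix.conjTranspose_smul, conjTranspose_adMat, conjTranspose_suBasis]
      simp [adMat]
    · rw [exp_smul_adMat, ← coe_expSU]
      rfl
  rw [← map_smul, ← hexp, coe_rep_mul, coe_rep_mul, rep_expSU, coe_rep_inv,
    ← Matrix.exp_conj _ _ hU, Matrix.mul_smul, Matrix.smul_mul]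

theorem rho_ι (X : SL3Lie) : Q.rho (ι ℂ X) = Q.diff X :=
  UniversalEnvelopingAlgebra.lift_ι_apply ℂ Q.diff X

theorem rep_conj_rho_ι_suLieBasis (g : SU3) (k : Fin 8) :
    (Q.rep g : Q.Op) * Q.rho (ι ℂ (suLieBasis k)) * (Q.rep g⁻¹ : Q.Op) =
      ∑ j, adRep g j k • Q.rho (ι ℂ (suLieBasis j)) := by
  simp only [rho_ι, rep_conj_diff_suLieBasis, adLie_suLieBasis, map_sum, map_smul]

variable {Q}

theorem IsSymbolCorrespondence.apply_adOn_expSU {W : Q.Op →ₗ[ℂ] PolyOrbit ξ}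
    (hW : IsSymbolCorrespondence Q ξ W) (k : Fin 8) (t : ℝ) (A : Q.Op) (x : adOrbit ξ) :
    (W A).1 (adOn (expSU k t) x) =
      (W (NormedSpace.exp ((t : ℂ) • -Q.diff (suLieBasis k)) * A *
        NormedSpace.exp (-((t : ℂ) • -Q.diff (suLieBasis k))))).1 x := by
  have h := hW.equivariant (expSU k t)⁻¹ A (adOn (expSU k t) x)
  rw [inv_inv, adOn_inv_adOn, coe_rep_inv, rep_expSU, ← Matrix.exp_neg] at h
  rw [← h, smul_neg, neg_neg]

theorem IsSymbolCorrespondence.lie_apply {W : Q.Op →ₗ[ℂ] PolyOrbit ξ}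
    (hW : IsSymbolCorrespondence Q ξ W) (k : Fin 8) (A : Q.Op) {F : PolySU3}
    (hF : W A = resOrbit ξ F) :
    W (Q.diff (suLieBasis k) * A - A * Q.diff (suLieBasis k)) =
      resOrbit ξ (poissonBracket F (MvPolynomial.X k)) := by
  refine Subtype.ext (funext fun x => ?_)
  let φ : Q.Op →ₗ[ℂ] ℂ :=
    (LinearMap.proj x : (adOrbit ξ → ℂ) →ₗ[ℂ] ℂ) ∘ₗ (PolyOrbit ξ).val.toLinearMap ∘ₗ W
  have hder : HasDerivAt (fun t : ℝ => (resOrbit ξ F).1 (adOn (expSU k t) x))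
      (φ (-Q.diff (suLieBasis k) * A - A * -Q.diff (suLieBasis k))) 0 := by
    simp only [← hF, hW.apply_adOn_expSU]
    exact hasDerivAt_matrix_exp_smul_conj φ (-Q.diff (suLieBasis k)) A
  have hneg : -Q.diff (suLieBasis k) * A - A * -Q.diff (suLieBasis k) =
      -(Q.diff (suLieBasis k) * A - A * Q.diff (suLieBasis k)) := by noncomm_ring
  rw [hneg, map_neg] at hder
  exact neg_injective (hder.unique (hasDerivAt_resOrbit F k x))

end quark

/-! ### Limits in finite-dimensional spaces -/

section limits

variable {𝕜 α : Type*} {l : Filter α}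

/-- The functions `f s` tend to `m` along `l` inside a fixed finite-dimensional subspace of `M`.
This replaces a topology on `M`, which need not carry one. -/
def TendstoInSpan (𝕜 : Type*) [Semiring 𝕜] [TopologicalSpace 𝕜] {M : Type*} [AddCommMonoid M]
    [Module 𝕜 M] (l : Filter α) (f : α → M) (m : M) : Prop :=
  ∃ (n : ℕ) (φ : Fin n → M) (c : α → Fin n → 𝕜) (c₀ : Fin n → 𝕜),
    (∀ i, Tendsto (c · i) l (𝓝 (c₀ i))) ∧ (∀ s, f s = ∑ i, c s i • φ i) ∧ m = ∑ i, c₀ i • φ i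

section semiring

variable [Semiring 𝕜] [TopologicalSpace 𝕜] {M N : Type*} [AddCommMonoid M] [Module 𝕜 M]

theorem tendstoInSpan_sum_smul {ι : Type*} [Fintype ι] (φ : ι → M) {c : α → ι → 𝕜} {c₀ : ι → 𝕜}
    (hc : ∀ i, Tendsto (c · i) l (𝓝 (c₀ i))) :
    TendstoInSpan 𝕜 l (fun s => ∑ i, c s i • φ i) (∑ i, c₀ i • φ i) := by
  let e := (Fintype.equivFin ι).symm
  exact ⟨_, φ ∘ e, fun s => c s ∘ e, c₀ ∘ e, fun i => hc (e i),
    fun s => (e.sum_comp fun i => c s i • φ i).symm, (e.sum_comp fun i => c₀ i • φ i).symm⟩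

theorem TendstoInSpan.tendsto_apply [AddCommMonoid N] [Module 𝕜 N] [TopologicalSpace N]
    [ContinuousAdd N] [ContinuousSMul 𝕜 N] {f : α → M} {m : M} (hf : TendstoInSpan 𝕜 l f m)
    {L : α → M →ₗ[𝕜] N} {L₀ : M →ₗ[𝕜] N}
    (hL : ∀ φ, Tendsto (fun s => L s φ) l (𝓝 (L₀ φ))) :
    Tendsto (fun s => L s (f s)) l (𝓝 (L₀ m)) := by
  obtain ⟨n, φ, c, c₀, hc, hf, rfl⟩ := hf
  simp only [hf, map_sum, map_smul]
  exact tendsto_finsetSum _ fun i _ => (hc i).smul (hL (φ i))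

end semiring

theorem TendstoInSpan.tendsto_apply₂ [CommSemiring 𝕜] [TopologicalSpace 𝕜] {M M' N : Type*}
    [AddCommMonoid M] [Module 𝕜 M] [AddCommMonoid M'] [Module 𝕜 M'] [AddCommMonoid N] [Module 𝕜 N]
    [TopologicalSpace N] [ContinuousAdd N] [ContinuousSMul 𝕜 N] {f : α → M} {m : M} {f' : α → M'}
    {m' : M'} (hf : TendstoInSpan 𝕜 l f m) (hf' : TendstoInSpan 𝕜 l f' m')
    {B : α → M →ₗ[𝕜] M' →ₗ[𝕜] N} {B₀ : M →ₗ[𝕜] M' →ₗ[𝕜] N}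
    (hB : ∀ φ φ', Tendsto (fun s => B s φ φ') l (𝓝 (B₀ φ φ'))) :
    Tendsto (fun s => B s (f s) (f' s)) l (𝓝 (B₀ m m')) :=
  hf'.tendsto_apply (L := fun s => B s (f s)) (L₀ := B₀ m) fun φ' =>
    hf.tendsto_apply (L := fun s => (B s).flip φ') (L₀ := B₀.flip φ') fun φ => hB φ φ'

theorem tendsto_inv_one_and_eventually_isUnit_det [Field 𝕜] [TopologicalSpace 𝕜]
    [IsTopologicalDivisionRing 𝕜] [T1Space 𝕜] {ι : Type*} [Fintype ι] [DecidableEq ι]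
    {M : α → Matrix ι ι 𝕜} (hM : Tendsto M l (𝓝 1)) :
    Tendsto (fun s => (M s)⁻¹) l (𝓝 1) ∧ ∀ᶠ s in l, IsUnit (M s).det := by
  have hdet : Tendsto (fun s => (M s).det) l (𝓝 1) := by
    rw [← Matrix.det_one (n := ι)]
    exact (continuous_id.matrix_det.tendsto (1 : Matrix ι ι 𝕜)).comp hM
  refine ⟨?_, (hdet.eventually_ne one_ne_zero).mono fun s hs => isUnit_iff_ne_zero.mpr hs⟩
  have hinv : ContinuousAt Inv.inv (1 : Matrix ι ι 𝕜) := by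
    refine continuousAt_matrix_inv _ ?_
    rw [Matrix.det_one, Ring.inverse_eq_inv']
    exact continuousAt_inv₀ one_ne_zero
  rw [ContinuousAt, inv_one] at hinv
  exact hinv.comp hM

theorem tendsto_zero_of_tendsto_mulVec_zero [Field 𝕜] [TopologicalSpace 𝕜]
    [IsTopologicalDivisionRing 𝕜] [T1Space 𝕜] {ι : Type*} [Fintype ι] [DecidableEq ι]
    {M : α → Matrix ι ι 𝕜} (hM : Tendsto M l (𝓝 1)) {v : α → ι → 𝕜}
    (hv : Tendsto (fun s => M s *ᵥ v s) l (𝓝 0)) : Tendsto v l (𝓝 0) := by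
  obtain ⟨hinv, hdet⟩ := tendsto_inv_one_and_eventually_isUnit_det hM
  have hcont : Continuous fun p : Matrix ι ι 𝕜 × (ι → 𝕜) => p.1 *ᵥ p.2 :=
    continuous_fst.matrix_mulVec continuous_snd
  have h := (hcont.tendsto' (1, 0) 0 (Matrix.mulVec_zero 1)).comp (hinv.prodMk_nhds hv)
  refine h.congr' (hdet.mono fun s hs => ?_)
  change (M s)⁻¹ *ᵥ (M s *ᵥ v s) = v s
  rw [Matrix.mulVec_mulVec, Matrix.nonsing_inv_mul _ hs, Matrix.one_mulVec]

theorem exists_tendsto_one_basis_eq_sum [Field 𝕜] [TopologicalSpace 𝕜]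
    [IsTopologicalDivisionRing 𝕜] [T1Space 𝕜] {ι E : Type*} [Fintype ι] [DecidableEq ι]
    [AddCommGroup E] [Module 𝕜 E] (b : Module.Basis ι 𝕜 E) {v : α → ι → E}
    (hv : ∀ a i, Tendsto (fun s => b.repr (v s a) i) l (𝓝 (b.repr (b a) i))) :
    ∃ N : α → Matrix ι ι 𝕜, Tendsto N l (𝓝 1) ∧ ∀ᶠ s in l, ∀ a, b a = ∑ a', N s a' a • v s a' := by
  have hM : Tendsto (fun s => b.toMatrix (v s)) l (𝓝 1) := by
    rw [← b.toMatrix_self]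
    exact tendsto_pi_nhds.mpr fun i => tendsto_pi_nhds.mpr fun a => hv a i
  obtain ⟨hinv, hdet⟩ := tendsto_inv_one_and_eventually_isUnit_det hM
  refine ⟨_, hinv, hdet.mono fun s hs a => ?_⟩
  have hcol (i : ι) : ∑ a', b.toMatrix (v s) i a' * (b.toMatrix (v s))⁻¹ a' a =
      if i = a then 1 else 0 := by
    rw [← Matrix.mul_apply, Matrix.mul_nonsing_inv _ hs, Matrix.one_apply]
  calc b a = ∑ i, (∑ a', b.toMatrix (v s) i a' * (b.toMatrix (v s))⁻¹ a' a) • b i := by simp [hcol]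
    _ = ∑ a', (b.toMatrix (v s))⁻¹ a' a • v s a' := by
      simp_rw [Finset.sum_smul]
      rw [Finset.sum_comm]
      refine Finset.sum_congr rfl fun a' _ => ?_
      conv_rhs => rw [← b.sum_toMatrix_smul_self (v s) a', Finset.smul_sum]
      simp_rw [smul_smul, mul_comm]

section finiteDimensional

variable [NontriviallyNormedField 𝕜] [CompleteSpace 𝕜] {E F G : Type*} [AddCommGroup E] [Module 𝕜 E]
  [AddCommGroup F] [Module 𝕜 F] [TopologicalSpace F] [IsTopologicalAddGroup F] [ContinuousSMul 𝕜 F]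
  [T2Space F] [FiniteDimensional 𝕜 F]

theorem tendsto_apply_of_tendsto_injective [AddCommGroup G] [Module 𝕜 G] [TopologicalSpace G]
    [IsTopologicalAddGroup G] [ContinuousSMul 𝕜 G] {L : E →ₗ[𝕜] F} (hL : Function.Injective L)
    {e : α → E} {e₀ : E} (he : Tendsto (fun s => L (e s)) l (𝓝 (L e₀))) (φ : E →ₗ[𝕜] G) :
    Tendsto (fun s => φ (e s)) l (𝓝 (φ e₀)) := by
  obtain ⟨P, hP⟩ := L.exists_leftInverse_of_injective (LinearMap.ker_eq_bot.mpr hL)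
  have hP (e : E) : P (L e) = e := DFunLike.congr_fun hP e
  simpa only [Function.comp_def, LinearMap.comp_apply, hP] using
    ((φ ∘ₗ P).continuous_of_finiteDimensional.tendsto _).comp he

theorem tendsto_repr_zero_of_tendsto_apply_zero {ι : Type*} [Finite ι]
    (b : Module.Basis ι 𝕜 E) {L : α → E →ₗ[𝕜] F} {L₀ : E →ₗ[𝕜] F} (hL₀ : Function.Injective L₀)
    (hL : ∀ e, Tendsto (fun s => L s e) l (𝓝 (L₀ e))) {e : α → E}
    (he : Tendsto (fun s => L s (e s)) l (𝓝 0)) (i : ι) :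
    Tendsto (fun s => b.repr (e s) i) l (𝓝 0) := by
  classical
  have := Fintype.ofFinite ι
  obtain ⟨P, hP⟩ := L₀.exists_leftInverse_of_injective (LinearMap.ker_eq_bot.mpr hL₀)
  have hP (e : E) : P (L₀ e) = e := DFunLike.congr_fun hP e
  have hcoord (j : ι) {f : α → F} {f₀ : F} (hf : Tendsto f l (𝓝 f₀)) :
      Tendsto (fun s => b.repr (P (f s)) j) l (𝓝 (b.repr (P f₀) j)) :=
    ((b.coord j ∘ₗ P).continuous_of_finiteDimensional.tendsto f₀).comp hf
  let M (s : α) : Matrix ι ι 𝕜 := LinearMap.toMatrix b b (P ∘ₗ L s)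
  have hM : Tendsto M l (𝓝 1) := by
    rw [← LinearMap.toMatrix_id b]
    refine tendsto_pi_nhds.mpr fun j => tendsto_pi_nhds.mpr fun a => ?_
    simpa only [M, LinearMap.toMatrix_apply, LinearMap.comp_apply, hP, LinearMap.id_apply]
      using hcoord j (hL (b a))
  refine tendsto_pi_nhds.mp (tendsto_zero_of_tendsto_mulVec_zero hM (v := fun s => b.repr (e s))
    (tendsto_pi_nhds.mpr fun j => ?_)) i
  simpa only [M, LinearMap.toMatrix_mulVec_repr, LinearMap.comp_apply, map_zero,
    Finsupp.coe_zero, Pi.zero_apply] using hcoord j he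

end finiteDimensional

end limits

/-! ### Equivariant families and averaging -/

section equivFam

variable {T : Type*} [Fintype T] [DecidableEq T] {D : SU3 →* Matrix T T ℂ} {ξ : Mat3}

theorem coe_sum_smul_apply {ι : Type*} (s : Finset ι) (c : ι → ℂ) (f : ι → PolyOrbit ξ)
    (x : adOrbit ξ) : (∑ i ∈ s, c i • f i : PolyOrbit ξ).1 x = ∑ i ∈ s, c i * (f i).1 x := by
  simp only [← toC_apply, map_sum, ContinuousMap.sum_apply, map_smul, ContinuousMap.smul_apply,
    smul_eq_mul]

/-- Without this shortcut the search for the additive group of a submodule of `T → Poly(O_ξ)` times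
out. -/
instance PolyOrbit.instAddCommGroup (ξ : Mat3) : AddCommGroup (PolyOrbit ξ) :=
  (PolyOrbit ξ).toRing.toAddCommGroup

/-- The `SU(3)`-equivariant linear maps from a matrix representation `D` to `Poly(O_ξ)`, encoded by
the images of the basis vectors. -/
def equivFam (D : SU3 →* Matrix T T ℂ) (ξ : Mat3) : Submodule ℂ (T → PolyOrbit ξ) where
  carrier := {h | ∀ (g : SU3) (x : adOrbit ξ) (K : T),
    (h K).1 x = ∑ J, D g J K * (h J).1 (adOn g x)}
  add_mem' {h h'} hh hh' g x K := by
    change (h K).1 x + (h' K).1 x = ∑ J, D g J K * ((h J).1 (adOn g x) + (h' J).1 (adOn g x))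
    simp only [hh g x K, hh' g x K, mul_add, Finset.sum_add_distrib]
  zero_mem' g _ _ := (Finset.sum_eq_zero fun _ _ => mul_zero (D g _ _)).symm
  smul_mem' c h hh g x K := by
    change c * (h K).1 x = ∑ J, D g J K * (c * (h J).1 (adOn g x))
    simp only [hh g x K, Finset.mul_sum, mul_left_comm]

theorem apply_inv_of_mem_equivFam {F : T → PolyOrbit ξ} (hF : F ∈ equivFam D ξ) (g : SU3)
    (x : adOrbit ξ) (L : T) : (F L).1 (adOn g⁻¹ x) = ∑ J, D g J L * (F J).1 x := by
  rw [hF g (adOn g⁻¹ x) L, adOn_adOn_inv]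

/-- Evaluation at the base point of `O_ξ`. -/
def evBase (D : SU3 →* Matrix T T ℂ) (ξ : Mat3) : equivFam D ξ →ₗ[ℂ] (T → ℂ) where
  toFun h K := (h.1 K).1 (basePoint ξ)
  map_add' _ _ := rfl
  map_smul' _ _ := rfl

theorem evBase_injective : Function.Injective (evBase D ξ) := by
  refine (injective_iff_map_eq_zero _).mpr fun h hh => ?_
  refine Subtype.ext (funext fun K => Subtype.ext (funext fun x => ?_))
  obtain ⟨g, rfl⟩ := exists_adOn_basePoint x
  rw [h.2 g⁻¹ _ K, adOn_inv_adOn]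
  exact Finset.sum_eq_zero fun J _ => mul_eq_zero_of_right _ (congrFun hh J)

instance equivFam.instFinite : Module.Finite ℂ (equivFam D ξ) :=
  Module.Finite.of_injective (evBase D ξ) evBase_injective

/-- A basis of the space of equivariant families. -/
def famBasis (D : SU3 →* Matrix T T ℂ) (ξ : Mat3) :
    Module.Basis (Fin (Module.finrank ℂ (equivFam D ξ))) ℂ (equivFam D ξ) :=
  Module.finBasis ℂ (equivFam D ξ)

theorem coe_equivFam_eq_sum (h : equivFam D ξ) (K : T) :
    h.1 K = ∑ a, (famBasis D ξ).repr h a • (famBasis D ξ a).1 K := by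
  conv_lhs => rw [← (famBasis D ξ).sum_repr h]
  rw [Submodule.coe_sum, Finset.sum_apply]
  rfl

theorem tendsto_famBasis_repr {α : Type*} {l : Filter α} {h : α → equivFam D ξ}
    {h₀ : equivFam D ξ}
    (hh : ∀ K, Tendsto (fun s => ((h s).1 K).1 (basePoint ξ)) l (𝓝 ((h₀.1 K).1 (basePoint ξ))))
    (a : Fin (Module.finrank ℂ (equivFam D ξ))) :
    Tendsto (fun s => (famBasis D ξ).repr (h s) a) l (𝓝 ((famBasis D ξ).repr h₀ a)) :=
  tendsto_apply_of_tendsto_injective evBase_injective (tendsto_pi_nhds.mpr hh)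
    ((famBasis D ξ).coord a)

theorem exists_bound_sum_norm (hD : Continuous D) :
    ∃ C : ℝ, 0 ≤ C ∧ ∀ g K, ∑ J, ‖D g J K‖ ≤ C := by
  have hc : Continuous fun g K => ∑ J, ‖D g J K‖ := continuous_pi fun K =>
    continuous_finsetSum _ fun J _ => (hD.matrix_elem J K).norm
  obtain ⟨C, hC⟩ := isCompact_univ.exists_bound_of_continuousOn hc.continuousOn
  refine ⟨C, (norm_nonneg _).trans (hC 1 (Set.mem_univ _)), fun g K => ?_⟩
  exact (le_abs_self _).trans ((norm_le_pi_norm _ K).trans (hC g (Set.mem_univ g)))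

end equivFam

section average

open MeasureTheory

/-- The average of a linear map between representations over a group. -/
def avgMatrix {G T T' : Type*} [Group G] [MeasurableSpace G] (μ : Measure G) [Fintype T]
    [DecidableEq T] [Fintype T'] [DecidableEq T'] (D : G →* Matrix T T ℂ)
    (D' : G →* Matrix T' T' ℂ) (c : Matrix T' T ℂ) : Matrix T' T ℂ :=
  Matrix.of fun L K => ∫ g, (D' g * c * D g⁻¹) L K ∂μ

variable {T T' : Type*} [Fintype T] [DecidableEq T] [Fintype T'] [DecidableEq T']

theorem mul_avgMatrix {G : Type*} [Group G] [MeasurableSpace G] [MeasurableMul G] {μ : Measure G}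
    [μ.IsMulLeftInvariant] {D : G →* Matrix T T ℂ} {D' : G →* Matrix T' T' ℂ} {c : Matrix T' T ℂ}
    (hint : ∀ L K, Integrable (fun g => (D' g * c * D g⁻¹) L K) μ) (k : G) :
    D' k * avgMatrix μ D D' c = avgMatrix μ D D' c * D k := by
  ext L K
  have hshift : ∀ g, D' k * (D' g * c * D g⁻¹) = D' (k * g) * c * D (k * g)⁻¹ * D k := fun g => by
    have hinv : D (k * g)⁻¹ * D k = D g⁻¹ := by
      rw [← map_mul, _root_.mul_inv_rev, inv_mul_cancel_right]
    rw [Matrix.mul_assoc _ (D _), hinv, map_mul]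
    simp only [Matrix.mul_assoc]
  calc (D' k * avgMatrix μ D D' c) L K
      = ∫ g, (D' k * (D' g * c * D g⁻¹)) L K ∂μ := by
        simp only [Matrix.mul_apply (M := D' k), avgMatrix, Matrix.of_apply]
        rw [integral_finsetSum _ fun L' _ => (hint L' K).const_mul _]
        simp only [integral_const_mul]
    _ = ∫ g, (D' g * c * D g⁻¹ * D k) L K ∂μ := by
        simp only [hshift]
        exact integral_mul_left_eq_self (fun g => (D' g * c * D g⁻¹ * D k) L K) k
    _ = (avgMatrix μ D D' c * D k) L K := by
        simp only [Matrix.mul_apply (N := D k), avgMatrix, Matrix.of_apply]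
        rw [integral_finsetSum _ fun K' _ => (hint L K').mul_const _]
        simp only [integral_mul_const]

instance instIsHaarMeasureHaarSU3 : haarSU3.IsHaarMeasure :=
  inferInstanceAs (Measure.haarMeasure ⊤).IsHaarMeasure

instance instIsProbabilityMeasureHaarSU3 : IsProbabilityMeasure haarSU3 :=
  ⟨Measure.haarMeasure_self (G := SU3) (K₀ := ⊤)⟩

theorem integrable_haarSU3 {f : SU3 → ℂ} (hf : Continuous f) : Integrable f haarSU3 :=
  hf.integrable_of_hasCompactSupport (HasCompactSupport.of_compactSpace f)

variable {D : SU3 →* Matrix T T ℂ} {D' : SU3 →* Matrix T' T' ℂ} {ξ : Mat3}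

theorem continuous_conj_apply (hD : Continuous D) (hD' : Continuous D') (c : Matrix T' T ℂ) (L : T')
    (K : T) : Continuous fun g => (D' g * c * D g⁻¹) L K :=
  ((hD'.matrix_mul continuous_const).matrix_mul (hD.comp continuous_inv)).matrix_elem L K

theorem sum_avgMatrix_smul_apply (hD : Continuous D) (hD' : Continuous D') (c : Matrix T' T ℂ)
    {F : T' → PolyOrbit ξ} (hF : F ∈ equivFam D' ξ) (K : T) (x : adOrbit ξ) :
    (∑ L, avgMatrix haarSU3 D D' c L K • F L).1 x =
      ∫ g, ∑ J, D g⁻¹ J K * (∑ L, c L J • F L).1 (adOn g⁻¹ x) ∂haarSU3 := by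
  calc (∑ L, avgMatrix haarSU3 D D' c L K • F L).1 x
      = ∫ g, ∑ L, (D' g * c * D g⁻¹) L K * (F L).1 x ∂haarSU3 := by
        rw [integral_finsetSum _ fun L _ =>
          (integrable_haarSU3 (continuous_conj_apply hD hD' c L K)).mul_const _]
        simp only [coe_sum_smul_apply, avgMatrix, Matrix.of_apply, integral_mul_const]
    _ = _ := by
        refine integral_congr_ae (.of_forall fun g => ?_)
        simp only [coe_sum_smul_apply, apply_inv_of_mem_equivFam hF, Matrix.mul_apply,
          Finset.sum_mul, Finset.mul_sum]
        rw [Finset.sum_comm]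
        refine Finset.sum_congr rfl fun J _ => ?_
        rw [Finset.sum_comm]
        refine Finset.sum_congr rfl fun L _ => Finset.sum_congr rfl fun L' _ => ?_
        ring

/-- The averaged family at `x` is an average of the original one over the translates of `x`, and the
equivariant family `b` is its own average. -/
theorem norm_sum_avgMatrix_smul_sub_le (hD : Continuous D) (hD' : Continuous D') {C : ℝ}
    (hC : ∀ g K, ∑ J, ‖D g J K‖ ≤ C) (c : Matrix T' T ℂ) {F : T' → PolyOrbit ξ}
    (hF : F ∈ equivFam D' ξ) {b : T → PolyOrbit ξ} (hb : b ∈ equivFam D ξ) {ε : ℝ} (hε : 0 ≤ ε)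
    (h : ∀ J, ‖toC ξ (∑ L, c L J • F L) - toC ξ (b J)‖ ≤ ε) (K : T) (x : adOrbit ξ) :
    ‖(∑ L, avgMatrix haarSU3 D D' c L K • F L).1 x - (b K).1 x‖ ≤ C * ε := by
  let φ (g : SU3) : ℂ := ∑ J, D g⁻¹ J K * (∑ L, c L J • F L).1 (adOn g⁻¹ x)
  have hφ : Continuous φ :=
    continuous_finsetSum _ fun J _ => ((hD.comp continuous_inv).matrix_elem J K).mul
      ((continuous_polyOrbit _).comp ((continuous_adOn x).comp continuous_inv))
  have hbound (g : SU3) : ‖φ g - (b K).1 x‖ ≤ C * ε := calc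
    ‖φ g - (b K).1 x‖
      = ‖∑ J, D g⁻¹ J K * (toC ξ (∑ L, c L J • F L) - toC ξ (b J)) (adOn g⁻¹ x)‖ := by
        rw [hb g⁻¹ x K, ← Finset.sum_sub_distrib]
        simp only [← mul_sub, ContinuousMap.sub_apply, toC_apply]
    _ ≤ ∑ J, ‖D g⁻¹ J K‖ * ε := (norm_sum_le _ _).trans <| Finset.sum_le_sum fun J _ => by
        rw [norm_mul]
        gcongr
        exact (ContinuousMap.norm_coe_le_norm _ _).trans (h J)
    _ ≤ C * ε := by
        rw [← Finset.sum_mul]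
        exact mul_le_mul_of_nonneg_right (hC g⁻¹ K) hε
  calc ‖(∑ L, avgMatrix haarSU3 D D' c L K • F L).1 x - (b K).1 x‖
      = ‖∫ g, (φ g - (b K).1 x) ∂haarSU3‖ := by
        rw [integral_sub (integrable_haarSU3 hφ) (integrable_const _),
          sum_avgMatrix_smul_apply hD hD' c hF, integral_const, probReal_univ, one_smul]
    _ ≤ C * ε := by
        simpa only [probReal_univ, mul_one] using
          norm_integral_le_of_norm_le_const (μ := haarSU3) (.of_forall hbound)

end average

/-! ### Noncommutative polynomials -/

/-- Noncommutative polynomials in the coordinates `x_1, …, x_8` of `su(3)`, the common source of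
symbols and quantizations. -/
abbrev FreePoly : Type := FreeAlgebra ℂ (Fin 8)

/-- The action of `SU(3)` on noncommutative polynomials. -/
def freeAct (g : SU3) : FreePoly →ₐ[ℂ] FreePoly :=
  FreeAlgebra.lift ℂ fun k => ∑ j, adRep g j k • FreeAlgebra.ι ℂ j

theorem freeAct_ι (g : SU3) (k : Fin 8) :
    freeAct g (FreeAlgebra.ι ℂ k) = ∑ j, adRep g j k • FreeAlgebra.ι ℂ j := by
  rw [freeAct, FreeAlgebra.lift_ι_apply]

section words

variable {T T' : Type*} [Fintype T] [DecidableEq T] [Fintype T'] [DecidableEq T']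

/-- Families of noncommutative polynomials that transform by the representation `D`. -/
def IsFreeFam (D : SU3 →* Matrix T T ℂ) (F : T → FreePoly) : Prop :=
  ∀ g K, freeAct g (F K) = ∑ J, D g J K • F J

theorem IsFreeFam.sum_smul {D : SU3 →* Matrix T T ℂ} {D' : SU3 →* Matrix T' T' ℂ}
    {F : T' → FreePoly} (hF : IsFreeFam D' F) {c : Matrix T' T ℂ} (hc : ∀ g, D' g * c = c * D g) :
    IsFreeFam D fun K => ∑ L, c L K • F L := fun g K => by
  have hentry (L : T') : ∑ L', D' g L L' * c L' K = ∑ J, c L J * D g J K := by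
    rw [← Matrix.mul_apply, hc g, Matrix.mul_apply]
  simp only [map_sum, map_smul, hF g, Finset.smul_sum, smul_smul]
  rw [Finset.sum_comm]
  conv_rhs => rw [Finset.sum_comm]
  refine Finset.sum_congr rfl fun L _ => ?_
  simp only [← Finset.sum_smul, mul_comm (c _ K), mul_comm (D g _ K), hentry]

/-- The generators together with `1`. With `1` among the letters, the words of length `N` span the
noncommutative polynomials of degree at most `N`. -/
def letter : Unit ⊕ Fin 8 → FreePoly := Sum.elim (fun _ => 1) (FreeAlgebra.ι ℂ)

/-- The representation of `SU(3)` on the span of the letters. -/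
def letterRep : SU3 →* Matrix (Unit ⊕ Fin 8) (Unit ⊕ Fin 8) ℂ where
  toFun g := Matrix.fromBlocks 1 0 0 (adRep g)
  map_one' := by rw [map_one, Matrix.fromBlocks_one]
  map_mul' g h := by simp only [map_mul, Matrix.fromBlocks_multiply, Matrix.mul_one,
    Matrix.mul_zero, Matrix.zero_mul, add_zero, zero_add]

theorem continuous_letterRep : Continuous letterRep :=
  continuous_const.matrix_fromBlocks continuous_const continuous_const continuous_adRep

theorem isFreeFam_letter : IsFreeFam letterRep letter := by
  rintro g (_ | k)
  · simp [letter, letterRep]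
  · simp [letter, letterRep, freeAct_ι]

/-- The `N`-th tensor power of a matrix representation. -/
def tensorPow {G R : Type*} [Monoid G] [CommSemiring R] (D : G →* Matrix T T R) (N : ℕ) :
    G →* Matrix (Fin N → T) (Fin N → T) R where
  toFun g := Matrix.of fun J K => ∏ i, D g (J i) (K i)
  map_one' := by
    ext J K
    simp only [map_one, Matrix.of_apply, Matrix.one_apply, Finset.prod_ite_zero,
      Finset.prod_const_one, Finset.mem_univ, true_imp_iff, funext_iff]
  map_mul' g h := by
    ext J K
    simp only [map_mul, Matrix.of_apply, Matrix.mul_apply, Fintype.prod_sum,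
      Finset.prod_mul_distrib]

theorem continuous_tensorPow {G R : Type*} [Monoid G] [TopologicalSpace G] [CommSemiring R]
    [TopologicalSpace R] [ContinuousMul R] {D : G →* Matrix T T R} (hD : Continuous D) (N : ℕ) :
    Continuous (tensorPow D N) :=
  continuous_matrix fun J K => by
    change Continuous fun g => ∏ i, D g (J i) (K i)
    exact continuous_finsetProd _ fun i _ => hD.matrix_elem (J i) (K i)

/-- Products of `N` letters. -/
def wordPoly (N : ℕ) (I : Fin N → Unit ⊕ Fin 8) : FreePoly := (List.ofFn fun i => letter (I i)).prod

theorem wordPoly_zero (I : Fin 0 → Unit ⊕ Fin 8) : wordPoly 0 I = 1 := by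
  simp only [wordPoly, List.ofFn_zero, List.prod_nil]

theorem wordPoly_succ (N : ℕ) (I : Fin (N + 1) → Unit ⊕ Fin 8) :
    wordPoly (N + 1) I = letter (I 0) * wordPoly N fun i => I i.succ := by
  simp only [wordPoly, List.ofFn_succ, List.prod_cons]

theorem isFreeFam_wordPoly (N : ℕ) : IsFreeFam (tensorPow letterRep N) (wordPoly N) := fun g K => by
  calc freeAct g (wordPoly N K)
      = MultilinearMap.mkPiAlgebraFin ℂ N FreePoly fun i => freeAct g (letter (K i)) := by
        rw [MultilinearMap.mkPiAlgebraFin_apply, wordPoly, map_list_prod, List.map_ofFn]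
        rfl
    _ = ∑ J, tensorPow letterRep N g J K • wordPoly N J := by
        simp only [isFreeFam_letter g, MultilinearMap.map_sum, MultilinearMap.map_smul_univ,
          MultilinearMap.mkPiAlgebraFin_apply]
        rfl

theorem span_range_wordPoly (N : ℕ) :
    Submodule.span ℂ (Set.range (wordPoly N)) = Submodule.span ℂ (Set.range letter) ^ N := by
  induction N with
  | zero =>
    have : wordPoly 0 = fun _ => 1 := funext wordPoly_zero
    rw [pow_zero, this, Set.range_const, Submodule.one_eq_span]
  | succ N ih =>
    rw [pow_succ', ← ih, Submodule.span_mul_span]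
    congr 1
    ext t
    simp only [Set.mem_range, Set.mem_mul, exists_exists_eq_and, wordPoly_succ]
    exact ⟨fun ⟨I, hI⟩ => ⟨I 0, Fin.tail I, hI⟩, fun ⟨a, I, hI⟩ => ⟨Fin.cons a I, hI⟩⟩

theorem eventually_mem_span_range_wordPoly (t : FreePoly) :
    ∀ᶠ N in atTop, t ∈ Submodule.span ℂ (Set.range (wordPoly N)) := by
  simp only [span_range_wordPoly]
  have hone : 1 ≤ Submodule.span ℂ (Set.range letter) :=
    Submodule.one_le.mpr (Submodule.subset_span ⟨Sum.inl (), rfl⟩)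
  have hmono {a b : ℕ} (hab : a ≤ b) := pow_le_pow_right' hone hab
  induction t using FreeAlgebra.induction with
  | grade0 c =>
    exact .of_forall fun N => one_le_pow_of_one_le' hone N (Submodule.algebraMap_mem c)
  | grade1 k =>
    filter_upwards [eventually_ge_atTop 1] with N hN
    refine hmono hN ?_
    rw [pow_one]
    exact Submodule.subset_span ⟨Sum.inr k, rfl⟩
  | mul a b ha hb =>
    obtain ⟨A, hA⟩ := ha.exists
    obtain ⟨B, hB⟩ := hb.exists
    filter_upwards [eventually_ge_atTop (A + B)] with N hN
    refine hmono hN ?_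
    rw [pow_add]
    exact Submodule.mul_mem_mul hA hB
  | add a b ha hb =>
    filter_upwards [ha, hb] with N hA hB using Submodule.add_mem _ hA hB

end words

section symbols

/-- The commutative polynomial underlying a noncommutative one. -/
def symbolMap : FreePoly →ₐ[ℂ] PolySU3 := FreeAlgebra.lift ℂ MvPolynomial.X

theorem symbolMap_ι (k : Fin 8) : symbolMap (FreeAlgebra.ι ℂ k) = MvPolynomial.X k :=
  FreeAlgebra.lift_ι_apply _ _

theorem symbolMap_surjective : Function.Surjective symbolMap := by
  rw [← AlgHom.range_eq_top, eq_top_iff, ← MvPolynomial.adjoin_range_X, Algebra.adjoin_le_iff]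
  rintro _ ⟨k, rfl⟩
  exact ⟨FreeAlgebra.ι ℂ k, symbolMap_ι k⟩

/-- The quantization of a noncommutative polynomial at radius `R`, which replaces `x_k` by
`-(i / R) E_k` in `U(sl(3))`. -/
def quantMap (R : ℂ) : FreePoly →ₐ[ℂ] USL3 :=
  FreeAlgebra.lift ℂ fun k =>
    (-(Complex.I / R)) • UniversalEnvelopingAlgebra.ι ℂ (suLieBasis k)

theorem quantMap_ι (R : ℂ) (k : Fin 8) : quantMap R (FreeAlgebra.ι ℂ k) =
    (-(Complex.I / R)) • UniversalEnvelopingAlgebra.ι ℂ (suLieBasis k) :=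
  FreeAlgebra.lift_ι_apply _ _

theorem ι_suLieBasis_eq_smul_quantMap {R : ℂ} (hR : R ≠ 0) (k : Fin 8) :
    UniversalEnvelopingAlgebra.ι ℂ (suLieBasis k) =
      (Complex.I * R) • quantMap R (FreeAlgebra.ι ℂ k) := by
  have h : Complex.I * R * -(Complex.I / R) = 1 := by
    field_simp
    rw [Complex.I_sq, neg_neg]
  rw [quantMap_ι, smul_smul, h, one_smul]

theorem quantMap_surjective {R : ℂ} (hR : R ≠ 0) : Function.Surjective (quantMap R) := by
  rw [← AlgHom.range_eq_top]
  refine eq_top_of_forall_ι_mem fun X => ?_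
  rw [← suLieBasis.sum_repr X, map_sum]
  refine Subalgebra.sum_mem _ fun k _ => ?_
  rw [map_smul, ι_suLieBasis_eq_smul_quantMap hR]
  exact Subalgebra.smul_mem _ (Subalgebra.smul_mem _ (AlgHom.mem_range_self _ _) _) _

/-- The commutator of two quantized polynomials is, after rescaling, the quantization of one fixed
polynomial, whose symbol is given by the Poisson bracket. -/
def HasPoissonComm (t t' : FreePoly) : Prop :=
  ∃ b : FreePoly, (∀ R : ℂ, R ≠ 0 →
    R • (quantMap R t * quantMap R t' - quantMap R t' * quantMap R t) = quantMap R b) ∧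
    symbolMap b = Complex.I • poissonBracket (symbolMap t) (symbolMap t')

theorem HasPoissonComm.symm {t t' : FreePoly} (h : HasPoissonComm t t') : HasPoissonComm t' t := by
  obtain ⟨b, hb, hs⟩ := h
  refine ⟨-b, fun R hR => ?_, ?_⟩
  · rw [map_neg, ← hb R hR, ← smul_neg, neg_sub]
  · rw [map_neg, hs, poissonBracket_antisymm, smul_neg, neg_neg]

theorem hasPoissonComm_ι_ι (k l : Fin 8) :
    HasPoissonComm (FreeAlgebra.ι ℂ k) (FreeAlgebra.ι ℂ l) := by
  refine ⟨∑ m, (-Complex.I * structConst k l m) • FreeAlgebra.ι ℂ m, fun R hR => ?_, ?_⟩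
  · simp only [map_sum, map_smul]
    rw [quantMap_ι, quantMap_ι, smul_mul_smul_comm, smul_mul_smul_comm, ← smul_sub, ← Ring.lie_def,
      ← LieHom.map_lie, lie_suLieBasis, map_sum, Finset.smul_sum, Finset.smul_sum]
    refine Finset.sum_congr rfl fun m _ => ?_
    rw [map_smul, quantMap_ι, smul_smul, smul_smul, smul_smul]
    congr 1
    field_simp
  · simp only [map_sum, map_smul, symbolMap_ι]
    rw [poissonBracket_X_X, Finset.smul_sum]
    refine Finset.sum_congr rfl fun m _ => ?_
    rw [smul_smul, structConst_swap_left l k m, mul_neg, neg_mul]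

theorem hasPoissonComm_of_ι {t' : FreePoly} (h : ∀ k, HasPoissonComm (FreeAlgebra.ι ℂ k) t')
    (t : FreePoly) : HasPoissonComm t t' := by
  induction t using FreeAlgebra.induction with
  | grade0 c =>
    refine ⟨0, fun R _ => ?_, ?_⟩
    · rw [AlgHom.commutes, Algebra.commutes, sub_self, smul_zero, map_zero]
    · rw [AlgHom.commutes, map_zero, MvPolynomial.algebraMap_eq, poissonBracket_antisymm,
        poissonBracket_eq_sum_pderiv_mul]
      simp only [MvPolynomial.pderiv_C, zero_mul, Finset.sum_const_zero, neg_zero, smul_zero]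
  | grade1 k => exact h k
  | mul a b ha hb =>
    obtain ⟨u, hu, hus⟩ := ha
    obtain ⟨v, hv, hvs⟩ := hb
    refine ⟨a * v + u * b, fun R hR => ?_, ?_⟩
    · rw [map_add, map_mul, map_mul, map_mul, ← hu R hR, ← hv R hR, mul_smul_comm, smul_mul_assoc,
        ← smul_add]
      congr 1
      noncomm_ring
    · rw [map_add, map_mul, map_mul, map_mul, hus, hvs, poissonBracket_mul_left, smul_add,
        mul_smul_comm, smul_mul_assoc]
  | add a b ha hb =>
    obtain ⟨u, hu, hus⟩ := ha
    obtain ⟨v, hv, hvs⟩ := hb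
    refine ⟨u + v, fun R hR => ?_, ?_⟩
    · rw [map_add, map_add, ← hu R hR, ← hv R hR, ← smul_add]
      congr 1
      noncomm_ring
    · rw [map_add, map_add, hus, hvs, ← smul_add, ← poissonBilin_apply (_ + _), map_add]
      rfl

theorem hasPoissonComm (t t' : FreePoly) : HasPoissonComm t t' :=
  hasPoissonComm_of_ι (fun k => (hasPoissonComm_of_ι (fun l => hasPoissonComm_ι_ι l k) t').symm) t

/-- Restriction of the symbol to the orbit `O_ξ`. -/
def classMap (ξ : Mat3) : FreePoly →ₐ[ℂ] PolyOrbit ξ := (resHom ξ).comp symbolMap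

theorem classMap_apply (ξ : Mat3) (t : FreePoly) : classMap ξ t = resOrbit ξ (symbolMap t) := rfl

theorem classMap_surjective (ξ : Mat3) : Function.Surjective (classMap ξ) := fun f => by
  obtain ⟨F, rfl⟩ := exists_resOrbit f
  obtain ⟨t, rfl⟩ := symbolMap_surjective F
  exact ⟨t, rfl⟩

end symbols

section equivariance

variable {ξ : Mat3}

/-- Equivariant linear maps from noncommutative polynomials to `Poly(O_ξ)`. -/
def IsEquivMap (q : FreePoly →ₗ[ℂ] PolyOrbit ξ) : Prop :=
  ∀ (g : SU3) (t : FreePoly) (x : adOrbit ξ), (q (freeAct g t)).1 (adOn g x) = (q t).1 x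

theorem IsEquivMap.mem_equivFam {q : FreePoly →ₗ[ℂ] PolyOrbit ξ} (hq : IsEquivMap q) {T : Type*}
    [Fintype T] [DecidableEq T] {D : SU3 →* Matrix T T ℂ} {F : T → FreePoly}
    (hF : IsFreeFam D F) : (fun K => q (F K)) ∈ equivFam D ξ := by
  intro g x K
  rw [← hq g (F K) x, hF g K, map_sum]
  simp only [map_smul, coe_sum_smul_apply]

theorem isEquivMap_classMap (ξ : Mat3) : IsEquivMap (classMap ξ).toLinearMap := by
  intro g t x
  change (classMap ξ (freeAct g t)).1 (adOn g x) = (classMap ξ t).1 x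
  induction t using FreeAlgebra.induction with
  | grade0 c => rw [AlgHom.commutes, AlgHom.commutes]; rfl
  | grade1 k =>
    rw [freeAct_ι, map_sum]
    simp only [map_smul, coe_sum_smul_apply, classMap_apply, symbolMap_ι, resOrbit_apply,
      MvPolynomial.eval_X]
    exact (suCoord_eq_sum_adRep_mul g x k).symm
  | mul a b ha hb =>
    simp only [map_mul]
    exact congrArg₂ (· * ·) ha hb
  | add a b ha hb =>
    simp only [map_add]
    exact congrArg₂ (· + ·) ha hb

theorem rep_conj_quantMap {ω : Mat3} (Q : QuarkSystem ω) (R : ℂ) (g : SU3) (t : FreePoly) :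
    (Q.rep g : Q.Op) * Q.rho (quantMap R t) * (Q.rep g⁻¹ : Q.Op) =
      Q.rho (quantMap R (freeAct g t)) := by
  induction t using FreeAlgebra.induction with
  | grade0 c =>
    simp only [AlgHom.commutes]
    rw [← Algebra.commutes,
      mul_assoc, rep_mul_rep_inv, mul_one]
  | grade1 k =>
    simp only [freeAct_ι, quantMap_ι, map_sum, map_smul, Matrix.mul_smul, Matrix.smul_mul,
      rep_conj_rho_ι_suLieBasis, Finset.smul_sum, smul_comm (-(Complex.I / R))]
  | mul a b ha hb =>
    calc (Q.rep g : Q.Op) * Q.rho (quantMap R (a * b)) * (Q.rep g⁻¹ : Q.Op)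
        = (Q.rep g : Q.Op) * Q.rho (quantMap R a) * ((Q.rep g⁻¹ : Q.Op) * (Q.rep g : Q.Op)) *
            Q.rho (quantMap R b) * (Q.rep g⁻¹ : Q.Op) := by
          rw [rep_inv_mul_rep, map_mul, map_mul]
          simp only [mul_one, mul_assoc]
      _ = Q.rho (quantMap R (freeAct g (a * b))) := by
          simp only [map_mul, ← ha, ← hb, mul_assoc]
  | add a b ha hb => simp only [map_add, mul_add, add_mul, ha, hb]

theorem IsUniversalCorrespondence.isEquivMap {ω : Mat3} {w : USL3 →ₗ[ℂ] PolyOrbit ξ}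
    (hw : IsUniversalCorrespondence ω ξ w) (R : ℂ) :
    IsEquivMap (w ∘ₗ (quantMap R).toLinearMap) := by
  obtain ⟨Q, W, hW, h⟩ := hw
  intro g t x
  change (w (quantMap R (freeAct g t))).1 (adOn g x) = (w (quantMap R t)).1 x
  rw [h, h, ← rep_conj_quantMap, hW.equivariant]

/-- Any family of noncommutative polynomials can be averaged to an equivariant one, which is then as
close to a given equivariant family as the original one was. -/
theorem exists_isFreeFam_forall_norm_sub_le {T : Type*} [Fintype T] [DecidableEq T]
    {D : SU3 →* Matrix T T ℂ} (hD : Continuous D) :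
    ∃ C : ℝ, ∀ t : T → FreePoly, ∃ t', IsFreeFam D t' ∧
      ∀ q : FreePoly →ₗ[ℂ] PolyOrbit ξ, IsEquivMap q → ∀ b ∈ equivFam D ξ, ∀ ε : ℝ, 0 ≤ ε →
        (∀ J, ‖toC ξ (q (t J)) - toC ξ (b J)‖ ≤ ε) →
        ∀ K x, ‖(q (t' K)).1 x - (b K).1 x‖ ≤ C * ε := by
  obtain ⟨C, -, hC⟩ := exists_bound_sum_norm hD
  refine ⟨C, fun t => ?_⟩
  obtain ⟨N, hN⟩ := (eventually_all.mpr fun J => eventually_mem_span_range_wordPoly (t J)).exists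
  choose c hc using fun J => (Submodule.mem_span_range_iff_exists_fun ℂ).mp (hN J)
  have hword := continuous_tensorPow continuous_letterRep N
  let c' := avgMatrix haarSU3 D (tensorPow letterRep N) (Matrix.of fun L J => c J L)
  refine ⟨fun K => ∑ L, c' L K • wordPoly N L, (isFreeFam_wordPoly N).sum_smul <|
    mul_avgMatrix fun L K => integrable_haarSU3 (continuous_conj_apply hD hword _ L K),
    fun q hq b hb ε hε h K x => ?_⟩
  simp only [map_sum, map_smul]
  refine norm_sum_avgMatrix_smul_sub_le hD hword hC _ (hq.mem_equivFam (isFreeFam_wordPoly N)) hb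
    hε (fun J => ?_) K x
  simpa only [← hc, map_sum, map_smul, Matrix.of_apply] using h J

/-- Equivariant families that converge to a basis at the base point are eventually bases. -/
theorem exists_tendsto_one_famBasis_eq_sum {T : Type*} [Fintype T] [DecidableEq T]
    {D : SU3 →* Matrix T T ℂ} {α : Type*} {l : Filter α} {q : α → FreePoly →ₗ[ℂ] PolyOrbit ξ}
    (hq : ∀ s, IsEquivMap (q s))
    {t : α → Fin (Module.finrank ℂ (equivFam D ξ)) → T → FreePoly}
    (ht : ∀ s a, IsFreeFam D (t s a))
    (hlim : ∀ a K, Tendsto (fun s => (q s (t s a K)).1 (basePoint ξ)) l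
      (𝓝 (((famBasis D ξ a).1 K).1 (basePoint ξ)))) :
    ∃ N : α → Matrix (Fin (Module.finrank ℂ (equivFam D ξ)))
        (Fin (Module.finrank ℂ (equivFam D ξ))) ℂ, Tendsto N l (𝓝 1) ∧
      ∀ᶠ s in l, ∀ a K, (famBasis D ξ a).1 K = ∑ a', N s a' a • q s (t s a' K) := by
  obtain ⟨N, hN, h⟩ := exists_tendsto_one_basis_eq_sum (famBasis D ξ)
    (v := fun s a => ⟨_, (hq s).mem_equivFam (ht s a)⟩) fun a i =>
      tendsto_famBasis_repr (hlim a) i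
  refine ⟨N, hN, h.mono fun s hs a K => ?_⟩
  rw [hs a, Submodule.coe_sum, Finset.sum_apply]
  rfl

end equivariance

/-! ### Correspondences -/

section correspondence

variable {ω ξ : Mat3} {w : USL3 →ₗ[ℂ] PolyOrbit ξ}

theorem IsUniversalCorrespondence.map_one (hw : IsUniversalCorrespondence ω ξ w) : w 1 = 1 := by
  obtain ⟨Q, W, hW, h⟩ := hw
  have hdim : (Q.dim : ℂ) ≠ 0 := by
    obtain ⟨v, hv, -⟩ := Q.highest_weight
    rw [Nat.cast_ne_zero]
    intro h0
    have : IsEmpty (Fin Q.dim) := by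
      rw [h0]
      infer_instance
    exact hv (Subsingleton.elim _ _)
  have hinv (g : SU3) (x : adOrbit ξ) : (W 1).1 (adOn g x) = (W 1).1 x := by
    have h1 := hW.equivariant g 1 x
    rwa [mul_one, rep_mul_rep_inv] at h1
  have hbase : (W 1).1 (basePoint ξ) = 1 := by
    have h1 := hW.normalized 1
    simp only [hinv] at h1
    rwa [Matrix.trace_one, Fintype.card_fin, div_self hdim, MeasureTheory.integral_const,
      MeasureTheory.probReal_univ, one_smul] at h1
  rw [h, _root_.map_one]
  refine Subtype.ext (funext fun x => ?_)
  obtain ⟨g, rfl⟩ := exists_adOn_basePoint x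
  rw [hinv, hbase]
  rfl

theorem IsUniversalCorrespondence.lie_apply (hw : IsUniversalCorrespondence ω ξ w) (k : Fin 8)
    {u : USL3} {F : PolySU3} (hF : w u = resOrbit ξ F) :
    w (UniversalEnvelopingAlgebra.ι ℂ (suLieBasis k) * u -
      u * UniversalEnvelopingAlgebra.ι ℂ (suLieBasis k)) =
      resOrbit ξ (poissonBracket F (MvPolynomial.X k)) := by
  obtain ⟨Q, W, hW, h⟩ := hw
  rw [h] at hF
  rw [h, map_sub, map_mul, map_mul, rho_ι, hW.lie_apply k _ hF]

theorem exists_linearMap_rightInverse_on_range {K V V' : Type*} [Field K] [AddCommGroup V]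
    [Module K V] [AddCommGroup V'] [Module K V'] (f : V →ₗ[K] V') :
    ∃ σ : V' →ₗ[K] V, ∀ y ∈ LinearMap.range f, f (σ y) = y := by
  obtain ⟨g, hg⟩ := f.rangeRestrict.exists_rightInverse_of_surjective f.range_rangeRestrict
  obtain ⟨σ, hσ⟩ := g.exists_extend
  refine ⟨σ, fun y hy => ?_⟩
  have h1 : σ y = g ⟨y, hy⟩ := LinearMap.congr_fun hσ ⟨y, hy⟩
  rw [h1]
  exact congrArg Subtype.val (LinearMap.congr_fun hg ⟨y, hy⟩)

theorem IsUniversalCorrespondence.exists_bilin (hw : IsUniversalCorrespondence ω ξ w) :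
    ∃ B : PolyOrbit ξ →ₗ[ℂ] PolyOrbit ξ →ₗ[ℂ] PolyOrbit ξ, ∀ u v, B (w u) (w v) = w (u * v) := by
  obtain ⟨σ, hσ⟩ := exists_linearMap_rightInverse_on_range w
  refine ⟨((LinearMap.mul ℂ USL3).compl₁₂ σ σ).compr₂ w, fun u v => ?_⟩
  rw [LinearMap.compr₂_apply, LinearMap.compl₁₂_apply, LinearMap.mul_apply',
    ← twistedProduct_apply hw, hσ _ ⟨u, rfl⟩, hσ _ ⟨v, rfl⟩, twistedProduct_apply hw]

/-- Evaluation at a point of the orbit. -/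
def evalAt (x : adOrbit ξ) : PolyOrbit ξ →ₗ[ℂ] ℂ where
  toFun f := f.1 x
  map_add' _ _ := rfl
  map_smul' _ _ := rfl

theorem tendsto_evalAt {α : Type*} {l : Filter α} {f : α → PolyOrbit ξ} {f₀ : PolyOrbit ξ}
    (h : Tendsto (fun s => toC ξ (f s)) l (𝓝 (toC ξ f₀))) (x : adOrbit ξ) :
    Tendsto (fun s => (f s).1 x) l (𝓝 (f₀.1 x)) :=
  ((continuous_eval_const (F := C(adOrbit ξ, ℂ)) x).tendsto _).comp h

theorem exists_eq_sum_famBasis (f : PolyOrbit ξ) :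
    ∃ (N : ℕ) (c : (Fin N → Unit ⊕ Fin 8) →
      Fin (Module.finrank ℂ (equivFam (tensorPow letterRep N) ξ)) → ℂ),
      f = ∑ K, ∑ a, c K a • (famBasis (tensorPow letterRep N) ξ a).1 K := by
  obtain ⟨t, rfl⟩ := classMap_surjective ξ f
  obtain ⟨N, hN⟩ := (eventually_mem_span_range_wordPoly t).exists
  obtain ⟨c, rfl⟩ := (Submodule.mem_span_range_iff_exists_fun ℂ).mp hN
  let h : equivFam (tensorPow letterRep N) ξ :=
    ⟨fun K => classMap ξ (wordPoly N K),
      (isEquivMap_classMap ξ).mem_equivFam (isFreeFam_wordPoly N)⟩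
  refine ⟨N, fun K a => c K * (famBasis _ ξ).repr h a, ?_⟩
  rw [map_sum]
  refine Finset.sum_congr rfl fun K _ => ?_
  have hK : classMap ξ (wordPoly N K) = _ := coe_equivFam_eq_sum h K
  simp only [map_smul, hK, Finset.smul_sum, smul_smul]

end correspondence

/-! ### Convergence of quantizations and the Poisson limit -/

section poisson

variable {ξ : Mat3} {α : Type*} (w : α → USL3 →ₗ[ℂ] PolyOrbit ξ) (R : α → ℂ) (l : Filter α)

/-- The symbols of the quantizations of `t` converge uniformly to the classical function of `t`. -/
def QuantTendsto (t : FreePoly) : Prop :=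
  Tendsto (fun s => toC ξ (w s (quantMap (R s) t))) l (𝓝 (toC ξ (classMap ξ t)))

/-- The correspondence principle for the twisted products of a family of maps `w s` with radii
`R s`. For `ξ`-rays and `R s = s r(ξ)` this is `IsPoissonType`. -/
def HasPoissonLimit : Prop :=
  ∀ F₁ F₂ : PolySU3,
    TendstoUniformly
      (fun s (x : adOrbit ξ) => (twistedProduct (w s) (resOrbit ξ F₁) (resOrbit ξ F₂)).1 x)
      (fun x => (resOrbit ξ F₁).1 x * (resOrbit ξ F₂).1 x) l ∧
    TendstoUniformly
      (fun s (x : adOrbit ξ) => R s *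
        ((twistedProduct (w s) (resOrbit ξ F₁) (resOrbit ξ F₂)).1 x -
          (twistedProduct (w s) (resOrbit ξ F₂) (resOrbit ξ F₁)).1 x))
      (fun x => Complex.I * (resOrbit ξ (poissonBracket F₁ F₂)).1 x) l

variable {w R l}

theorem hasPoissonLimit_iff : HasPoissonLimit w R l ↔ ∀ F₁ F₂ : PolySU3,
    Tendsto (fun s => toC ξ (twistedProduct (w s) (resOrbit ξ F₁) (resOrbit ξ F₂))) l
      (𝓝 (toC ξ (resOrbit ξ F₁ * resOrbit ξ F₂))) ∧
    Tendsto (fun s => toC ξ (R s • (twistedProduct (w s) (resOrbit ξ F₁) (resOrbit ξ F₂) -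
        twistedProduct (w s) (resOrbit ξ F₂) (resOrbit ξ F₁)))) l
      (𝓝 (toC ξ (Complex.I • resOrbit ξ (poissonBracket F₁ F₂)))) := by
  simp only [ContinuousMap.tendsto_iff_tendstoUniformly]
  rfl

theorem exists_eventually_eq_quantMap (hw : ∀ s, ∃ ω, IsUniversalCorrespondence ω ξ (w s))
    (hS : ∀ t, QuantTendsto w R l t) (f : PolyOrbit ξ) :
    ∃ (t : α → FreePoly) (t₀ : FreePoly), TendstoInSpan ℂ l t t₀ ∧ classMap ξ t₀ = f ∧
      ∀ᶠ s in l, w s (quantMap (R s) (t s)) = f := by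
  obtain ⟨n, c, rfl⟩ := exists_eq_sum_famBasis f
  choose τ hτ using fun a K => classMap_surjective ξ ((famBasis (tensorPow letterRep n) ξ a).1 K)
  obtain ⟨C, hC⟩ := exists_isFreeFam_forall_norm_sub_le (ξ := ξ)
    (continuous_tensorPow continuous_letterRep n)
  choose t ht hclose using fun a => hC (τ a)
  have hclass a K : classMap ξ (t a K) = (famBasis (tensorPow letterRep n) ξ a).1 K := by
    refine Subtype.ext (funext fun x => ?_)
    have h := hclose a _ (isEquivMap_classMap ξ) _ (famBasis _ ξ a).2 0 le_rfl (fun J => by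
      rw [AlgHom.toLinearMap_apply, hτ, sub_self, norm_zero]) K x
    rwa [mul_zero, norm_le_zero_iff, sub_eq_zero] at h
  obtain ⟨N, hN, hev⟩ := exists_tendsto_one_famBasis_eq_sum (l := l) (t := fun _ => t)
    (fun s => (hw s).choose_spec.isEquivMap (R s)) (fun _ => ht) fun a K => by
      rw [← hclass]
      exact tendsto_evalAt (hS (t a K)) _
  have hsum {q : FreePoly →ₗ[ℂ] PolyOrbit ξ} {M : Matrix _ _ ℂ}
      (hM : ∀ a K, (famBasis _ ξ a).1 K = ∑ a', M a' a • q (t a' K)) :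
      q (∑ p : (Fin n → Unit ⊕ Fin 8) × _ × _, (c p.1 p.2.1 * M p.2.2 p.2.1) • t p.2.2 p.1) =
        ∑ K, ∑ a, c K a • (famBasis (tensorPow letterRep n) ξ a).1 K := by
    simp only [map_sum, map_smul, Fintype.sum_prod_type, hM, Finset.smul_sum, smul_smul]
  refine ⟨_, _, tendstoInSpan_sum_smul (fun p : _ × _ × _ => t p.2.2 p.1) fun p =>
      tendsto_const_nhds.mul (tendsto_pi_nhds.mp (tendsto_pi_nhds.mp hN p.2.2) p.2.1),
    hsum (q := (classMap ξ).toLinearMap) (M := 1) fun a K => ?_,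
    hev.mono fun s hs => hsum (q := w s ∘ₗ (quantMap (R s)).toLinearMap) hs⟩
  simp only [Matrix.one_apply, ite_smul, one_smul, zero_smul, Finset.sum_ite_eq', Finset.mem_univ,
    if_true, AlgHom.toLinearMap_apply, hclass]

theorem tendsto_mul_of_quantTendsto (hS : ∀ t, QuantTendsto w R l t) {t t' : α → FreePoly}
    {t₀ t₀' : FreePoly} (ht : TendstoInSpan ℂ l t t₀) (ht' : TendstoInSpan ℂ l t' t₀') :
    Tendsto (fun s => toC ξ (w s (quantMap (R s) (t s * t' s)))) l
      (𝓝 (toC ξ (classMap ξ (t₀ * t₀')))) := by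
  let B (s : α) : FreePoly →ₗ[ℂ] FreePoly →ₗ[ℂ] C(adOrbit ξ, ℂ) :=
    (LinearMap.mul ℂ FreePoly).compr₂
      ((toC ξ).toLinearMap ∘ₗ w s ∘ₗ (quantMap (R s)).toLinearMap)
  let B₀ : FreePoly →ₗ[ℂ] FreePoly →ₗ[ℂ] C(adOrbit ξ, ℂ) :=
    (LinearMap.mul ℂ FreePoly).compr₂ ((toC ξ).toLinearMap ∘ₗ (classMap ξ).toLinearMap)
  exact ht.tendsto_apply₂ ht' (B := B) (B₀ := B₀) fun φ φ' => hS (φ * φ')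

theorem tendsto_smul_commutator_of_quantTendsto (hR : ∀ s, R s ≠ 0)
    (hS : ∀ t, QuantTendsto w R l t) {t t' : α → FreePoly} {t₀ t₀' : FreePoly}
    (ht : TendstoInSpan ℂ l t t₀) (ht' : TendstoInSpan ℂ l t' t₀') :
    Tendsto (fun s => toC ξ (R s • w s (quantMap (R s) (t s * t' s - t' s * t s)))) l
      (𝓝 (toC ξ (Complex.I • resOrbit ξ (poissonBracket (symbolMap t₀) (symbolMap t₀'))))) := by
  let B (s : α) : FreePoly →ₗ[ℂ] FreePoly →ₗ[ℂ] C(adOrbit ξ, ℂ) :=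
    (LinearMap.mul ℂ FreePoly - (LinearMap.mul ℂ FreePoly).flip).compr₂
      ((toC ξ).toLinearMap ∘ₗ (R s • w s ∘ₗ (quantMap (R s)).toLinearMap))
  let B₀ : FreePoly →ₗ[ℂ] FreePoly →ₗ[ℂ] C(adOrbit ξ, ℂ) :=
    (poissonBilin.compl₁₂ symbolMap.toLinearMap symbolMap.toLinearMap).compr₂
      ((toC ξ).toLinearMap ∘ₗ (Complex.I • (resHom ξ).toLinearMap))
  have hB (s : α) (φ φ' : FreePoly) :
      B s φ φ' = toC ξ (R s • w s (quantMap (R s) (φ * φ' - φ' * φ))) := rfl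
  have hB₀ (φ φ' : FreePoly) : B₀ φ φ' =
      toC ξ (Complex.I • resOrbit ξ (poissonBracket (symbolMap φ) (symbolMap φ'))) := by
    rw [← poissonBilin_apply, ← resHom_apply]
    rfl
  simp only [← hB, ← hB₀]
  refine ht.tendsto_apply₂ ht' fun φ φ' => ?_
  obtain ⟨b, hb, hsymb⟩ := hasPoissonComm φ φ'
  have hlim := hS b
  rw [QuantTendsto, classMap_apply, hsymb, ← resHom_apply, map_smul] at hlim
  refine hlim.congr fun s => ?_
  rw [← hb _ (hR s), map_smul, ← map_mul, ← map_mul, ← map_sub, hB]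

/-- If the symbols of all quantizations converge, then the twisted products of `f₁`, `f₂` are
eventually the symbols of products of quantizations, to which `hasPoissonComm` applies. -/
theorem hasPoissonLimit_of_quantTendsto (hw : ∀ s, ∃ ω, IsUniversalCorrespondence ω ξ (w s))
    (hR : ∀ s, R s ≠ 0) (hS : ∀ t, QuantTendsto w R l t) : HasPoissonLimit w R l := by
  refine hasPoissonLimit_iff.mpr fun F F' => ?_
  obtain ⟨t, t₀, ht, ht₀, hev⟩ := exists_eventually_eq_quantMap hw hS (resOrbit ξ F)
  obtain ⟨t', t₀', ht', ht₀', hev'⟩ := exists_eventually_eq_quantMap hw hS (resOrbit ξ F')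
  have hprod : ∀ᶠ s in l, twistedProduct (w s) (resOrbit ξ F) (resOrbit ξ F') =
        w s (quantMap (R s) (t s * t' s)) ∧
      twistedProduct (w s) (resOrbit ξ F') (resOrbit ξ F) =
        w s (quantMap (R s) (t' s * t s)) := by
    filter_upwards [hev, hev'] with s hs hs'
    obtain ⟨ω, hws⟩ := hw s
    simp only [← hs, ← hs', twistedProduct_apply hws, map_mul, and_self]
  rw [← ht₀, ← ht₀', ← map_mul, ← resOrbit_poissonBracket_congr ht₀ ht₀', ht₀, ht₀']
  constructor
  · refine (tendsto_mul_of_quantTendsto hS ht ht').congr' ?_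
    filter_upwards [hprod] with s hs
    rw [hs.1]
  · refine (tendsto_smul_commutator_of_quantTendsto hR hS ht ht').congr' ?_
    filter_upwards [hprod] with s hs
    rw [hs.1, hs.2, ← map_sub, ← map_sub]

end poisson

/-! ### Convergence of quantizations from the Poisson limit -/

section equivariance

variable {ξ : Mat3}

theorem isFreeFam_ι : IsFreeFam adRep (FreeAlgebra.ι ℂ : Fin 8 → FreePoly) := freeAct_ι

/-- The infinitesimal form of equivariance. -/
theorem sum_structConst_mul_equivFam_adRep {θ : Fin 8 → PolyOrbit ξ} (hθ : θ ∈ equivFam adRep ξ)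
    {k : Fin 8} {F : PolySU3} (hF : resOrbit ξ F = θ k) (l : Fin 8) (x : adOrbit ξ) :
    ∑ j, structConst l k j * (θ j).1 x =
      (resOrbit ξ (poissonBracket F (MvPolynomial.X l))).1 x := by
  choose Θ hΘ using fun j => exists_resOrbit (θ j)
  have hone : expSU l 0 = 1 := Subtype.ext (by rw [coe_expSU]; simp)
  have hrep (j : Fin 8) :
      HasDerivAt (fun t : ℝ => adRep (expSU l t) j k) (structConst l k j) 0 := by
    simp only [adRep_apply, adMat, coe_expSU, coe_expSU_inv]
    exact hasDerivAt_matrix_exp_smul_conj ((LinearMap.proj j).comp suCoordLin) (suBasis l)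
      (suBasis k)
  have hsum : HasDerivAt (fun t : ℝ => ∑ j, adRep (expSU l t) j k * (θ j).1 (adOn (expSU l t) x))
      (∑ j, (structConst l k j * (θ j).1 x + (1 : Matrix (Fin 8) (Fin 8) ℂ) j k *
        -(resOrbit ξ (poissonBracket (Θ j) (MvPolynomial.X l))).1 x)) 0 := by
    refine HasDerivAt.fun_sum fun j _ => ?_
    have h := (hrep j).mul (hasDerivAt_resOrbit (Θ j) l x)
    rwa [hone, map_one, adOn_one, hΘ] at h
  have hconst : (fun t : ℝ => ∑ j, adRep (expSU l t) j k * (θ j).1 (adOn (expSU l t) x)) =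
      fun _ => (θ k).1 x := funext fun t => (hθ (expSU l t) x k).symm
  rw [hconst] at hsum
  have hzero := hsum.unique (hasDerivAt_const 0 _)
  simp only [Finset.sum_add_distrib, Matrix.one_apply, ite_mul, one_mul, zero_mul,
    Finset.sum_ite_eq', Finset.mem_univ, if_true] at hzero
  rw [resOrbit_poissonBracket_congr (hF.trans (hΘ k).symm) rfl]
  linear_combination hzero

theorem IsUniversalCorrespondence.smul_commutator_quantMap {ω : Mat3}
    {w : USL3 →ₗ[ℂ] PolyOrbit ξ} (hw : IsUniversalCorrespondence ω ξ w) {R : ℂ} (hR : R ≠ 0)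
    (k : Fin 8) {u : USL3} {F : PolySU3} (hF : w u = resOrbit ξ F) :
    R • w (quantMap R (FreeAlgebra.ι ℂ k) * u - u * quantMap R (FreeAlgebra.ι ℂ k)) =
      Complex.I • resOrbit ξ (poissonBracket (MvPolynomial.X k) F) := by
  have hcoeff : R * -(Complex.I / R) = -Complex.I := by field_simp
  rw [quantMap_ι, smul_mul_assoc, mul_smul_comm, ← smul_sub, map_smul, hw.lie_apply k hF, smul_smul,
    hcoeff, poissonBracket_antisymm, ← resHom_apply, ← resHom_apply, map_neg, smul_neg, neg_smul,
    neg_neg]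

theorem tendsto_toC_of_tendsto_repr_sub_zero {T α : Type*} [Fintype T] [DecidableEq T]
    {D : SU3 →* Matrix T T ℂ} {l : Filter α} {h : α → equivFam D ξ} {h₀ : equivFam D ξ}
    (hh : ∀ a, Tendsto (fun s => (famBasis D ξ).repr (h₀ - h s) a) l (𝓝 0)) (K : T) :
    Tendsto (fun s => toC ξ ((h s).1 K)) l (𝓝 (toC ξ (h₀.1 K))) := by
  have hdiff (s : α) : h₀.1 K - (h s).1 K = _ := coe_equivFam_eq_sum (h₀ - h s) K
  have hsum := tendsto_finsetSum Finset.univ fun a _ =>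
    (hh a).smul_const (toC ξ ((famBasis D ξ a).1 K))
  simp only [← map_smul, ← map_sum, ← hdiff, zero_smul, Finset.sum_const_zero] at hsum
  simpa only [map_sub, sub_sub_cancel, map_zero, sub_zero] using hsum.const_sub (toC ξ (h₀.1 K))

/-- The coordinate `x_k` as a function on `O_ξ`. -/
def orbitCoord (ξ : Mat3) (k : Fin 8) : PolyOrbit ξ := resOrbit ξ (MvPolynomial.X k)

/-- The values at the base point of the rescaled commutators of an equivariant family with the
coordinates, with respect to a product `B`. -/
def baseCommutator (r : ℂ) (B : PolyOrbit ξ →ₗ[ℂ] PolyOrbit ξ →ₗ[ℂ] PolyOrbit ξ) :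
    equivFam adRep ξ →ₗ[ℂ] (Fin 8 × Fin 8 → ℂ) :=
  LinearMap.pi fun p => evalAt (basePoint ξ) ∘ₗ (r • (B - B.flip).flip (orbitCoord ξ p.2)) ∘ₗ
    LinearMap.proj p.1 ∘ₗ (equivFam adRep ξ).subtype

theorem baseCommutator_apply (r : ℂ) (B : PolyOrbit ξ →ₗ[ℂ] PolyOrbit ξ →ₗ[ℂ] PolyOrbit ξ)
    (θ : equivFam adRep ξ) (k l : Fin 8) : baseCommutator r B θ (k, l) =
      (r • (B (θ.1 k) (orbitCoord ξ l) - B (orbitCoord ξ l) (θ.1 k))).1 (basePoint ξ) := rfl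

/-- The values at the base point of `i` times the Poisson brackets of an equivariant family with
the coordinates, in the form given by `sum_structConst_mul_equivFam_adRep`. -/
def basePoisson (ξ : Mat3) : equivFam adRep ξ →ₗ[ℂ] (Fin 8 × Fin 8 → ℂ) :=
  LinearMap.pi fun p => Complex.I • ∑ j, structConst p.2 p.1 j •
    (LinearMap.proj j ∘ₗ evBase adRep ξ)

theorem basePoisson_apply (θ : equivFam adRep ξ) (k l : Fin 8) : basePoisson ξ θ (k, l) =
    Complex.I * ∑ j, structConst l k j * evBase adRep ξ θ j := by
  simp only [basePoisson, LinearMap.pi_apply, LinearMap.smul_apply, LinearMap.sum_apply,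
    LinearMap.comp_apply, LinearMap.proj_apply, smul_eq_mul]

theorem basePoisson_eq_poissonBracket (θ : equivFam adRep ξ) {k : Fin 8} {F : PolySU3}
    (hF : resOrbit ξ F = θ.1 k) (l : Fin 8) : basePoisson ξ θ (k, l) =
      (Complex.I • resOrbit ξ (poissonBracket F (MvPolynomial.X l))).1 (basePoint ξ) := by
  rw [basePoisson_apply]
  exact congrArg (Complex.I * ·) (sum_structConst_mul_equivFam_adRep θ.2 hF l _)

theorem basePoisson_injective : Function.Injective (basePoisson ξ) := by
  refine (injective_iff_map_eq_zero _).mpr fun θ hθ => evBase_injective ?_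
  rw [map_zero]
  refine eq_zero_of_forall_sum_structConst_mul fun l k => ?_
  have h := congrFun hθ (k, l)
  rw [basePoisson_apply] at h
  exact (mul_eq_zero.mp h).resolve_left Complex.I_ne_zero

end equivariance

section poisson

variable {ξ : Mat3} {α : Type*} {w : α → USL3 →ₗ[ℂ] PolyOrbit ξ} {R : α → ℂ} {l : Filter α}

theorem HasPoissonLimit.exists_tendsto (hR : ∀ s, R s ≠ 0) (hP : HasPoissonLimit w R l)
    (f : PolyOrbit ξ) :
    ∃ u : α → FreePoly, Tendsto (fun s => toC ξ (w s (quantMap (R s) (u s)))) l (𝓝 (toC ξ f)) := by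
  obtain ⟨F, rfl⟩ := exists_resOrbit f
  have h := (hasPoissonLimit_iff.mp hP F 1).1
  have hone : resOrbit ξ F * resOrbit ξ 1 = resOrbit ξ F := by
    rw [← resHom_apply 1, map_one, mul_one]
  rw [hone] at h
  choose u hu using fun s => quantMap_surjective (hR s)
    (Function.invFun (w s) (resOrbit ξ F) * Function.invFun (w s) (resOrbit ξ 1))
  refine ⟨u, ?_⟩
  simp only [hu]
  exact h

/-- The approximation of an equivariant basis by symbols can be made equivariant by averaging; an
approximation of a basis within a finite-dimensional space is eventually a basis. -/
theorem HasPoissonLimit.eventually_mem_range (hw : ∀ s, ∃ ω, IsUniversalCorrespondence ω ξ (w s))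
    (hR : ∀ s, R s ≠ 0) (hP : HasPoissonLimit w R l) (f : PolyOrbit ξ) :
    ∀ᶠ s in l, f ∈ LinearMap.range (w s) := by
  obtain ⟨n, c, rfl⟩ := exists_eq_sum_famBasis f
  choose u hu using fun a K =>
    hP.exists_tendsto hR ((famBasis (tensorPow letterRep n) ξ a).1 K)
  obtain ⟨C, hC⟩ := exists_isFreeFam_forall_norm_sub_le (ξ := ξ)
    (continuous_tensorPow continuous_letterRep n)
  choose t ht hclose using fun s a => hC fun K => u a K s
  have hq (s : α) : IsEquivMap (w s ∘ₗ (quantMap (R s)).toLinearMap) :=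
    (hw s).choose_spec.isEquivMap (R s)
  obtain ⟨N, -, hN⟩ := exists_tendsto_one_famBasis_eq_sum hq ht fun a K => by
    have hdist : Tendsto (fun s => C * ∑ J, ‖toC ξ (w s (quantMap (R s) (u a J s))) -
        toC ξ ((famBasis (tensorPow letterRep n) ξ a).1 J)‖) l (𝓝 0) := by
      have h := (tendsto_finsetSum Finset.univ fun J _ =>
        tendsto_iff_norm_sub_tendsto_zero.mp (hu a J)).const_mul C
      rwa [Finset.sum_const_zero, mul_zero] at h
    rw [tendsto_iff_norm_sub_tendsto_zero]
    refine squeeze_zero (fun _ => norm_nonneg _) (fun s => ?_) hdist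
    exact hclose s a _ (hq s) _ (famBasis _ ξ a).2 _
      (Finset.sum_nonneg fun _ _ => norm_nonneg _)
      (fun J => Finset.single_le_sum (f := fun J => ‖toC ξ (w s (quantMap (R s) (u a J s))) -
        toC ξ ((famBasis (tensorPow letterRep n) ξ a).1 J)‖) (fun _ _ => norm_nonneg _)
        (Finset.mem_univ J)) K _
  filter_upwards [hN] with s hs
  refine Submodule.sum_mem _ fun K _ => Submodule.sum_mem _ fun a _ => Submodule.smul_mem _ _ ?_
  rw [hs a K]
  exact Submodule.sum_mem _ fun a' _ => Submodule.smul_mem _ _ ⟨_, rfl⟩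

theorem HasPoissonLimit.exists_bilin (hw : ∀ s, ∃ ω, IsUniversalCorrespondence ω ξ (w s))
    (hR : ∀ s, R s ≠ 0) (hP : HasPoissonLimit w R l) :
    ∃ B : α → PolyOrbit ξ →ₗ[ℂ] PolyOrbit ξ →ₗ[ℂ] PolyOrbit ξ,
      (∀ s u v, B s (w s u) (w s v) = w s (u * v)) ∧
      (∀ f g, Tendsto (fun s => toC ξ (B s f g)) l (𝓝 (toC ξ (f * g)))) ∧
      ∀ F G, Tendsto
        (fun s => toC ξ (R s • (B s (resOrbit ξ F) (resOrbit ξ G) -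
          B s (resOrbit ξ G) (resOrbit ξ F)))) l
        (𝓝 (toC ξ (Complex.I • resOrbit ξ (poissonBracket F G)))) := by
  choose B hB using fun s => (hw s).choose_spec.exists_bilin
  have hP' := hasPoissonLimit_iff.mp hP
  have heq (f g : PolyOrbit ξ) : ∀ᶠ s in l, twistedProduct (w s) f g = B s f g := by
    filter_upwards [hP.eventually_mem_range hw hR f, hP.eventually_mem_range hw hR g]
    rintro s ⟨u, rfl⟩ ⟨v, rfl⟩
    rw [hB, twistedProduct_apply (hw s).choose_spec]
  refine ⟨B, hB, fun f g => ?_, fun F G => ?_⟩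
  · obtain ⟨F, rfl⟩ := exists_resOrbit f
    obtain ⟨G, rfl⟩ := exists_resOrbit g
    exact (hP' F G).1.congr' ((heq _ _).mono fun s hs => by rw [hs])
  · refine (hP' F G).2.congr' ?_
    filter_upwards [heq (resOrbit ξ F) (resOrbit ξ G), heq (resOrbit ξ G) (resOrbit ξ F)]
      with s h h'
    rw [h, h']

theorem tendstoInSpan_quantMap (hw : ∀ s, ∃ ω, IsUniversalCorrespondence ω ξ (w s)) {T : Type*}
    [Fintype T] [DecidableEq T] {D : SU3 →* Matrix T T ℂ} {F : T → FreePoly} (hF : IsFreeFam D F)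
    (hS : ∀ K, QuantTendsto w R l (F K)) (K : T) :
    TendstoInSpan ℂ l (fun s => w s (quantMap (R s) (F K))) (classMap ξ (F K)) := by
  let h (s : α) : equivFam D ξ := ⟨fun K => w s (quantMap (R s) (F K)),
    ((hw s).choose_spec.isEquivMap (R s)).mem_equivFam hF⟩
  let h₀ : equivFam D ξ :=
    ⟨fun K => classMap ξ (F K), (isEquivMap_classMap ξ).mem_equivFam hF⟩
  have hs (s : α) : w s (quantMap (R s) (F K)) = _ := coe_equivFam_eq_sum (h s) K
  have hs₀ : classMap ξ (F K) = _ := coe_equivFam_eq_sum h₀ K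
  rw [hs₀]
  simp only [hs]
  exact tendstoInSpan_sum_smul _ <| tendsto_famBasis_repr fun K => tendsto_evalAt (hS K) _

theorem HasPoissonLimit.quantTendsto_mul (hw : ∀ s, ∃ ω, IsUniversalCorrespondence ω ξ (w s))
    (hR : ∀ s, R s ≠ 0) (hP : HasPoissonLimit w R l) {T T' : Type*} [Fintype T] [DecidableEq T]
    [Fintype T'] [DecidableEq T'] {D : SU3 →* Matrix T T ℂ} {D' : SU3 →* Matrix T' T' ℂ}
    {F : T → FreePoly} {F' : T' → FreePoly} (hF : IsFreeFam D F) (hF' : IsFreeFam D' F')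
    (hS : ∀ K, QuantTendsto w R l (F K)) (hS' : ∀ K, QuantTendsto w R l (F' K)) (K : T) (K' : T') :
    QuantTendsto w R l (F K * F' K') := by
  obtain ⟨B, hB, hmul, -⟩ := hP.exists_bilin hw hR
  have h := (tendstoInSpan_quantMap hw hF hS K).tendsto_apply₂
    (tendstoInSpan_quantMap hw hF' hS' K') (B := fun s => (B s).compr₂ (toC ξ).toLinearMap)
    (B₀ := (LinearMap.mul ℂ (PolyOrbit ξ)).compr₂ (toC ξ).toLinearMap) hmul
  simp only [LinearMap.compr₂_apply, hB, ← map_mul, LinearMap.mul_apply'] at h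
  exact h

/-- If the twisted products have the Poisson limit, then the defect of the symbols of the generators
tends to `0`: by equivariance, its rescaled twisted commutators with the coordinates determine it in
the limit, and these tend to `0`. -/
theorem HasPoissonLimit.quantTendsto_ι (hw : ∀ s, ∃ ω, IsUniversalCorrespondence ω ξ (w s))
    (hR : ∀ s, R s ≠ 0) (hP : HasPoissonLimit w R l) (k : Fin 8) :
    QuantTendsto w R l (FreeAlgebra.ι ℂ k) := by
  obtain ⟨B, hB, -, hcomm⟩ := hP.exists_bilin hw hR
  let h₀ : equivFam adRep ξ :=
    ⟨fun k => classMap ξ (FreeAlgebra.ι ℂ k), (isEquivMap_classMap ξ).mem_equivFam isFreeFam_ι⟩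
  let h (s : α) : equivFam adRep ξ := ⟨fun k => w s (quantMap (R s) (FreeAlgebra.ι ℂ k)),
    ((hw s).choose_spec.isEquivMap (R s)).mem_equivFam isFreeFam_ι⟩
  have hh₀ (k : Fin 8) : resOrbit ξ (MvPolynomial.X k) = h₀.1 k :=
    congrArg (resOrbit ξ) (symbolMap_ι k).symm
  have hlim (θ : equivFam adRep ξ) :
      Tendsto (fun s => baseCommutator (R s) (B s) θ) l (𝓝 (basePoisson ξ θ)) := by
    refine tendsto_pi_nhds.mpr fun (k, l) => ?_
    obtain ⟨F, hF⟩ := exists_resOrbit (θ.1 k)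
    simp only [baseCommutator_apply, basePoisson_eq_poissonBracket θ hF, ← hF, orbitCoord]
    exact tendsto_evalAt (hcomm F _) _
  have heq : ∀ᶠ s in l, baseCommutator (R s) (B s) (h s) = basePoisson ξ h₀ := by
    filter_upwards [eventually_all.mpr fun l => hP.eventually_mem_range hw hR (orbitCoord ξ l)]
      with s hs
    funext (k, l)
    obtain ⟨u, hu⟩ := hs l
    rw [baseCommutator_apply, basePoisson_eq_poissonBracket h₀ (hh₀ k),
      ← (hw s).choose_spec.smul_commutator_quantMap (hR s) k hu, ← hu, hB, hB, map_sub]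
  have hdefect : Tendsto (fun s => baseCommutator (R s) (B s) (h₀ - h s)) l (𝓝 0) := by
    have hdiff := (hlim h₀).sub_const (basePoisson ξ h₀)
    rw [sub_self] at hdiff
    refine hdiff.congr' (heq.mono fun s hs => ?_)
    rw [← hs, ← map_sub]
  exact tendsto_toC_of_tendsto_repr_sub_zero (tendsto_repr_zero_of_tendsto_apply_zero
    (famBasis adRep ξ) basePoisson_injective hlim hdefect) k

theorem HasPoissonLimit.quantTendsto (hw : ∀ s, ∃ ω, IsUniversalCorrespondence ω ξ (w s))
    (hR : ∀ s, R s ≠ 0) (hP : HasPoissonLimit w R l) (t : FreePoly) : QuantTendsto w R l t := by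
  have hone : QuantTendsto w R l 1 := by
    refine tendsto_const_nhds.congr fun s => ?_
    rw [map_one (quantMap (R s)), (hw s).choose_spec.map_one, map_one (classMap ξ)]
  have hletter : ∀ k, QuantTendsto w R l (letter k)
    | .inl _ => hone
    | .inr k => hP.quantTendsto_ι hw hR k
  have hword (N : ℕ) : ∀ I, QuantTendsto w R l (wordPoly N I) := by
    induction N with
    | zero => exact fun I => (wordPoly_zero I).symm ▸ hone
    | succ N ih =>
      intro I
      rw [wordPoly_succ]
      exact hP.quantTendsto_mul hw hR isFreeFam_letter (isFreeFam_wordPoly N) hletter ih _ _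
  obtain ⟨N, hN⟩ := (eventually_mem_span_range_wordPoly t).exists
  obtain ⟨c, rfl⟩ := (Submodule.mem_span_range_iff_exists_fun ℂ).mp hN
  simp only [QuantTendsto, map_sum, map_smul]
  exact tendsto_finsetSum _ fun I _ => (hword N I).const_smul (c I)

end poisson

/-! ### Leading parts of quantizations -/

open UniversalEnvelopingAlgebra (ι)

/-- The noncommutative linear polynomial with the coordinates of an element of `sl(3)`. -/
def freeLin : SL3Lie →ₗ[ℂ] FreePoly := suLieBasis.constr ℂ (FreeAlgebra.ι ℂ)

theorem freeLin_suLieBasis (k : Fin 8) : freeLin (suLieBasis k) = FreeAlgebra.ι ℂ k :=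
  suLieBasis.constr_basis ℂ _ k

theorem quantMap_freeLin (r : ℂ) (X : SL3Lie) :
    quantMap r (freeLin X) = -(Complex.I / r) • ι ℂ X := by
  have h : (quantMap r).toLinearMap ∘ₗ freeLin =
      -(Complex.I / r) • (ι ℂ : SL3Lie →ₗ⁅ℂ⁆ USL3).toLinearMap := suLieBasis.ext fun k => by
    simp only [LinearMap.comp_apply, freeLin_suLieBasis, AlgHom.toLinearMap_apply, quantMap_ι]
    rfl
  exact LinearMap.congr_fun h X

theorem symbolMap_freeLin (X : SL3Lie) : symbolMap (freeLin X) = -linPoly X := by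
  simp only [freeLin, Module.Basis.constr_apply_fintype, map_sum, map_smul, symbolMap_ι, linPoly,
    ← Finset.sum_neg_distrib]
  refine Finset.sum_congr rfl fun k _ => ?_
  rw [Module.Basis.equivFun_apply, suLieBasis_repr, suCoord_eq_neg_trace, trace_mul_comm,
    MvPolynomial.smul_eq_C_mul, map_neg, neg_mul]

/-- The algebra homomorphism from symbols of ordered monomials to functions on `O_ξ`, through which
`β` factors. -/
def orbitBeta (ξ : Mat3) : MvPolynomial (Fin 8) ℂ →ₐ[ℂ] PolyOrbit ξ :=
  (resHom ξ).comp (MvPolynomial.aeval fun j => linPoly (gtMatrix j))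

theorem resOrbit_betaHom_pbwMap (ξ : Mat3) (d : ℕ) (p : MvPolynomial (Fin 8) ℂ) :
    resOrbit ξ (betaHom d (pbwMap p)) = orbitBeta ξ (MvPolynomial.homogeneousComponent d p) := by
  rw [betaHom_pbwMap]
  rfl

theorem classMap_freeLin (ξ : Mat3) (X : SL3Lie) :
    classMap ξ (freeLin X) = -orbitBeta ξ (linForm gtLieBasis X) := by
  have h : (classMap ξ).toLinearMap ∘ₗ freeLin =
      -((orbitBeta ξ).toLinearMap ∘ₗ linForm gtLieBasis) := gtLieBasis.ext fun j => by
    rw [LinearMap.comp_apply, LinearMap.neg_apply, LinearMap.comp_apply, linForm_basis]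
    simp only [AlgHom.toLinearMap_apply, classMap_apply, symbolMap_freeLin, orbitBeta,
      AlgHom.comp_apply, MvPolynomial.aeval_X, gtLieBasis_apply, ← resHom_apply, map_neg]
    rfl
  exact LinearMap.congr_fun h X

theorem quantMap_prod_freeLin (r : ℂ) (L : List SL3Lie) :
    quantMap r (L.map freeLin).prod = (-(Complex.I / r)) ^ L.length • (L.map (ι ℂ)).prod := by
  induction L with
  | nil => simp
  | cons X L ih =>
    rw [List.map_cons, List.prod_cons, map_mul, ih, quantMap_freeLin, List.map_cons,
      List.prod_cons, List.length_cons, smul_mul_smul_comm, pow_succ']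

theorem classMap_prod_freeLin (ξ : Mat3) (L : List SL3Lie) :
    classMap ξ (L.map freeLin).prod =
      (-1 : ℂ) ^ L.length • orbitBeta ξ (L.map (linForm gtLieBasis)).prod := by
  induction L with
  | nil => simp
  | cons X L ih =>
    rw [List.map_cons, List.prod_cons, map_mul, ih, classMap_freeLin, List.map_cons,
      List.prod_cons, map_mul, List.length_cons, pow_succ', ← smul_mul_smul_comm, neg_one_smul]

theorem span_range_prod_freeLin :
    Submodule.span ℂ (Set.range fun L : List SL3Lie => (L.map freeLin).prod) = ⊤ := by
  have hadjoin : (⊤ : Submodule ℂ FreePoly) =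
      Submodule.span ℂ
        (Submonoid.closure (Set.range (FreeAlgebra.ι ℂ : Fin 8 → FreePoly)) : Set FreePoly) := by
    rw [← Algebra.adjoin_eq_span, FreeAlgebra.adjoin_range_ι, Algebra.top_toSubmodule]
  rw [hadjoin]
  refine (Submodule.span_mono fun t ht => ?_).antisymm' (hadjoin ▸ le_top)
  obtain ⟨L, hL, rfl⟩ := Submonoid.exists_list_of_mem_closure ht
  have hrange : L ∈ Set.range (List.map freeLin) := by
    rw [Set.range_list_map]
    intro t ht
    obtain ⟨k, rfl⟩ := hL t ht
    exact ⟨suLieBasis k, freeLin_suLieBasis k⟩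
  obtain ⟨L, rfl⟩ := hrange
  exact ⟨L, rfl⟩

section leading

variable {ξ : Mat3} {α : Type*} (w : α → USL3 →ₗ[ℂ] PolyOrbit ξ) (R : α → ℂ) (l : Filter α)

/-- The rescaled symbols of `u` converge uniformly to `(-i)^{deg u} β_{deg u}[u]` on `O_ξ`. -/
def LeadingTendsto (u : USL3) : Prop :=
  TendstoUniformly (fun s (x : adOrbit ξ) => (R s ^ Udeg u)⁻¹ * (w s u).1 x)
    (fun x => (-Complex.I) ^ Udeg u * (resOrbit ξ (betaHom (Udeg u) u)).1 x) l

/-- The symbols of the element of `U(sl(3))` with PBW coordinates `p`, rescaled as for an element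
of degree `n`, converge uniformly to the function given by the part of degree `n` of `p`. -/
def RescaledTendsto (n : ℕ) (p : MvPolynomial (Fin 8) ℂ) : Prop :=
  Tendsto (fun s => (R s ^ n)⁻¹ • toC ξ (w s (pbwMap p))) l
    (𝓝 ((-Complex.I) ^ n • toC ξ (orbitBeta ξ (MvPolynomial.homogeneousComponent n p))))

variable {w R l}

theorem leadingTendsto_pbwMap_iff {p : MvPolynomial (Fin 8) ℂ} :
    LeadingTendsto w R l (pbwMap p) ↔ RescaledTendsto w R l p.totalDegree p := by
  rw [LeadingTendsto, Udeg_pbwMap, resOrbit_betaHom_pbwMap, RescaledTendsto,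
    ContinuousMap.tendsto_iff_tendstoUniformly]
  rfl

theorem tendsto_inv_pow_mul_pow (hR : ∀ s, R s ≠ 0) (hR0 : Tendsto (fun s => (R s)⁻¹) l (𝓝 0))
    {m n : ℕ} (h : m < n) : Tendsto (fun s => (R s ^ n)⁻¹ * R s ^ m) l (𝓝 0) := by
  have hpow := hR0.pow (n - m)
  rw [zero_pow (Nat.sub_ne_zero_of_lt h)] at hpow
  refine hpow.congr fun s => ?_
  rw [inv_pow, pow_sub₀ _ (hR s) h.le, mul_inv, inv_inv]

theorem RescaledTendsto.mono (hR : ∀ s, R s ≠ 0) (hR0 : Tendsto (fun s => (R s)⁻¹) l (𝓝 0))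
    {m n : ℕ} {p : MvPolynomial (Fin 8) ℂ} (h : RescaledTendsto w R l m p)
    (hp : p.totalDegree ≤ m) (hmn : m ≤ n) : RescaledTendsto w R l n p := by
  rcases hmn.eq_or_lt with rfl | hlt
  · exact h
  · have hlim := (tendsto_inv_pow_mul_pow hR hR0 hlt).smul h
    rw [zero_smul] at hlim
    rw [RescaledTendsto, MvPolynomial.homogeneousComponent_eq_zero _ _ (hp.trans_lt hlt), map_zero,
      map_zero, smul_zero]
    refine hlim.congr fun s => ?_
    rw [smul_smul, mul_assoc, mul_inv_cancel₀ (pow_ne_zero _ (hR s)), mul_one]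

theorem quantTendsto_prod_freeLin_iff (L : List SL3Lie) :
    QuantTendsto w R l (L.map freeLin).prod ↔
      Tendsto (fun s => (R s ^ L.length)⁻¹ • toC ξ (w s (L.map (ι ℂ)).prod)) l
        (𝓝 ((-Complex.I) ^ L.length • toC ξ (orbitBeta ξ (L.map (linForm gtLieBasis)).prod))) := by
  have hsq : (-1 : ℂ) ^ L.length = (-Complex.I) ^ L.length * (-Complex.I) ^ L.length := by
    rw [← mul_pow, neg_mul_neg, Complex.I_mul_I]
  have hquant (s : α) : toC ξ (w s (quantMap (R s) (L.map freeLin).prod)) =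
      (-Complex.I) ^ L.length • (R s ^ L.length)⁻¹ • toC ξ (w s (L.map (ι ℂ)).prod) := by
    rw [quantMap_prod_freeLin, map_smul, map_smul, smul_smul, ← neg_div, div_eq_mul_inv, mul_pow,
      inv_pow]
  rw [QuantTendsto, classMap_prod_freeLin, map_smul, hsq, mul_smul, funext hquant]
  exact tendsto_const_smul_iff₀ (pow_ne_zero _ (neg_ne_zero.mpr Complex.I_ne_zero))

theorem rescaledTendsto_monomial (hS : ∀ t, QuantTendsto w R l t) (m : Fin 8 →₀ ℕ) :
    RescaledTendsto w R l m.degree (MvPolynomial.monomial m 1) := by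
  have hword : (((orderedWord m).map gtLieBasis).map (ι ℂ)).prod =
      pbwMap (MvPolynomial.monomial m 1) := by
    rw [← orderedMap_gtLieBasis, orderedMap_monomial, one_smul, ← wordProd_orderedWord, wordProd,
      List.map_map]
    rfl
  have h := (quantTendsto_prod_freeLin_iff _).mp
    (hS (((orderedWord m).map gtLieBasis).map freeLin).prod)
  rw [List.length_map, length_orderedWord, prod_map_linForm_orderedWord, hword] at h
  rwa [RescaledTendsto, MvPolynomial.homogeneousComponent_of_mem
    (MvPolynomial.isHomogeneous_monomial 1 rfl), if_pos rfl]

theorem rescaledTendsto_of_quantTendsto (hR : ∀ s, R s ≠ 0)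
    (hR0 : Tendsto (fun s => (R s)⁻¹) l (𝓝 0)) (hS : ∀ t, QuantTendsto w R l t) {n : ℕ}
    {p : MvPolynomial (Fin 8) ℂ} (hp : p.totalDegree ≤ n) : RescaledTendsto w R l n p := by
  rw [← mem_restrictSupport_degree_lt_iff, MvPolynomial.restrictSupport_eq_span] at hp
  induction hp using Submodule.span_induction with
  | mem _ hp =>
    obtain ⟨m, hm, rfl⟩ := hp
    exact (rescaledTendsto_monomial hS m).mono hR hR0
      (MvPolynomial.isHomogeneous_monomial _ rfl).totalDegree_le (Nat.le_of_lt_succ hm)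
  | zero => simpa only [RescaledTendsto, map_zero, smul_zero] using tendsto_const_nhds
  | add p q _ _ hp hq => simpa only [RescaledTendsto, map_add, smul_add] using hp.add hq
  | smul c p _ hp =>
    simpa only [RescaledTendsto, map_smul, smul_comm _ c] using hp.const_smul c

theorem homogeneousComponent_add_eq_left {σ A : Type*} [CommSemiring A] {n : ℕ}
    {p q : MvPolynomial σ A} (hp : p.IsHomogeneous n)
    (hq : q ∈ MvPolynomial.restrictSupport A {m | m.degree < n}) :
    MvPolynomial.homogeneousComponent n (p + q) = p := by
  have hq0 : MvPolynomial.homogeneousComponent n q = 0 := by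
    rw [MvPolynomial.homogeneousComponent_apply]
    exact Finset.sum_eq_zero fun m hm => absurd (Finset.mem_filter.mp hm).2
      ((MvPolynomial.mem_restrictSupport_iff _).mp hq (Finset.mem_filter.mp hm).1).ne
  rw [map_add, MvPolynomial.homogeneousComponent_of_mem hp, if_pos rfl, hq0, add_zero]

theorem quantTendsto_of_rescaledTendsto
    (h : ∀ (n : ℕ) (p : MvPolynomial (Fin 8) ℂ), p.totalDegree ≤ n → RescaledTendsto w R l n p)
    (t : FreePoly) : QuantTendsto w R l t := by
  have ht : t ∈ Submodule.span ℂ (Set.range fun L : List SL3Lie => (L.map freeLin).prod) :=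
    span_range_prod_freeLin ▸ Submodule.mem_top
  induction ht using Submodule.span_induction with
  | mem _ ht =>
    obtain ⟨L, rfl⟩ := ht
    obtain ⟨q, hq, hLq⟩ := prod_ι_sub_orderedMap_mem gtLieBasis L
    have hhom := prod_linForm_isHomogeneous gtLieBasis L
    have hdeg := (MvPolynomial.totalDegree_add _ _).trans <| max_le hhom.totalDegree_le <|
      mem_restrictSupport_degree_lt_iff.mp <|
        MvPolynomial.restrictSupport_mono _ (fun _ hm => Nat.lt_succ_of_lt hm) hq
    have hlim := h _ _ hdeg
    rw [RescaledTendsto, homogeneousComponent_add_eq_left hhom hq, map_add,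
      ← orderedMap_gtLieBasis, hLq, add_sub_cancel] at hlim
    exact (quantTendsto_prod_freeLin_iff L).mpr hlim
  | zero => simpa only [QuantTendsto, map_zero] using tendsto_const_nhds
  | add t t' _ _ ht ht' => simpa only [QuantTendsto, map_add] using ht.add ht'
  | smul c t _ ht => simpa only [QuantTendsto, map_smul] using ht.const_smul c

theorem forall_leadingTendsto_iff (hR : ∀ s, R s ≠ 0) (hR0 : Tendsto (fun s => (R s)⁻¹) l (𝓝 0)) :
    (∀ u, LeadingTendsto w R l u) ↔ ∀ t, QuantTendsto w R l t := by
  rw [pbwMap_surjective.forall]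
  simp only [leadingTendsto_pbwMap_iff]
  refine ⟨fun h => ?_, fun h p => rescaledTendsto_of_quantTendsto hR hR0 h le_rfl⟩
  exact quantTendsto_of_rescaledTendsto fun n p hp => (h p).mono hR hR0 le_rfl hp

end leading

/-! ### Dominant weights and the main theorem -/

theorem ofReal_sqrt_ne_zero {a : ℝ} (ha : 0 < a) : ((√a : ℝ) : ℂ) ≠ 0 :=
  Complex.ofReal_ne_zero.mpr (Real.sqrt_ne_zero'.mpr ha)

theorem fundWeight₁_eq : fundWeight₁ = Complex.I • Matrix.diagonal ![2 / 3, -1 / 3, -1 / 3] := by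
  have h2 := ofReal_sqrt_mul_self (a := 2) (by norm_num)
  have h3 := ofReal_sqrt_mul_self (a := 3) (by norm_num)
  have h6 : ((√6 : ℝ) : ℂ) = ((√2 : ℝ) : ℂ) * ((√3 : ℝ) : ℂ) := by
    rw [← Complex.ofReal_mul, ← Real.sqrt_mul (by norm_num)]; norm_num
  have hn2 := ofReal_sqrt_ne_zero (a := 2) (by norm_num)
  have hn3 := ofReal_sqrt_ne_zero (a := 3) (by norm_num)
  push_cast at h2 h3
  ext i j
  fin_cases i <;> fin_cases j <;>
    simp [fundWeight₁, suBasis, gellMann, h6] <;> field_simp <;>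
    simp only [pow_two, h2, h3] <;> ring

theorem fundWeight₂_eq : fundWeight₂ = Complex.I • Matrix.diagonal ![1 / 3, 1 / 3, -2 / 3] := by
  have h3 := ofReal_sqrt_mul_self (a := 3) (by norm_num)
  have hn2 := ofReal_sqrt_ne_zero (a := 2) (by norm_num)
  have hn3 := ofReal_sqrt_ne_zero (a := 3) (by norm_num)
  push_cast at h3
  ext i j
  fin_cases i <;> fin_cases j <;>
    simp [fundWeight₂, suBasis, gellMann] <;> field_simp <;> simp only [pow_two, h3]

theorem smul_fundWeight_add_injective {a b a' b' : ℝ}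
    (h : a • fundWeight₁ + b • fundWeight₂ = a' • fundWeight₁ + b' • fundWeight₂) :
    a = a' ∧ b = b' := by
  rw [fundWeight₁_eq, fundWeight₂_eq] at h
  have h0 : a * (2 / 3) + b * 3⁻¹ = a' * (2 / 3) + b' * 3⁻¹ := by
    simpa using congrArg Complex.im (congrFun (congrFun h 0) 0)
  have h1 : a * (-1 / 3) + b * 3⁻¹ = a' * (-1 / 3) + b' * 3⁻¹ := by
    simpa using congrArg Complex.im (congrFun (congrFun h 1) 1)
  constructor <;> linarith

/-- The squared norm of a point of `unitChamber` is `1`, whereas that of a nonzero dominant weight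
is at least `2 / 3`. -/
theorem two_thirds_le_sq_of_isDominantWeight {ξ : Mat3} (hξ : ξ ∈ unitChamber) {R : ℝ} (hR : 0 < R)
    (h : IsDominantWeight (R • ξ)) : 2 / 3 ≤ R ^ 2 := by
  obtain ⟨x, y, -, -, hxy, rfl⟩ := hξ
  obtain ⟨p, q, hpq⟩ := h
  rw [smul_smul, smul_add, smul_smul, smul_smul] at hpq
  obtain ⟨hp, hq⟩ := smul_fundWeight_add_injective hpq
  have hsqrt : √(3 / 2) * √(3 / 2) = 3 / 2 := Real.mul_self_sqrt (by norm_num)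
  have hnorm : ((p ^ 2 + p * q + q ^ 2 : ℕ) : ℝ) = 3 / 2 * R ^ 2 := by
    push_cast
    rw [← hp, ← hq]
    linear_combination (R ^ 2 * (x ^ 2 + x * y + y ^ 2)) * hsqrt + (3 / 2 * R ^ 2) * hxy
  have hpos : 0 < p ^ 2 + p * q + q ^ 2 := by
    rw [← Nat.cast_pos (α := ℝ), hnorm]
    positivity
  have hone : (1 : ℝ) ≤ ((p ^ 2 + p * q + q ^ 2 : ℕ) : ℝ) := by exact_mod_cast hpos
  linarith

theorem integralRadius_pos {ξ : Mat3} (hξ : ξ ∈ rationalPoints) : 0 < integralRadius ξ := by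
  have h : 1 / 2 ≤ integralRadius ξ := by
    refine le_csInf hξ.2 fun R hR => ?_
    have hsq := two_thirds_le_sq_of_isDominantWeight hξ.1 hR.1 hR.2
    nlinarith [hR.1]
  linarith

section main

variable {ξ : Mat3} {α : Type*} {w : α → USL3 →ₗ[ℂ] PolyOrbit ξ} {R : α → ℂ} {l : Filter α}

theorem hasPoissonLimit_iff_forall_quantTendsto
    (hw : ∀ s, ∃ ω, IsUniversalCorrespondence ω ξ (w s)) (hR : ∀ s, R s ≠ 0) :
    HasPoissonLimit w R l ↔ ∀ t, QuantTendsto w R l t :=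
  ⟨fun h => h.quantTendsto hw hR, hasPoissonLimit_of_quantTendsto hw hR⟩

theorem theorem3p12_general (hw : ∀ᶠ s in l, ∃ ω, IsUniversalCorrespondence ω ξ (w s))
    (hR : Tendsto R l (Bornology.cobounded ℂ)) :
    HasPoissonLimit w R l ↔ ∀ u, LeadingTendsto w R l u := by
  let S : Set α := {s | (∃ ω, IsUniversalCorrespondence ω ξ (w s)) ∧ R s ≠ 0}
  have hS : S ∈ l := hw.and (hR.eventually_ne_cobounded 0)
  have hl : map ((↑) : S → α) (comap (↑) l) = l := map_comap_of_mem (by rwa [Subtype.range_coe])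
  have hR0 : Tendsto (fun s : S => (R s)⁻¹) (comap (↑) l) (𝓝 0) :=
    (tendsto_inv₀_cobounded.comp hR).comp tendsto_comap
  rw [← hl]
  exact (hasPoissonLimit_iff_forall_quantTendsto (w := fun s : S => w s) (R := fun s : S => R s)
    (fun s => s.2.1) fun s => s.2.2).trans (forall_leadingTendsto_iff (fun s => s.2.2) hR0).symm

end main

/-- A `ξ`-ray of universal correspondences is of Poisson type if and only if
`(s r(ξ))^{-deg u} w^s[u] → (-i)^{deg u} β_{deg u}[u]|O_ξ` uniformly, for every `u ∈ U(sl(3))`. -/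
theorem theorem3p12 (ξ : Mat3) (hξ : ξ ∈ rationalPoints)
    (w : ℕ → USL3 →ₗ[ℂ] PolyOrbit ξ) (hw : IsUniversalRay ξ w) :
    IsPoissonType ξ w ↔
      ∀ u : USL3, TendstoUniformly
        (fun (s : ℕ) (x : adOrbit ξ) =>
          (((s * integralRadius ξ : ℝ) : ℂ) ^ Udeg u)⁻¹ * (w s u).1 x)
        (fun x => (-Complex.I) ^ Udeg u * (resOrbit ξ (betaHom (Udeg u) u)).1 x) atTop :=
  theorem3p12_general ((eventually_ge_atTop 1).mono fun s hs => ⟨_, hw s hs⟩) <|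
    (RCLike.tendsto_ofReal_atTop_cobounded ℂ).comp <|
      tendsto_natCast_atTop_atTop.atTop_mul_const (integralRadius_pos hξ)

end
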